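/- Let $L,l,d,\epsilon_{ox},\epsilon_{ch}>0$, $\Omega=(0,L)\times(-\frac l2,\frac l2)$, $\Omega_1=(0,L)\times(0,\frac l2)$, $\Omega_2=(0,L)\times(-\frac l2,0)$, and $\gamma=(0,L)\times\{0\}$, identified with the interval $(0,L)$. Let $\Gamma_D\subset\partial\Omega$, $\Gamma_N=\partial\Omega\setminus\Gamma_D$, and assume $\overline{\Gamma_N}\cap\overline\gamma=\emptyset$. Put $\Gamma_D^i=\partial\Omega_i\cap\Gamma_D$ and, for $\Gamma\subset\partial\Omega_i$, let $H^1_{0,\Gamma}(\Omega_i)=\{v\in H^1(\Omega_i): v=0 \text{ on }\Gamma\}$ (in the sense of traces), with the norm $\|\cdot\|_{1,\Omega_i}$ of $H^1(\Omega_i)$. Let $V^i=H^1_{0,\Gamma_D^i}(\Omega_i)$, $V^\gamma=H^1_0(\gamma)$ and $\mathbf V=V^1\times V^2\times V^\gamma$ with $\|\mathbf u\|_{\mathbf V}=\big(\sum_{i=1}^2\|u_i\|_{1,\Omega_i}^2+\|u_\gamma\|_{1,\gamma}^2\big)^{1/2}$. Let $H^{1/2}_{00}(\gamma)$ be the space of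 traces on $\gamma$ of functions in $H^1_{0,\partial\Omega_1\setminus\gamma}(\Omega_1)$, with the norm $\|\sigma\|_{1/2,\gamma}=\inf\{\|v\|_{1,\Omega_1}: v\in H^1_{0,\partial\Omega_1\setminus\gamma}(\Omega_1),\ v|_\gamma=\sigma\}$ (by reflection, $\Omega_2$ gives the same space and norm). Let $\Lambda^1=\Lambda^2=(H^{1/2}_{00}(\gamma))'$ be its dual, with duality pairing $\langle\cdot,\cdot\rangle_\gamma$, and let $\boldsymbol\Lambda=\Lambda^1\times\Lambda^2$ with $\|\boldsymbol\lambda\|_{\boldsymbol\Lambda}=\big(\sum_{i=1}^2\|\lambda_i\|_{-1/2,\gamma}^2\big)^{1/2}$, where $\|\lambda_i\|_{-1/2,\gamma}=\sup\{\langle\lambda_i,v|_\gamma\rangle_\gamma/\|v\|_{1,\Omega_i}: 0\ne v\in H^1_{0,\partial\Omega_i\setminus\gamma}(\Omega_i)\}$. Define $$\mathbf a(\mathbf u,\mathbf v)=\sum_{i=1}^2\int_{\Omega_i}\epsilon_{ox}\nabla u_i\cdot\nabla v_i\,dx\,dy+d\int_\gamma\epsilon_{ch}u_\gamma'v_\gamma'\,dx,\qquad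 \mathbf b(\boldsymbol\mu,\mathbf u)=\sum_{i=1}^2\langle\mu_i,u_i|_\gamma-u_\gamma\rangle_\gamma .$$ Then these objects are well defined: every $v\in V^i$ has a unique trace on $\gamma$, this trace lies in $H^{1/2}_{00}(\gamma)$, $H^1_0(\gamma)\subset H^{1/2}_{00}(\gamma)$, and the suprema $\|\lambda_i\|_{-1/2,\gamma}$ are finite. Moreover there are constants $\alpha_1,\alpha_2,M,\beta>0$, independent of $\rho$, such that $$\mathbf a(\mathbf u,\mathbf v)\le\alpha_1\|\mathbf u\|_{\mathbf V}\|\mathbf v\|_{\mathbf V},\quad \mathbf a(\mathbf u,\mathbf u)\ge\alpha_2\|\mathbf u\|_{\mathbf V}^2,\quad \mathbf b(\boldsymbol\mu,\mathbf v)\le M\|\boldsymbol\mu\|_{\boldsymbol\Lambda}\|\mathbf v\|_{\mathbf V},\quad \inf_{0\ne\boldsymbol\lambda\in\boldsymbol\Lambda}\ \sup_{0\ne\mathbf v\in\mathbf V}\frac{\mathbf b(\boldsymbol\lambda,\mathbf v)}{\|\boldsymbol\lambda\|_{\boldsymbol\Lambda}\|\mathbf v\|_{\mathbf V}}\ge\beta$$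 for all $\mathbf u,\mathbf v\in\mathbf V$ and $\boldsymbol\mu\in\boldsymbol\Lambda$. For every $\rho\in L^2(\gamma)$ there is a unique $(\mathbf u,\boldsymbol\lambda)\in\mathbf V\times\boldsymbol\Lambda$ such that $$\mathbf a(\mathbf u,\mathbf v)-\mathbf b(\boldsymbol\lambda,\mathbf v)=\int_\gamma\rho\,v_\gamma\,dx\quad\forall\,\mathbf v\in\mathbf V,\qquad \mathbf b(\boldsymbol\mu,\mathbf u)=0\quad\forall\,\boldsymbol\mu\in\boldsymbol\Lambda,$$ and for all constants $\alpha_1,\alpha_2,\beta>0$ with the above properties it satisfies $$\|\mathbf u\|_{\mathbf V}\le\frac1{\alpha_2}\|\rho\|_{0,\gamma},\qquad \|\boldsymbol\lambda\|_{\boldsymbol\Lambda}\le\frac1\beta\Big(1+\frac{\alpha_1}{\alpha_2}\Big)\|\rho\|_{0,\gamma}.$$ -/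

import Mathlib

open MeasureTheory Filter Topology Set
open scoped ENNReal ContDiff

noncomputable section

namespace InterfaceProblem

/-! ### Sobolev spaces through weak derivatives -/

section L2Convergence

/-- The space `L²(Ω)` of classes of square integrable real functions on `Ω`, for Lebesgue
measure. -/
abbrev L2 {E : Type*} [MeasureSpace E] (Ω : Set E) : Type _ :=
  Lp ℝ 2 ((volume : Measure E).restrict Ω)

/-- `φₙ → f` in `L²(m)`, for a sequence of functions `φₙ`. -/
def TendstoL2 {E : Type*} [MeasurableSpace E] (m : Measure E) (φ : ℕ → E → ℝ)
    (f : Lp ℝ 2 m) : Prop :=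
  Tendsto (fun n => eLpNorm (fun x => φ n x - f x) 2 m) atTop (𝓝 0)

variable {E : Type*} [MeasurableSpace E] {m : Measure E}

theorem TendstoL2.zero : TendstoL2 m (fun _ _ => 0) 0 := by
  have h : ∀ _ : ℕ, eLpNorm (fun x => (0 : ℝ) - (0 : Lp ℝ 2 m) x) 2 m = 0 := by
    intro _
    rw [eLpNorm_congr_ae (g := fun _ => (0 : ℝ))]
    · simp
    · filter_upwards [Lp.coeFn_zero ℝ 2 m] with x hx
      rw [hx, Pi.zero_apply, sub_zero]
  exact tendsto_const_nhds.congr (fun n => (h n).symm)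

theorem TendstoL2.add {φ ψ : ℕ → E → ℝ} {f g : Lp ℝ 2 m}
    (mφ : ∀ n, AEStronglyMeasurable (φ n) m) (mψ : ∀ n, AEStronglyMeasurable (ψ n) m)
    (hφ : TendstoL2 m φ f) (hψ : TendstoL2 m ψ g) :
    TendstoL2 m (fun n x => φ n x + ψ n x) (f + g) := by
  have hs := Tendsto.add hφ hψ
  rw [add_zero] at hs
  refine tendsto_of_tendsto_of_tendsto_of_le_of_le tendsto_const_nhds hs
    (fun _ => zero_le) (fun n => ?_)
  have e : (fun x => φ n x + ψ n x - (f + g : Lp ℝ 2 m) x) =ᵐ[m]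
      ((fun x => φ n x - f x) + (fun x => ψ n x - g x)) := by
    filter_upwards [Lp.coeFn_add f g] with x hx
    simp only [hx, Pi.add_apply]
    ring
  rw [eLpNorm_congr_ae e]
  exact eLpNorm_add_le ((mφ n).sub (Lp.aestronglyMeasurable f))
    ((mψ n).sub (Lp.aestronglyMeasurable g)) (by norm_num)

theorem TendstoL2.smul {φ : ℕ → E → ℝ} {f : Lp ℝ 2 m} (c : ℝ) (hφ : TendstoL2 m φ f) :
    TendstoL2 m (fun n x => c * φ n x) (c • f) := by
  have hs := ENNReal.Tendsto.const_mul (a := ‖c‖ₑ) hφ (Or.inr (by simp))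
  rw [mul_zero] at hs
  refine hs.congr (fun n => ?_)
  rw [← eLpNorm_const_smul]
  refine eLpNorm_congr_ae ?_
  filter_upwards [Lp.coeFn_smul c f] with x hx
  simp only [hx, Pi.smul_apply, smul_eq_mul]
  ring

end L2Convergence

section Sobolev

variable {E : Type*} [NormedAddCommGroup E] [NormedSpace ℝ E] [MeasureSpace E] {ι : Type*}

/-- `g` is the weak derivative of `f` on `Ω` in the direction `e`:
`∫_Ω f ∂ₑφ = - ∫_Ω g φ` for all test functions `φ ∈ C_c^∞(Ω)`. -/
def HasWeakDeriv (Ω : Set E) (e : E) (f g : L2 Ω) : Prop :=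
  ∀ φ : E → ℝ, ContDiff ℝ ∞ φ → HasCompactSupport φ → tsupport φ ⊆ Ω →
    ∫ x in Ω, f x * fderiv ℝ φ x e = -∫ x in Ω, g x * φ x

/-- `φₙ → w` in `H¹(Ω)`, for a sequence of smooth functions `φₙ`; here `w none` is the limit
function and `w (some j)` its weak derivative in the direction `e j`. -/
def TendstoH1 (Ω : Set E) (e : ι → E) (φ : ℕ → E → ℝ)
    (w : PiLp 2 (fun _ : Option ι => L2 Ω)) : Prop :=
  TendstoL2 (volume.restrict Ω) φ (w none) ∧
    ∀ j, TendstoL2 (volume.restrict Ω) (fun n x => fderiv ℝ (φ n) x (e j)) (w (some j))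

theorem TendstoH1.zero (Ω : Set E) (e : ι → E) : TendstoH1 Ω e (fun _ _ => 0) 0 := by
  refine ⟨TendstoL2.zero, fun j => ?_⟩
  simpa using TendstoL2.zero

theorem TendstoH1.smul {Ω : Set E} {e : ι → E} {φ : ℕ → E → ℝ}
    {w : PiLp 2 (fun _ : Option ι => L2 Ω)} (sφ : ∀ n, ContDiff ℝ ∞ (φ n)) (c : ℝ)
    (hφ : TendstoH1 Ω e φ w) : TendstoH1 Ω e (fun n x => c * φ n x) (c • w) := by
  refine ⟨hφ.1.smul c, fun j => ?_⟩
  have h := (hφ.2 j).smul c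
  have e1 : (fun (n : ℕ) x => fderiv ℝ (fun y => c * φ n y) x (e j)) =
      fun n x => c * fderiv ℝ (φ n) x (e j) := by
    funext n x
    rw [fderiv_const_mul ((sφ n).differentiable (by simp) x)]
    simp
  rw [e1]
  exact h

theorem HasWeakDeriv.zero (Ω : Set E) (e : E) : HasWeakDeriv Ω e 0 0 := by
  intro φ _ _ _
  have A : ∀ ψ : E → ℝ, ∫ x in Ω, (0 : L2 Ω) x * ψ x = 0 := by
    intro ψ
    refine integral_eq_zero_of_ae ?_
    filter_upwards [Lp.coeFn_zero ℝ 2 ((volume : Measure E).restrict Ω)] with x hx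
    simp only [hx, Pi.zero_apply, zero_mul]
  rw [A, A, neg_zero]

theorem HasWeakDeriv.smul {Ω : Set E} {e : E} {f g : L2 Ω} (c : ℝ) (h : HasWeakDeriv Ω e f g) :
    HasWeakDeriv Ω e (c • f) (c • g) := by
  intro φ hφ hc hs
  have A : ∀ (u : L2 Ω) (ψ : E → ℝ),
      ∫ x in Ω, (c • u : L2 Ω) x * ψ x = c * ∫ x in Ω, u x * ψ x := by
    intro u ψ
    rw [← integral_const_mul]
    refine integral_congr_ae ?_
    filter_upwards [Lp.coeFn_smul c u] with x hx
    simp only [hx, Pi.smul_apply, smul_eq_mul]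
    ring
  rw [A, A, h φ hφ hc hs]
  ring

variable [BorelSpace E]

theorem TendstoH1.add {Ω : Set E} {e : ι → E} {φ ψ : ℕ → E → ℝ}
    {w z : PiLp 2 (fun _ : Option ι => L2 Ω)}
    (sφ : ∀ n, ContDiff ℝ ∞ (φ n)) (sψ : ∀ n, ContDiff ℝ ∞ (ψ n))
    (hφ : TendstoH1 Ω e φ w) (hψ : TendstoH1 Ω e ψ z) :
    TendstoH1 Ω e (fun n x => φ n x + ψ n x) (w + z) := by
  have hc : ∀ (f : E → ℝ) (v : E), ContDiff ℝ ∞ f → Continuous (fun x => fderiv ℝ f x v) :=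
    fun f v hf => (hf.continuous_fderiv (by simp)).clm_apply continuous_const
  refine ⟨hφ.1.add (fun n => (sφ n).continuous.aestronglyMeasurable)
    (fun n => (sψ n).continuous.aestronglyMeasurable) hψ.1, fun j => ?_⟩
  have h := (hφ.2 j).add (fun n => (hc _ (e j) (sφ n)).aestronglyMeasurable)
    (fun n => (hc _ (e j) (sψ n)).aestronglyMeasurable) (hψ.2 j)
  have e1 : (fun (n : ℕ) x => fderiv ℝ (fun y => φ n y + ψ n y) x (e j)) =
      fun n x => fderiv ℝ (φ n) x (e j) + fderiv ℝ (ψ n) x (e j) := by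
    funext n x
    rw [fderiv_fun_add ((sφ n).differentiable (by simp) x) ((sψ n).differentiable (by simp) x)]
    simp
  rw [e1]
  exact h

variable [IsFiniteMeasureOnCompacts (volume : Measure E)]

theorem integrable_L2_mul {F : Type*} [NormedAddCommGroup F] [MeasureSpace F] [BorelSpace F]
    [IsFiniteMeasureOnCompacts (volume : Measure F)] {Ω : Set F} (f : L2 Ω) {φ : F → ℝ}
    (hφ : Continuous φ) (hc : HasCompactSupport φ) :
    Integrable (fun x => f x * φ x) (volume.restrict Ω) :=
  MemLp.integrable_mul (p := 2) (q := 2) (Lp.memLp f) (hφ.memLp_of_hasCompactSupport hc)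

theorem HasWeakDeriv.add {Ω : Set E} {e : E} {f g f₁ g₁ : L2 Ω} (h : HasWeakDeriv Ω e f g)
    (h₁ : HasWeakDeriv Ω e f₁ g₁) : HasWeakDeriv Ω e (f + f₁) (g + g₁) := by
  intro φ hφ hc hs
  have cd : Continuous (fun x => fderiv ℝ φ x e) :=
    (hφ.continuous_fderiv (by simp)).clm_apply continuous_const
  have dc : HasCompactSupport (fun x => fderiv ℝ φ x e) := hc.fderiv_apply ℝ e
  have A : ∀ (u v : L2 Ω) (ψ : E → ℝ), Continuous ψ → HasCompactSupport ψ →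
      ∫ x in Ω, (u + v : L2 Ω) x * ψ x = (∫ x in Ω, u x * ψ x) + ∫ x in Ω, v x * ψ x := by
    intro u v ψ hψ hcψ
    rw [← integral_add (integrable_L2_mul u hψ hcψ) (integrable_L2_mul v hψ hcψ)]
    refine integral_congr_ae ?_
    filter_upwards [Lp.coeFn_add u v] with x hx
    simp only [hx, Pi.add_apply]
    ring
  rw [A _ _ _ cd dc, A _ _ _ hφ.continuous hc, h φ hφ hc hs, h₁ φ hφ hc hs]
  ring

/-- The Sobolev space `H¹(Ω)` (with respect to the coordinate directions `e j`). An element is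
recorded as the family `w` of a function `w none ∈ L²(Ω)` together with its weak partial
derivatives `w (some j) ∈ L²(Ω)`, which it determines. The norm inherited from `PiLp 2` is the
`H¹` norm `(‖w none‖² + ∑ⱼ ‖w (some j)‖²)^{1/2}`. -/
def H1 (Ω : Set E) (e : ι → E) : Submodule ℝ (PiLp 2 (fun _ : Option ι => L2 Ω)) where
  carrier := {w | ∀ j, HasWeakDeriv Ω (e j) (w none) (w (some j))}
  zero_mem' := fun j => HasWeakDeriv.zero Ω (e j)
  add_mem' := fun ha hb j => (ha j).add (hb j)
  smul_mem' := fun c _ ha j => (ha j).smul c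

end Sobolev

/-! ### Rectangles, traces and trace spaces -/

section Rectangle

/-- The coordinate directions of the plane. -/
def planeDirs : Fin 2 → ℝ × ℝ := ![(1, 0), (0, 1)]

/-- The open rectangle `(0, L) × (a, b)`. -/
def rect (L a b : ℝ) : Set (ℝ × ℝ) := Ioo 0 L ×ˢ Ioo a b

/-- Triples `(v, ∂ₓv, ∂ᵧv)` of functions in `L²((0, L) × (a, b))`, where the elements of
`H¹((0, L) × (a, b))` live. -/
abbrev Jet (L a b : ℝ) : Type := PiLp 2 (fun _ : Option (Fin 2) => L2 (rect L a b))

/-- The arc length measure on the boundary of the rectangle `(0, L) × (a, b)`: the sum of the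
one-dimensional Lebesgue measures on its four sides. -/
def arcLength (L a b : ℝ) : Measure (ℝ × ℝ) :=
  (volume.restrict (Ioo 0 L)).map (fun x : ℝ => (x, a)) +
  (volume.restrict (Ioo 0 L)).map (fun x : ℝ => (x, b)) +
  (volume.restrict (Ioo a b)).map (fun y : ℝ => ((0 : ℝ), y)) +
  (volume.restrict (Ioo a b)).map (fun y : ℝ => (L, y))

/-- `g ∈ L²(∂R)` is the trace of `w ∈ H¹(R)`, `R = (0, L) × (a, b)`: there are functions `φₙ`,
smooth up to the boundary, with `φₙ → w` in `H¹(R)` and `φₙ|_{∂R} → g` in `L²(∂R)`. -/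
def IsTrace (L a b : ℝ) (w : Jet L a b) (g : Lp ℝ 2 (arcLength L a b)) : Prop :=
  ∃ φ : ℕ → ℝ × ℝ → ℝ, (∀ n, ContDiff ℝ ∞ (φ n)) ∧
    TendstoH1 (rect L a b) planeDirs φ w ∧ TendstoL2 (arcLength L a b) φ g

variable {L a b : ℝ}

theorem IsTrace.zero : IsTrace L a b 0 0 :=
  ⟨fun _ _ => 0, fun _ => contDiff_const, TendstoH1.zero _ _, TendstoL2.zero⟩

theorem IsTrace.add {w z : Jet L a b} {g k : Lp ℝ 2 (arcLength L a b)}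
    (hw : IsTrace L a b w g) (hz : IsTrace L a b z k) : IsTrace L a b (w + z) (g + k) := by
  obtain ⟨φ, sφ, h1, h2⟩ := hw
  obtain ⟨ψ, sψ, k1, k2⟩ := hz
  exact ⟨fun n x => φ n x + ψ n x, fun n => (sφ n).add (sψ n), h1.add sφ sψ k1,
    h2.add (fun n => (sφ n).continuous.aestronglyMeasurable)
      (fun n => (sψ n).continuous.aestronglyMeasurable) k2⟩

theorem IsTrace.smul {w : Jet L a b} {g : Lp ℝ 2 (arcLength L a b)} (c : ℝ)
    (hw : IsTrace L a b w g) : IsTrace L a b (c • w) (c • g) := by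
  obtain ⟨φ, sφ, h1, h2⟩ := hw
  exact ⟨fun n x => c * φ n x, fun n => contDiff_const.mul (sφ n), h1.smul sφ c, h2.smul c⟩

/-- `H¹_{0,Γ}(R) = {v ∈ H¹(R) : v = 0 on Γ}` for `R = (0, L) × (a, b)`, in the sense of traces. -/
def H1zero (L a b : ℝ) (Γ : Set (ℝ × ℝ)) : Submodule ℝ (Jet L a b) where
  carrier := {w | w ∈ H1 (rect L a b) planeDirs ∧
    ∃ g, IsTrace L a b w g ∧ ∀ᵐ z ∂(arcLength L a b), z ∈ Γ → g z = 0}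
  zero_mem' := by
    refine ⟨Submodule.zero_mem _, 0, IsTrace.zero, ?_⟩
    filter_upwards [Lp.coeFn_zero ℝ 2 (arcLength L a b)] with z hz _
    rw [hz, Pi.zero_apply]
  add_mem' := by
    rintro w z ⟨hw, g, hg, g0⟩ ⟨hz, k, hk, k0⟩
    refine ⟨Submodule.add_mem _ hw hz, g + k, hg.add hk, ?_⟩
    filter_upwards [Lp.coeFn_add g k, g0, k0] with x hx h1 h2 hΓ
    rw [hx, Pi.add_apply, h1 hΓ, h2 hΓ, add_zero]
  smul_mem' := by
    rintro c w ⟨hw, g, hg, g0⟩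
    refine ⟨Submodule.smul_mem _ c hw, c • g, hg.smul c, ?_⟩
    filter_upwards [Lp.coeFn_smul c g, g0] with x hx h1 hΓ
    rw [hx, Pi.smul_apply, h1 hΓ, smul_zero]

/-- `σ ∈ L²(0, L)` is the restriction to `γ = (0, L) × {0}` of the trace of `w`, for a rectangle
`(0, L) × (a, b)` that has `γ` as one of its sides. -/
def IsTraceOnInterface (L a b : ℝ) (w : Jet L a b) (σ : L2 (Ioo 0 L)) : Prop :=
  ∃ g, IsTrace L a b w g ∧ (fun x : ℝ => g (x, 0)) =ᵐ[volume.restrict (Ioo 0 L)] σ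

open Classical in
/-- The trace `w|_γ`. -/
def traceOnInterface (L a b : ℝ) (w : Jet L a b) : L2 (Ioo 0 L) :=
  if h : ∃ σ, IsTraceOnInterface L a b w σ then h.choose else 0

end Rectangle

/-! ### The geometry of the device and the function spaces -/

section Spaces

/-- A property that holds almost everywhere on the boundary of a rectangle with side `γ` holds
almost everywhere on `γ`. -/
theorem ae_interface {L a b : ℝ} (hab : a = 0 ∨ b = 0) {p : ℝ × ℝ → Prop}
    (h : ∀ᵐ z ∂(arcLength L a b), p z) : ∀ᵐ x ∂(volume.restrict (Ioo 0 L)), p (x, 0) := by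
  have hm : AEMeasurable (fun x : ℝ => (x, (0 : ℝ))) (volume.restrict (Ioo 0 L)) := by fun_prop
  refine ae_of_ae_map hm ?_
  unfold arcLength at h
  simp only [ae_add_measure_iff] at h
  rcases hab with rfl | rfl
  · exact h.1.1.1
  · exact h.1.1.2

theorem IsTraceOnInterface.zero {L a b : ℝ} (hab : a = 0 ∨ b = 0) :
    IsTraceOnInterface L a b 0 0 := by
  refine ⟨0, IsTrace.zero, ?_⟩
  filter_upwards [ae_interface hab (Lp.coeFn_zero ℝ 2 (arcLength L a b)),
    Lp.coeFn_zero ℝ 2 (volume.restrict (Ioo 0 L))] with x h1 h2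
  rw [h1, h2]
  rfl

theorem IsTraceOnInterface.add {L a b : ℝ} (hab : a = 0 ∨ b = 0) {w z : Jet L a b}
    {σ τ : L2 (Ioo 0 L)} (hw : IsTraceOnInterface L a b w σ)
    (hz : IsTraceOnInterface L a b z τ) : IsTraceOnInterface L a b (w + z) (σ + τ) := by
  obtain ⟨g, hg, hσ⟩ := hw
  obtain ⟨k, hk, hτ⟩ := hz
  refine ⟨g + k, hg.add hk, ?_⟩
  filter_upwards [ae_interface hab (Lp.coeFn_add g k), Lp.coeFn_add σ τ, hσ, hτ]
    with x h1 h2 h3 h4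
  rw [h1, h2, Pi.add_apply, Pi.add_apply, h3, h4]

theorem IsTraceOnInterface.smul {L a b : ℝ} (hab : a = 0 ∨ b = 0) {w : Jet L a b}
    {σ : L2 (Ioo 0 L)} (c : ℝ) (hw : IsTraceOnInterface L a b w σ) :
    IsTraceOnInterface L a b (c • w) (c • σ) := by
  obtain ⟨g, hg, hσ⟩ := hw
  refine ⟨c • g, hg.smul c, ?_⟩
  filter_upwards [ae_interface hab (Lp.coeFn_smul c g), Lp.coeFn_smul c σ, hσ] with x h1 h2 h3
  rw [h1, h2, Pi.smul_apply, Pi.smul_apply, h3]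

/-- The line `γ = (0, L) × {0}` as a subset of the plane. -/
def interface (L : ℝ) : Set (ℝ × ℝ) := Ioo 0 L ×ˢ {0}

/-- The lower ends in `y` of the two subdomains. -/
def lo (l : ℝ) : Fin 2 → ℝ := ![0, -(l / 2)]

/-- The upper ends in `y` of the two subdomains. -/
def hi (l : ℝ) : Fin 2 → ℝ := ![l / 2, 0]

/-- The device domain `Ω = (0, L) × (-l/2, l/2)`. -/
def device (L l : ℝ) : Set (ℝ × ℝ) := rect L (-(l / 2)) (l / 2)

/-- The oxide subdomains `Ω₁ = (0, L) × (0, l/2)` (index `0`) and `Ω₂ = (0, L) × (-l/2, 0)`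
(index `1`). -/
def oxide (L l : ℝ) (i : Fin 2) : Set (ℝ × ℝ) := rect L (lo l i) (hi l i)

/-- `Vⁱ = H¹_{0,Γ_Dⁱ}(Ωᵢ)`, with `Γ_Dⁱ = ∂Ωᵢ ∩ Γ_D`. -/
def VOx (L l : ℝ) (ΓD : Set (ℝ × ℝ)) (i : Fin 2) : Submodule ℝ (Jet L (lo l i) (hi l i)) :=
  H1zero L (lo l i) (hi l i) (frontier (oxide L l i) ∩ ΓD)

/-- `H¹_{0,∂Ωᵢ∖γ}(Ωᵢ)`. -/
def VInt (L l : ℝ) (i : Fin 2) : Submodule ℝ (Jet L (lo l i) (hi l i)) :=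
  H1zero L (lo l i) (hi l i) (frontier (oxide L l i) \ interface L)

/-- `V^γ = H¹₀(γ)`, the closure of `C_c^∞(0, L)` in `H¹(0, L)`. -/
def VGam (L : ℝ) : Submodule ℝ (PiLp 2 (fun _ : Option (Fin 1) => L2 (Ioo (0 : ℝ) L))) where
  carrier := {w | w ∈ H1 (Ioo 0 L) (fun _ : Fin 1 => (1 : ℝ)) ∧
    ∃ φ : ℕ → ℝ → ℝ, (∀ n, ContDiff ℝ ∞ (φ n) ∧ HasCompactSupport (φ n) ∧
      tsupport (φ n) ⊆ Ioo 0 L) ∧ TendstoH1 (Ioo 0 L) (fun _ : Fin 1 => (1 : ℝ)) φ w}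
  zero_mem' := by
    refine ⟨Submodule.zero_mem _, fun _ _ => 0, fun _ => ⟨contDiff_const, ?_, ?_⟩,
      TendstoH1.zero _ _⟩
    · exact HasCompactSupport.zero
    · simp [tsupport]
  add_mem' := by
    rintro w z ⟨hw, φ, hφ, cφ⟩ ⟨hz, ψ, hψ, cψ⟩
    refine ⟨Submodule.add_mem _ hw hz, fun n x => φ n x + ψ n x, fun n => ⟨?_, ?_, ?_⟩,
      cφ.add (fun n => (hφ n).1) (fun n => (hψ n).1) cψ⟩
    · exact (hφ n).1.add (hψ n).1
    · exact (hφ n).2.1.add (hψ n).2.1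
    · exact (tsupport_add (φ n) (ψ n)).trans (union_subset (hφ n).2.2 (hψ n).2.2)
  smul_mem' := by
    rintro c w ⟨hw, φ, hφ, cφ⟩
    refine ⟨Submodule.smul_mem _ c hw, fun n x => c * φ n x, fun n => ⟨?_, ?_, ?_⟩,
      cφ.smul (fun n => (hφ n).1) c⟩
    · exact contDiff_const.mul (hφ n).1
    · exact (hφ n).2.1.mul_left
    · exact (tsupport_mul_subset_right).trans (hφ n).2.2

/-- `𝐕 = V¹ × V² × V^γ`. -/
abbrev V (L l : ℝ) (ΓD : Set (ℝ × ℝ)) : Type :=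
  ((i : Fin 2) → VOx L l ΓD i) × VGam L

/-- `‖𝐮‖_𝐕`. -/
def normV (L l : ℝ) (ΓD : Set (ℝ × ℝ)) (u : V L l ΓD) : ℝ :=
  √((∑ i, ‖u.1 i‖ ^ 2) + ‖u.2‖ ^ 2)

/-- `H^{1/2}₀₀(γ)`, the space of traces on `γ` of functions in `H¹_{0,∂Ω₁∖γ}(Ω₁)`. (By
reflection, `Ω₂` gives the same space and norm.) -/
def Hhalf (L l : ℝ) : Submodule ℝ (L2 (Ioo 0 L)) where
  carrier := {σ | ∃ w ∈ VInt L l 0, IsTraceOnInterface L (lo l 0) (hi l 0) w σ}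
  zero_mem' := ⟨0, Submodule.zero_mem _, IsTraceOnInterface.zero (Or.inl rfl)⟩
  add_mem' := by
    rintro σ τ ⟨w, hw, hσ⟩ ⟨z, hz, hτ⟩
    exact ⟨w + z, Submodule.add_mem _ hw hz, hσ.add (Or.inl rfl) hτ⟩
  smul_mem' := by
    rintro c σ ⟨w, hw, hσ⟩
    exact ⟨c • w, Submodule.smul_mem _ c hw, hσ.smul (Or.inl rfl) c⟩

/-- `‖σ‖_{1/2,γ}`, the infimum of `‖v‖_{1,Ω₁}` over `v ∈ H¹_{0,∂Ω₁∖γ}(Ω₁)` with `v|_γ = σ`. -/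
def halfNorm (L l : ℝ) (σ : Hhalf L l) : ℝ :=
  sInf {r | ∃ w ∈ VInt L l 0, IsTraceOnInterface L (lo l 0) (hi l 0) w σ ∧ r = ‖w‖}

/-- `(H^{1/2}₀₀(γ))'`, the space of continuous linear functionals on `H^{1/2}₀₀(γ)`. -/
def HhalfDual (L l : ℝ) : Submodule ℝ (Hhalf L l →ₗ[ℝ] ℝ) where
  carrier := {μ | ∃ C : ℝ, ∀ σ, |μ σ| ≤ C * halfNorm L l σ}
  zero_mem' := ⟨0, by simp⟩
  add_mem' := by
    rintro μ ν ⟨C, hC⟩ ⟨D, hD⟩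
    refine ⟨C + D, fun σ => ?_⟩
    rw [add_mul]
    exact (abs_add_le _ _).trans (add_le_add (hC σ) (hD σ))
  smul_mem' := by
    rintro c μ ⟨C, hC⟩
    refine ⟨|c| * C, fun σ => ?_⟩
    rw [LinearMap.smul_apply, smul_eq_mul, abs_mul, mul_assoc]
    exact mul_le_mul_of_nonneg_left (hC σ) (abs_nonneg c)

open Classical in
/-- The duality pairing `⟨μ, σ⟩_γ`, for `σ ∈ L²(γ)` that belongs to `H^{1/2}₀₀(γ)`. -/
def pairing (L l : ℝ) (μ : HhalfDual L l) (σ : L2 (Ioo 0 L)) : ℝ :=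
  if h : σ ∈ Hhalf L l then μ.1 ⟨σ, h⟩ else 0

/-- The quotient `⟨μ, v|_γ⟩_γ / ‖v‖_{1,Ωᵢ}` for `v ∈ H¹_{0,∂Ωᵢ∖γ}(Ωᵢ)` (with value `0` at
`v = 0`). -/
def dualQuotient (L l : ℝ) (i : Fin 2) (μ : HhalfDual L l) (v : VInt L l i) : ℝ :=
  pairing L l μ (traceOnInterface L (lo l i) (hi l i) v) / ‖v‖

/-- The norm `‖μ‖_{-1/2,γ}` of `Λⁱ`: the supremum of `⟨μ, v|_γ⟩_γ / ‖v‖_{1,Ωᵢ}` over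
`v ∈ H¹_{0,∂Ωᵢ∖γ}(Ωᵢ)`. -/
def dualNorm (L l : ℝ) (i : Fin 2) (μ : HhalfDual L l) : ℝ :=
  ⨆ v : VInt L l i, dualQuotient L l i μ v

/-- `𝚲 = Λ¹ × Λ²` with `Λⁱ = (H^{1/2}₀₀(γ))'`. -/
abbrev Lam (L l : ℝ) : Type := Fin 2 → HhalfDual L l

/-- `‖𝛌‖_𝚲`. -/
def normLam (L l : ℝ) (lam : Lam L l) : ℝ := √(∑ i, dualNorm L l i (lam i) ^ 2)

end Spaces

/-! ### The saddle-point problem -/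

section Problem

variable (L l : ℝ) (ΓD : Set (ℝ × ℝ)) (d εox εch : ℝ)

/-- `𝐚(𝐮, 𝐯) = ∑ᵢ ∫_{Ωᵢ} ε_ox ∇uᵢ · ∇vᵢ + d ∫_γ ε_ch u_γ' v_γ'`. -/
def formA (u v : V L l ΓD) : ℝ :=
  (∑ i, ∫ z in oxide L l i, εox * ∑ j : Fin 2,
      (u.1 i).1 (some j) z * (v.1 i).1 (some j) z) +
    d * ∫ x in Ioo 0 L, εch * (u.2.1 (some 0) x * v.2.1 (some 0) x)

/-- `𝐛(𝛍, 𝐮) = ∑ᵢ ⟨μᵢ, uᵢ|_γ - u_γ⟩_γ`. -/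
def formB (mu : Lam L l) (u : V L l ΓD) : ℝ :=
  ∑ i, pairing L l (mu i) (traceOnInterface L (lo l i) (hi l i) (u.1 i) - u.2.1 none)

/-- `(𝐮, 𝛌)` solves the variational problem: `𝐚(𝐮, 𝐯) - 𝐛(𝛌, 𝐯) = ∫_γ ρ v_γ` for all `𝐯 ∈ 𝐕` and
`𝐛(𝛍, 𝐮) = 0` for all `𝛍 ∈ 𝚲`. -/
def IsSolution (ρ : L2 (Ioo 0 L)) (p : V L l ΓD × Lam L l) : Prop :=
  (∀ v : V L l ΓD, formA L l ΓD d εox εch p.1 v - formB L l ΓD p.2 v =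
    ∫ x in Ioo 0 L, ρ x * v.2.1 none x) ∧
  ∀ mu : Lam L l, formB L l ΓD mu p.1 = 0

/-- `α` is a continuity constant of `𝐚`. -/
def ContinuityConst (α : ℝ) : Prop :=
  0 < α ∧ ∀ u v : V L l ΓD,
    formA L l ΓD d εox εch u v ≤ α * normV L l ΓD u * normV L l ΓD v

/-- `α` is a coercivity constant of `𝐚`. -/
def CoercivityConst (α : ℝ) : Prop :=
  0 < α ∧ ∀ u : V L l ΓD, α * normV L l ΓD u ^ 2 ≤ formA L l ΓD d εox εch u u

/-- `M` is a continuity constant of `𝐛`. -/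
def ContinuityConstB (M : ℝ) : Prop :=
  0 < M ∧ ∀ (mu : Lam L l) (v : V L l ΓD),
    formB L l ΓD mu v ≤ M * normLam L l mu * normV L l ΓD v

/-- `β` is an inf-sup constant of `𝐛`: for every `𝛌 ≠ 0`, the supremum over `𝐯` of
`𝐛(𝛌, 𝐯) / (‖𝛌‖ ‖𝐯‖)` (with value `0` at `𝐯 = 0`) is at least `β`. -/
def InfSupConst (β : ℝ) : Prop :=
  0 < β ∧ ∀ lam : Lam L l, lam ≠ 0 →
    β ≤ ⨆ v : V L l ΓD, formB L l ΓD lam v / (normLam L l lam * normV L l ΓD v)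

end Problem

end InterfaceProblem

end

/-! Every function in the spaces comes with a trace, hence with a sequence of functions smooth up to
the boundary that converges to it in `H¹`. The analysis therefore consists of inequalities for
smooth functions. Bounded linear operations pass to the limit by completeness
(`exists_tendsto_of_norm_le`), and pointwise identities between traces pass to it along a.e.
convergent subsequences (`exists_subseq_ae_tendsto`).

The basic inequality is `f(s)² ≤ 2 f(t)² + 2(b - a) ∫ f'²` on an interval. Averaged over `t` and
integrated over slices, it gives the trace inequality, hence uniqueness of traces and completeness
of the spaces. It also gives the Poincaré inequalities.

The separation of `Γ_N` from `γ` enters twice. A smooth cutoff equal to `0` on `Γ_N` and `1` on `γ`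
turns a function of `Vⁱ` into one of `H¹_{0,∂Ωᵢ∖γ}(Ωᵢ)` with the same trace on `γ`, so that trace
lies in `H^{1/2}₀₀(γ)`. Moreover, near the corner `(0, 0)`, which is in the closure of `γ`, the left
side belongs to `Γ_D`; this yields a Poincaré inequality on each `Vⁱ`, and with it coercivity on all
of `𝐕`. Reflection identifies the trace spaces of the two rectangles, and `(1 - y/h) φ(x)` extends
functions of `H¹₀(γ)`.

For the inf-sup condition, test functions with one nonzero component in `H¹_{0,∂Ωᵢ∖γ}(Ωᵢ) ⊂ Vⁱ`
recover each dual norm, so the supremum is at least `1/√2`; the value `1/2` is recorded.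

For existence, Lax-Milgram on the common kernel of the functionals `𝐛(𝛍, ·)` gives `𝐮`. The residual
`𝐚(𝐮, ·) - ∫ ρ v_γ` vanishes on functions without jumps, and every bounded functional of this kind
is some `𝐛(𝛌, ·)` (`Admissible.exists_lam`): its value on an extension of `σ` into one subdomain
depends only on `σ`. Coercivity and the inf-sup condition give uniqueness and the two bounds. -/

noncomputable section

namespace InterfaceProblem

/-! ### Smooth functions as elements of `L²` and of `H¹` -/

section Smooth

/-- A finite measure that is carried by a compact set. -/
class CompactlyCarried {E : Type*} [TopologicalSpace E] [MeasurableSpace E]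
    (m : Measure E) : Prop extends IsFiniteMeasure m where
  exists_isCompact : ∃ K, IsCompact K ∧ ∀ᵐ x ∂m, x ∈ K

theorem memLp_of_continuous {E : Type*} [TopologicalSpace E] [SecondCountableTopology E]
    [MeasurableSpace E] [OpensMeasurableSpace E] (m : Measure E) [CompactlyCarried m] {f : E → ℝ}
    (hf : Continuous f) (p : ℝ≥0∞) : MemLp f p m := by
  obtain ⟨K, hK, h⟩ := CompactlyCarried.exists_isCompact (m := m)
  obtain ⟨C, hC⟩ := hK.exists_bound_of_continuousOn hf.continuousOn
  exact MemLp.of_bound hf.aestronglyMeasurable C (h.mono fun x hx => hC x hx)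

theorem integrable_of_continuous {E : Type*} [TopologicalSpace E] [SecondCountableTopology E]
    [MeasurableSpace E] [OpensMeasurableSpace E] (m : Measure E) [CompactlyCarried m] {f : E → ℝ}
    (hf : Continuous f) : Integrable f m :=
  memLp_one_iff_integrable.1 (memLp_of_continuous m hf 1)

instance compactlyCarried_Ioo (a b : ℝ) :
    CompactlyCarried ((volume : Measure ℝ).restrict (Ioo a b)) where
  exists_isCompact := ⟨Icc a b, isCompact_Icc,
    (ae_restrict_mem measurableSet_Ioo).mono fun _ hx => Ioo_subset_Icc_self hx⟩

theorem measurableSet_rect (L a b : ℝ) : MeasurableSet (rect L a b) :=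
  measurableSet_Ioo.prod measurableSet_Ioo

theorem volume_restrict_rect (L a b : ℝ) :
    (volume : Measure (ℝ × ℝ)).restrict (rect L a b) =
      (volume.restrict (Ioo 0 L)).prod (volume.restrict (Ioo a b)) := by
  rw [Measure.prod_restrict]
  rfl

instance compactlyCarried_rect (L a b : ℝ) :
    CompactlyCarried ((volume : Measure (ℝ × ℝ)).restrict (rect L a b)) where
  toIsFiniteMeasure := by rw [volume_restrict_rect]; infer_instance
  exists_isCompact := ⟨Icc 0 L ×ˢ Icc a b, isCompact_Icc.prod isCompact_Icc,
    (ae_restrict_mem (measurableSet_rect L a b)).mono fun _ hx =>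
      ⟨Ioo_subset_Icc_self hx.1, Ioo_subset_Icc_self hx.2⟩⟩

theorem ae_arcLength_iff {L a b : ℝ} {p : ℝ × ℝ → Prop} (hp : MeasurableSet {z | p z}) :
    (∀ᵐ z ∂(arcLength L a b), p z) ↔
      (((∀ᵐ x ∂(volume.restrict (Ioo 0 L)), p (x, a)) ∧
        ∀ᵐ x ∂(volume.restrict (Ioo 0 L)), p (x, b)) ∧
        ∀ᵐ y ∂(volume.restrict (Ioo a b)), p (0, y)) ∧
        ∀ᵐ y ∂(volume.restrict (Ioo a b)), p (L, y) := by
  unfold arcLength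
  simp only [ae_add_measure_iff]
  rw [ae_map_iff (by fun_prop) hp, ae_map_iff (by fun_prop) hp, ae_map_iff (by fun_prop) hp,
    ae_map_iff (by fun_prop) hp]

instance compactlyCarried_arcLength (L a b : ℝ) : CompactlyCarried (arcLength L a b) where
  toIsFiniteMeasure := by unfold arcLength; infer_instance
  exists_isCompact := by
    -- The four coordinates are inserted separately because `L` may be negative and `a > b` is
    -- possible: the intervals can be empty while a side remains.
    let K : Set (ℝ × ℝ) := insert 0 (insert L (Icc 0 L)) ×ˢ insert a (insert b (Icc a b))
    have hK : IsCompact K :=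
      ((isCompact_Icc.insert L).insert 0).prod ((isCompact_Icc.insert b).insert a)
    have h (c d : ℝ) : ∀ᵐ x ∂(volume.restrict (Ioo c d)), x ∈ Icc c d :=
      (ae_restrict_mem measurableSet_Ioo).mono fun _ hx => Ioo_subset_Icc_self hx
    refine ⟨K, hK, (ae_arcLength_iff (p := fun z => z ∈ K) hK.measurableSet).2
      ⟨⟨⟨?_, ?_⟩, ?_⟩, ?_⟩⟩
    · filter_upwards [h 0 L] with x hx using ⟨Or.inr (Or.inr hx), Or.inl rfl⟩
    · filter_upwards [h 0 L] with x hx using ⟨Or.inr (Or.inr hx), Or.inr (Or.inl rfl)⟩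
    · filter_upwards [h a b] with x hx using ⟨Or.inl rfl, Or.inr (Or.inr hx)⟩
    · filter_upwards [h a b] with x hx using ⟨Or.inr (Or.inl rfl), Or.inr (Or.inr hx)⟩

/-- The subspace of smooth functions among the real functions on `E`. -/
def smoothSubmodule (E : Type*) [NormedAddCommGroup E] [NormedSpace ℝ E] :
    Submodule ℝ (E → ℝ) where
  carrier := {φ | ContDiff ℝ ∞ φ}
  zero_mem' := show ContDiff ℝ ∞ (fun _ : E => (0 : ℝ)) from contDiff_const
  add_mem' {φ ψ} h k := by
    change ContDiff ℝ ∞ φ at h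
    change ContDiff ℝ ∞ ψ at k
    exact h.add k
  smul_mem' c φ h := by
    change ContDiff ℝ ∞ φ at h
    exact contDiff_const.smul h

/-- The smooth real functions on `E`. -/
abbrev Smooth (E : Type*) [NormedAddCommGroup E] [NormedSpace ℝ E] : Type _ :=
  smoothSubmodule E

variable {E : Type*} [NormedAddCommGroup E] [NormedSpace ℝ E]

theorem Smooth.contDiff (φ : Smooth E) : ContDiff ℝ ∞ φ.1 := φ.2

theorem Smooth.continuous (φ : Smooth E) : Continuous φ.1 := φ.contDiff.continuous

theorem Smooth.differentiable (φ : Smooth E) : Differentiable ℝ φ.1 :=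
  φ.contDiff.differentiable (by simp)

/-- The derivative of a smooth function in the direction `v`. -/
def Smooth.deriv (v : E) : Smooth E →ₗ[ℝ] Smooth E where
  toFun φ := ⟨fun x => fderiv ℝ φ.1 x v,
    (ContDiff.fderiv_right (m := ∞) (Smooth.contDiff φ) (by simp)).clm_apply contDiff_const⟩
  map_add' φ ψ := by
    ext x
    change fderiv ℝ (φ.1 + ψ.1) x v = fderiv ℝ φ.1 x v + fderiv ℝ ψ.1 x v
    rw [fderiv_add (Smooth.differentiable φ x) (Smooth.differentiable ψ x)]
    rfl
  map_smul' c φ := by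
    ext x
    change fderiv ℝ (c • φ.1) x v = c * fderiv ℝ φ.1 x v
    rw [fderiv_const_smul (Smooth.differentiable φ x)]
    rfl

variable [MeasurableSpace E] [BorelSpace E] [SecondCountableTopology E]

/-- The class of a smooth function in `L²(m)`. -/
def smoothLp (m : Measure E) [CompactlyCarried m] : Smooth E →ₗ[ℝ] Lp ℝ 2 m where
  toFun φ := (memLp_of_continuous (f := φ.1) m (Smooth.continuous φ) 2).toLp φ.1
  map_add' _ _ := rfl
  map_smul' _ _ := rfl

theorem coeFn_smoothLp (m : Measure E) [CompactlyCarried m] (φ : Smooth E) :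
    smoothLp m φ =ᵐ[m] φ.1 :=
  (memLp_of_continuous m φ.continuous 2).coeFn_toLp

theorem norm_sq_Lp {α : Type*} [MeasurableSpace α] {m : Measure α} (f : Lp ℝ 2 m) :
    ‖f‖ ^ 2 = ∫ x, f x ^ 2 ∂m := by
  rw [← real_inner_self_eq_norm_sq, L2.inner_def]
  simp [pow_two]

theorem norm_sq_smoothLp (m : Measure E) [CompactlyCarried m] (φ : Smooth E) :
    ‖smoothLp m φ‖ ^ 2 = ∫ x, φ.1 x ^ 2 ∂m := by
  rw [norm_sq_Lp]
  refine integral_congr_ae ?_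
  filter_upwards [coeFn_smoothLp m φ] with x hx
  rw [hx]

/-- Replaces convergence of representatives by convergence in the normed space, where completeness
and closures are available. -/
theorem tendstoL2_iff (m : Measure E) [CompactlyCarried m] (φ : ℕ → Smooth E) (f : Lp ℝ 2 m) :
    TendstoL2 m (fun n => (φ n).1) f ↔ Tendsto (fun n => smoothLp m (φ n)) atTop (𝓝 f) := by
  rw [Lp.tendsto_Lp_iff_tendsto_eLpNorm']
  unfold TendstoL2
  refine iff_of_eq (congrArg (fun u => Tendsto u atTop (𝓝 0)) (funext fun n => ?_))
  refine eLpNorm_congr_ae ?_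
  filter_upwards [coeFn_smoothLp m (φ n)] with x hx
  rw [Pi.sub_apply, hx]

end Smooth

/-! ### Smooth functions in `H¹`; closedness of `H¹` -/

section Jets

variable {E : Type*} [NormedAddCommGroup E] [NormedSpace ℝ E] [MeasureSpace E] [BorelSpace E]
  [SecondCountableTopology E] {ι : Type*}

/-- The function and its directional derivatives, as classes in `L²(Ω)`. -/
def jet (Ω : Set E) (e : ι → E) [CompactlyCarried (volume.restrict Ω)] :
    Smooth E →ₗ[ℝ] PiLp 2 (fun _ : Option ι => L2 Ω) where
  toFun φ := WithLp.toLp 2 fun o =>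
    o.elim (smoothLp (volume.restrict Ω) φ)
      fun j => smoothLp (volume.restrict Ω) (Smooth.deriv (e j) φ)
  map_add' φ ψ := by ext1 o; cases o <;> simp
  map_smul' c φ := by ext1 o; cases o <;> simp

variable (Ω : Set E) (e : ι → E) [CompactlyCarried (volume.restrict Ω)]

theorem jet_none (φ : Smooth E) : jet Ω e φ none = smoothLp (volume.restrict Ω) φ := rfl

theorem jet_some (φ : Smooth E) (j : ι) :
    jet Ω e φ (some j) = smoothLp (volume.restrict Ω) (Smooth.deriv (e j) φ) := rfl

theorem tendsto_piLp_iff {X : Type*} [NormedAddCommGroup X]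
    (u : ℕ → PiLp 2 (fun _ : Option ι => X)) (w : PiLp 2 (fun _ : Option ι => X)) :
    Tendsto u atTop (𝓝 w) ↔ ∀ o, Tendsto (fun n => u n o) atTop (𝓝 (w o)) := by
  rw [(PiLp.homeomorph 2 (fun _ : Option ι => X)).isInducing.tendsto_nhds_iff, tendsto_pi_nhds]
  rfl

theorem tendstoH1_iff (φ : ℕ → Smooth E) (w : PiLp 2 (fun _ : Option ι => L2 Ω)) :
    TendstoH1 Ω e (fun n => (φ n).1) w ↔ Tendsto (fun n => jet Ω e (φ n)) atTop (𝓝 w) := by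
  rw [tendsto_piLp_iff, Option.forall]
  refine and_congr (tendstoL2_iff _ φ _) (forall_congr' fun j => ?_)
  exact tendstoL2_iff _ (fun n => Smooth.deriv (e j) (φ n)) _

theorem norm_sq_jet [Fintype ι] (φ : Smooth E) :
    ‖jet Ω e φ‖ ^ 2 = (∫ x in Ω, φ.1 x ^ 2) + ∑ j, ∫ x in Ω, fderiv ℝ φ.1 x (e j) ^ 2 := by
  rw [PiLp.norm_sq_eq_of_L2, Fintype.sum_option, jet_none, norm_sq_smoothLp]
  simp only [jet_some, norm_sq_smoothLp]
  rfl

/-- The integral is the inner product with a fixed element of `L²`. -/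
theorem continuous_integral_mul {α : Type*} [MeasurableSpace α] {m : Measure α} {ψ : α → ℝ}
    (hψ : MemLp ψ 2 m) : Continuous fun f : Lp ℝ 2 m => ∫ x, f x * ψ x ∂m := by
  have h : (fun f : Lp ℝ 2 m => ∫ x, f x * ψ x ∂m) = fun f => inner ℝ (hψ.toLp ψ) f := by
    funext f
    rw [L2.inner_def]
    refine integral_congr_ae ?_
    filter_upwards [hψ.coeFn_toLp] with x hx
    simp [hx]
  rw [h]
  fun_prop

omit [SecondCountableTopology E] [CompactlyCarried (volume.restrict Ω)] in
-- Each test function imposes one equation between continuous functionals of the jet.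
theorem isClosed_H1 [Fintype ι] [IsFiniteMeasureOnCompacts (volume : Measure E)] :
    IsClosed (H1 Ω e : Set (PiLp 2 (fun _ : Option ι => L2 Ω))) := by
  have h : (H1 Ω e : Set (PiLp 2 (fun _ : Option ι => L2 Ω))) =
      ⋂ (j : ι) (φ : E → ℝ) (_ : ContDiff ℝ ∞ φ) (_ : HasCompactSupport φ) (_ : tsupport φ ⊆ Ω),
        {w | ∫ x in Ω, w none x * fderiv ℝ φ x (e j) = -∫ x in Ω, w (some j) x * φ x} := by
    ext w
    simp only [mem_iInter]
    rfl
  rw [h]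
  refine isClosed_iInter fun j => isClosed_iInter fun φ => isClosed_iInter fun hφ =>
    isClosed_iInter fun hc => isClosed_iInter fun hs => ?_
  have cd : Continuous (fun x => fderiv ℝ φ x (e j)) :=
    (hφ.continuous_fderiv (by simp)).clm_apply continuous_const
  have dc : HasCompactSupport (fun x => fderiv ℝ φ x (e j)) := hc.fderiv_apply ℝ (e j)
  refine isClosed_eq ?_ ?_
  · exact (continuous_integral_mul (cd.memLp_of_hasCompactSupport dc)).comp (by fun_prop)
  · exact ((continuous_integral_mul (hφ.continuous.memLp_of_hasCompactSupport hc)).comp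
      (by fun_prop)).neg

/-- The test function vanishes outside `Ω`, so both integrals extend to the whole space, where
integration by parts has no boundary term. -/
theorem jet_mem_H1 [FiniteDimensional ℝ E] [(volume : Measure E).IsAddHaarMeasure]
    (φ : Smooth E) : jet Ω e φ ∈ H1 Ω e := by
  intro j ψ hψ hc hs
  have cd : Continuous (fun x => fderiv ℝ ψ x (e j)) :=
    (hψ.continuous_fderiv (by simp)).clm_apply continuous_const
  have dc : HasCompactSupport (fun x => fderiv ℝ ψ x (e j)) := hc.fderiv_apply ℝ (e j)
  have z : ∀ x, x ∉ Ω → ψ x = 0 := fun x hx => image_eq_zero_of_notMem_tsupport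
    fun h => hx (hs h)
  have z' : ∀ x, x ∉ Ω → fderiv ℝ ψ x (e j) = 0 := fun x hx => by
    have : fderiv ℝ ψ x = 0 := image_eq_zero_of_notMem_tsupport (f := fderiv ℝ ψ)
      fun h => hx (hs (tsupport_fderiv_subset ℝ h))
    rw [this]
    rfl
  have e1 : ∫ x in Ω, jet Ω e φ none x * fderiv ℝ ψ x (e j) =
      ∫ x, φ.1 x * fderiv ℝ ψ x (e j) := by
    rw [← setIntegral_eq_integral_of_forall_compl_eq_zero (s := Ω) (μ := volume)
      (f := fun x => φ.1 x * fderiv ℝ ψ x (e j)) fun x hx => by rw [z' x hx, mul_zero]]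
    refine integral_congr_ae ?_
    filter_upwards [coeFn_smoothLp (volume.restrict Ω) φ] with x hx
    rw [jet_none, hx]
  have e2 : ∫ x in Ω, jet Ω e φ (some j) x * ψ x = ∫ x, fderiv ℝ φ.1 x (e j) * ψ x := by
    rw [← setIntegral_eq_integral_of_forall_compl_eq_zero (s := Ω) (μ := volume)
      (f := fun x => fderiv ℝ φ.1 x (e j) * ψ x) fun x hx => by rw [z x hx, mul_zero]]
    refine integral_congr_ae ?_
    filter_upwards [coeFn_smoothLp (volume.restrict Ω) (Smooth.deriv (e j) φ)] with x hx
    rw [jet_some, hx]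
    rfl
  rw [e1, e2]
  refine integral_mul_fderiv_eq_neg_fderiv_mul_of_integrable (f := φ.1) (g := ψ) ?_ ?_ ?_
    (fun x _ => φ.differentiable x) (fun x _ => hψ.differentiable (by simp) x)
  · exact ((Smooth.deriv (e j) φ).continuous.mul hψ.continuous).integrable_of_hasCompactSupport
      hc.mul_left
  · exact (φ.continuous.mul cd).integrable_of_hasCompactSupport dc.mul_left
  · exact (φ.continuous.mul hψ.continuous).integrable_of_hasCompactSupport hc.mul_left

theorem mem_H1_of_tendsto [Fintype ι] [FiniteDimensional ℝ E]
    [(volume : Measure E).IsAddHaarMeasure] {φ : ℕ → Smooth E}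
    {w : PiLp 2 (fun _ : Option ι => L2 Ω)}
    (h : Tendsto (fun n => jet Ω e (φ n)) atTop (𝓝 w)) : w ∈ H1 Ω e :=
  (isClosed_H1 Ω e).mem_of_tendsto h (Eventually.of_forall fun n => jet_mem_H1 Ω e (φ n))

end Jets

section Density

variable {S X Y : Type*} [AddCommGroup S] [Module ℝ S] [NormedAddCommGroup X] [NormedSpace ℝ X]
  [NormedAddCommGroup Y] [NormedSpace ℝ Y]

/-- If `J'` is bounded with respect to `J`, then `J'` converges along sequences along which `J`
does. -/
theorem exists_tendsto_of_norm_le [CompleteSpace Y] (J : S →ₗ[ℝ] X) (J' : S →ₗ[ℝ] Y) {C : ℝ}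
    (h : ∀ s, ‖J' s‖ ≤ C * ‖J s‖) {s : ℕ → S} {w : X}
    (hs : Tendsto (fun n => J (s n)) atTop (𝓝 w)) :
    ∃ w', Tendsto (fun n => J' (s n)) atTop (𝓝 w') ∧ ‖w'‖ ≤ C * ‖w‖ := by
  have hc : CauchySeq fun n => J' (s n) := by
    have h0 : Tendsto (fun p : ℕ × ℕ => |C| * ‖J (s p.1) - J (s p.2)‖) atTop (𝓝 0) := by
      have := (hs.cauchySeq.tendsto_uniformity).mono_right
        (Metric.uniformity_eq_comap_nhds_zero (α := X)).le
      rw [tendsto_comap_iff] at this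
      have h2 := this.const_mul |C|
      rw [mul_zero] at h2
      refine h2.congr fun p => ?_
      simp [dist_eq_norm]
    rw [cauchySeq_iff_tendsto_dist_atTop_0]
    refine squeeze_zero (fun _ => dist_nonneg) (fun p => ?_) h0
    rw [dist_eq_norm, ← map_sub, ← map_sub]
    exact (h _).trans (mul_le_mul_of_nonneg_right (le_abs_self C) (norm_nonneg _))
  obtain ⟨w', hw'⟩ := cauchySeq_tendsto_of_complete hc
  exact ⟨w', hw', le_of_tendsto_of_tendsto' hw'.norm (hs.norm.const_mul C) fun n => h _⟩

end Density

/-! ### Traces -/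

section Slices

/-- Cauchy-Schwarz against the constant `1`, obtained by expanding the nonnegative integral of `(|f|
- mean)²`. -/
theorem sq_setIntegral_abs_le {f : ℝ → ℝ} (hf : Continuous f) {a b : ℝ} (hab : a < b) :
    (∫ x in Ioo a b, |f x|) ^ 2 ≤ (b - a) * ∫ x in Ioo a b, f x ^ 2 := by
  have hi (g : ℝ → ℝ) (hg : Continuous g) : IntegrableOn g (Ioo a b) :=
    integrable_of_continuous _ hg
  set I := ∫ x in Ioo a b, |f x| with hI
  have hpos : 0 < b - a := sub_pos.2 hab
  have h0 : 0 ≤ ∫ x in Ioo a b, (|f x| - I / (b - a)) ^ 2 :=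
    integral_nonneg fun _ => sq_nonneg _
  have h1 : ∫ x in Ioo a b, (|f x| - I / (b - a)) ^ 2 =
      (∫ x in Ioo a b, f x ^ 2) - 2 * (I / (b - a)) * I + (I / (b - a)) ^ 2 * (b - a) := by
    have e : ∀ x, (|f x| - I / (b - a)) ^ 2 =
        f x ^ 2 - 2 * (I / (b - a)) * |f x| + (I / (b - a)) ^ 2 := fun x => by
      rw [← sq_abs (f x)]; ring
    simp only [e]
    rw [integral_add, integral_sub, integral_const_mul, ← hI]
    · simp [hab.le]
      ring
    · exact hi _ (by fun_prop)
    · exact hi _ (by fun_prop)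
    · exact hi _ (by fun_prop)
    · exact hi _ (by fun_prop)
  rw [h1] at h0
  have h2 : (∫ x in Ioo a b, f x ^ 2) - 2 * (I / (b - a)) * I + (I / (b - a)) ^ 2 * (b - a) =
      (∫ x in Ioo a b, f x ^ 2) - I ^ 2 / (b - a) := by
    field_simp
    ring
  rw [h2, sub_nonneg, div_le_iff₀ hpos] at h0
  linarith

variable {f f' : ℝ → ℝ} {a b : ℝ}

/-- The source of all trace and Poincaré inequalities below: the fundamental theorem of calculus
between `t` and `s`, then Cauchy-Schwarz. -/
theorem sq_le_of_hasDerivAt (hf : ∀ x, HasDerivAt f (f' x) x) (hf' : Continuous f')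
    (hab : a < b) {s t : ℝ} (hs : s ∈ Icc a b) (ht : t ∈ Icc a b) :
    f s ^ 2 ≤ 2 * f t ^ 2 + 2 * (b - a) * ∫ x in Ioo a b, f' x ^ 2 := by
  have h1 : ∫ x in t..s, f' x = f s - f t :=
    intervalIntegral.integral_eq_sub_of_hasDerivAt (fun x _ => hf x)
      (hf'.intervalIntegrable _ _)
  have h2 : |f s - f t| ≤ ∫ x in Ioo a b, |f' x| := by
    rw [← h1, ← integral_Icc_eq_integral_Ioo]
    have h := intervalIntegral.norm_integral_le_integral_norm_uIoc (f := f') (a := t) (b := s)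
      (μ := volume)
    simp only [Real.norm_eq_abs] at h
    refine h.trans ?_
    refine setIntegral_mono_set (f := fun x => |f' x|) ?_ (ae_of_all _ fun _ => abs_nonneg _)
      (LE.le.eventuallyLE ?_)
    · exact (hf'.abs.continuousOn).integrableOn_compact isCompact_Icc
    · exact uIoc_subset_uIcc.trans (uIcc_subset_Icc ht hs)
  have h3 := sq_setIntegral_abs_le hf' hab
  have h4 : (f s - f t) ^ 2 ≤ (b - a) * ∫ x in Ioo a b, f' x ^ 2 := by
    refine le_trans ?_ h3
    rw [← sq_abs]
    exact pow_le_pow_left₀ (abs_nonneg _) h2 2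
  -- The square is the defect in `f(s)² ≤ 2 f(t)² + 2 (f(s) - f(t))²`.
  nlinarith [sq_nonneg (f s - 2 * f t)]

/-- The value at a point in terms of the mean square over a subinterval. -/
theorem mul_sq_le_of_hasDerivAt (hf : ∀ x, HasDerivAt f (f' x) x) (hf' : Continuous f')
    {a' b' : ℝ} (ha : a ≤ a') (hab' : a' < b') (hb : b' ≤ b) {s : ℝ} (hs : s ∈ Icc a b) :
    (b' - a') * f s ^ 2 ≤
      2 * (∫ x in Ioo a' b', f x ^ 2) + 2 * (b - a) * (b' - a') * ∫ x in Ioo a b, f' x ^ 2 := by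
  have hc : Continuous f := continuous_iff_continuousAt.2 fun x => (hf x).continuousAt
  have hab : a < b := by linarith
  have h : ∫ t in Ioo a' b', f s ^ 2 ≤
      ∫ t in Ioo a' b', (2 * f t ^ 2 + 2 * (b - a) * ∫ x in Ioo a b, f' x ^ 2) := by
    refine setIntegral_mono_on (integrable_of_continuous _ continuous_const)
      (integrable_of_continuous _ (by fun_prop)) measurableSet_Ioo fun t ht => ?_
    exact sq_le_of_hasDerivAt hf hf' hab hs ⟨ha.trans ht.1.le, ht.2.le.trans hb⟩
  rw [integral_add (integrable_of_continuous _ (by fun_prop))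
    (integrable_of_continuous _ continuous_const), integral_const_mul] at h
  simp only [setIntegral_const, Real.volume_real_Ioo_of_le hab'.le, smul_eq_mul] at h
  linarith

end Slices

/-! ### Slice inequalities on rectangles and the trace inequality -/

section Rectangle

variable {L a b : ℝ}

theorem Smooth.hasDerivAt_fst (φ : Smooth (ℝ × ℝ)) (x y : ℝ) :
    HasDerivAt (fun t => φ.1 (t, y)) (Smooth.deriv (1, 0) φ |>.1 (x, y)) x :=
  ((φ.differentiable (x, y)).hasFDerivAt).comp_hasDerivAt x
    ((hasDerivAt_id x).prodMk (hasDerivAt_const x y))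

theorem Smooth.hasDerivAt_snd (φ : Smooth (ℝ × ℝ)) (x y : ℝ) :
    HasDerivAt (fun t => φ.1 (x, t)) (Smooth.deriv (0, 1) φ |>.1 (x, y)) y :=
  ((φ.differentiable (x, y)).hasFDerivAt).comp_hasDerivAt y
    ((hasDerivAt_const y x).prodMk (hasDerivAt_id y))

theorem integrable_prod_of_continuous {F : ℝ × ℝ → ℝ} (hF : Continuous F) (L a b : ℝ) :
    Integrable F ((volume.restrict (Ioo 0 L)).prod (volume.restrict (Ioo a b))) := by
  rw [← volume_restrict_rect]
  exact integrable_of_continuous _ hF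

theorem setIntegral_rect {F : ℝ × ℝ → ℝ} (hF : Continuous F) (L a b : ℝ) :
    ∫ z in rect L a b, F z = ∫ x in Ioo 0 L, ∫ y in Ioo a b, F (x, y) := by
  rw [volume_restrict_rect, integral_prod _ (integrable_prod_of_continuous hF L a b)]

theorem setIntegral_rect_symm {F : ℝ × ℝ → ℝ} (hF : Continuous F) (L a b : ℝ) :
    ∫ z in rect L a b, F z = ∫ y in Ioo a b, ∫ x in Ioo 0 L, F (x, y) := by
  rw [volume_restrict_rect, integral_prod_symm _ (integrable_prod_of_continuous hF L a b)]

theorem integrable_slice_fst {F : ℝ × ℝ → ℝ} (hF : Continuous F) (L a b : ℝ) :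
    IntegrableOn (fun x => ∫ y in Ioo a b, F (x, y)) (Ioo 0 L) :=
  (integrable_prod_of_continuous hF L a b).integral_prod_left

theorem integrable_slice_snd {F : ℝ × ℝ → ℝ} (hF : Continuous F) (L a b : ℝ) :
    IntegrableOn (fun y => ∫ x in Ioo 0 L, F (x, y)) (Ioo a b) :=
  (integrable_prod_of_continuous hF L a b).integral_prod_right

theorem Smooth.continuous_sq (φ : Smooth (ℝ × ℝ)) : Continuous fun z => φ.1 z ^ 2 :=
  φ.continuous.pow 2

/-- The one-dimensional inequality on vertical slices, integrated over `x`. The reference strip may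
be smaller than the rectangle: the full one serves for traces, a thin one for the Poincaré
inequality. -/
theorem integral_horizontal_le (φ : Smooth (ℝ × ℝ)) {a' b' : ℝ} (ha : a ≤ a') (hab' : a' < b')
    (hb : b' ≤ b) {s : ℝ} (hs : s ∈ Icc a b) :
    (b' - a') * ∫ x in Ioo 0 L, φ.1 (x, s) ^ 2 ≤
      2 * (∫ z in rect L a' b', φ.1 z ^ 2) +
        2 * (b - a) * (b' - a') * ∫ z in rect L a b, (Smooth.deriv (0, 1) φ).1 z ^ 2 := by
  have c1 := φ.continuous_sq
  have c2 := (Smooth.deriv (0, 1) φ).continuous_sq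
  rw [setIntegral_rect c1, setIntegral_rect c2, ← integral_const_mul, ← integral_const_mul,
    ← integral_const_mul, ← integral_add]
  · refine integral_mono (integrable_of_continuous _ ?_) (Integrable.add ?_ ?_) fun x => ?_
    · exact continuous_const.mul (c1.comp (by fun_prop : Continuous fun x : ℝ => (x, s)))
    · exact (integrable_slice_fst c1 L a' b').const_mul _
    · exact (integrable_slice_fst c2 L a b).const_mul _
    · exact mul_sq_le_of_hasDerivAt (fun y => φ.hasDerivAt_snd x y)
        ((Smooth.deriv (0, 1) φ).continuous.comp (by fun_prop)) ha hab' hb hs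
  · exact (integrable_slice_fst c1 L a' b').const_mul _
  · exact (integrable_slice_fst c2 L a b).const_mul _

theorem integral_vertical_le (φ : Smooth (ℝ × ℝ)) (hL : 0 < L) {s : ℝ} (hs : s ∈ Icc 0 L) :
    L * ∫ y in Ioo a b, φ.1 (s, y) ^ 2 ≤
      2 * (∫ z in rect L a b, φ.1 z ^ 2) +
        2 * L * L * ∫ z in rect L a b, (Smooth.deriv (1, 0) φ).1 z ^ 2 := by
  have c1 := φ.continuous_sq
  have c2 := (Smooth.deriv (1, 0) φ).continuous_sq
  rw [setIntegral_rect_symm c1, setIntegral_rect_symm c2, ← integral_const_mul,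
    ← integral_const_mul, ← integral_const_mul, ← integral_add]
  · refine integral_mono (integrable_of_continuous _ ?_) (Integrable.add ?_ ?_) fun y => ?_
    · exact continuous_const.mul (c1.comp (by fun_prop : Continuous fun y : ℝ => (s, y)))
    · exact (integrable_slice_snd c1 L a b).const_mul _
    · exact (integrable_slice_snd c2 L a b).const_mul _
    · have := mul_sq_le_of_hasDerivAt (fun x => φ.hasDerivAt_fst x y)
        ((Smooth.deriv (1, 0) φ).continuous.comp (by fun_prop)) le_rfl hL le_rfl hs
      simpa only [sub_zero] using this
  · exact (integrable_slice_snd c1 L a b).const_mul _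
  · exact (integrable_slice_snd c2 L a b).const_mul _

/-- On each horizontal slice the reference point is the left end, where `Γ_D` will make the boundary
term vanish in the limit. -/
theorem integral_rect_le_of_left (φ : Smooth (ℝ × ℝ)) (hL : 0 < L) :
    ∫ z in rect L a b, φ.1 z ^ 2 ≤ 2 * L * (∫ y in Ioo a b, φ.1 (0, y) ^ 2) +
      2 * L * L * ∫ z in rect L a b, (Smooth.deriv (1, 0) φ).1 z ^ 2 := by
  have c1 := φ.continuous_sq
  have c2 := (Smooth.deriv (1, 0) φ).continuous_sq
  have c3 : Continuous fun y : ℝ => φ.1 (0, y) ^ 2 :=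
    c1.comp (by fun_prop : Continuous fun y : ℝ => ((0 : ℝ), y))
  rw [setIntegral_rect_symm c1, setIntegral_rect_symm c2, ← integral_const_mul,
    ← integral_const_mul, ← integral_add]
  · refine integral_mono (integrable_slice_snd c1 L a b) (Integrable.add ?_ ?_) fun y => ?_
    · exact (integrable_of_continuous _ c3).const_mul _
    · exact (integrable_slice_snd c2 L a b).const_mul _
    · have hc : Continuous fun x : ℝ => φ.1 (x, y) ^ 2 := c1.comp (by fun_prop)
      have h := setIntegral_mono_on (μ := volume) (s := Ioo 0 L)
        (integrable_of_continuous _ hc)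
        (integrable_of_continuous _ continuous_const) measurableSet_Ioo fun x hx =>
          sq_le_of_hasDerivAt (fun x => φ.hasDerivAt_fst x y)
            ((Smooth.deriv (1, 0) φ).continuous.comp (by fun_prop)) hL
            (Ioo_subset_Icc_self hx) (left_mem_Icc.2 hL.le)
      simp only [setIntegral_const, Real.volume_real_Ioo_of_le hL.le, smul_eq_mul,
        sub_zero] at h
      refine h.trans (le_of_eq ?_)
      ring
  · exact (integrable_of_continuous _ c3).const_mul _
  · exact (integrable_slice_snd c2 L a b).const_mul _

/-- The bound of `integral_horizontal_le` does not depend on the height `s`, so integrating over `s`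
multiplies it by `b - a`. -/
theorem integral_rect_le_of_strip (φ : Smooth (ℝ × ℝ)) {a' b' : ℝ} (ha : a ≤ a') (hab' : a' < b')
    (hb : b' ≤ b) :
    (b' - a') * ∫ z in rect L a b, φ.1 z ^ 2 ≤
      (b - a) * (2 * (∫ z in rect L a' b', φ.1 z ^ 2) +
        2 * (b - a) * (b' - a') * ∫ z in rect L a b, (Smooth.deriv (0, 1) φ).1 z ^ 2) := by
  have c1 := φ.continuous_sq
  rw [setIntegral_rect_symm c1 L a b, ← integral_const_mul]
  have h := setIntegral_mono_on (μ := volume) (s := Ioo a b)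
        ((integrable_slice_snd c1 L a b).const_mul (b' - a'))
        (integrable_of_continuous _ continuous_const) measurableSet_Ioo fun y hy =>
          integral_horizontal_le (L := L) φ ha hab' hb (Ioo_subset_Icc_self hy)
  simpa only [setIntegral_const, Real.volume_real_Ioo_of_le (ha.trans (hab'.le.trans hb)),
    smul_eq_mul] using h

theorem norm_sq_jet_rect (φ : Smooth (ℝ × ℝ)) :
    ‖jet (rect L a b) planeDirs φ‖ ^ 2 = (∫ z in rect L a b, φ.1 z ^ 2) +
      ((∫ z in rect L a b, (Smooth.deriv (1, 0) φ).1 z ^ 2) +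
        ∫ z in rect L a b, (Smooth.deriv (0, 1) φ).1 z ^ 2) := by
  rw [norm_sq_jet, Fin.sum_univ_two]
  rfl

theorem norm_sq_smoothLp_arcLength (φ : Smooth (ℝ × ℝ)) :
    ‖smoothLp (arcLength L a b) φ‖ ^ 2 =
      (∫ x in Ioo 0 L, φ.1 (x, a) ^ 2) + (∫ x in Ioo 0 L, φ.1 (x, b) ^ 2) +
        (∫ y in Ioo a b, φ.1 (0, y) ^ 2) + ∫ y in Ioo a b, φ.1 (L, y) ^ 2 := by
  have c := φ.continuous_sq
  have hc (m : Measure (ℝ × ℝ)) : AEStronglyMeasurable (fun z => φ.1 z ^ 2) m :=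
    c.aestronglyMeasurable
  have i (c d : ℝ) {f : ℝ → ℝ × ℝ} (hf : Continuous f) :
      Integrable (fun z => φ.1 z ^ 2) ((volume.restrict (Ioo c d)).map f) := by
    rw [integrable_map_measure (hc _) hf.aemeasurable]
    exact integrable_of_continuous (f := (fun z => φ.1 z ^ 2) ∘ f) _ (φ.continuous_sq.comp hf)
  have i1 := i 0 L (f := fun x => (x, a)) (by fun_prop)
  have i2 := i 0 L (f := fun x => (x, b)) (by fun_prop)
  have i3 := i a b (f := fun y => (0, y)) (by fun_prop)
  have i4 := i a b (f := fun y => (L, y)) (by fun_prop)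
  rw [norm_sq_smoothLp, arcLength, integral_add_measure ((i1.add_measure i2).add_measure i3) i4,
    integral_add_measure (i1.add_measure i2) i3, integral_add_measure i1 i2,
    integral_map (by fun_prop) (hc _), integral_map (by fun_prop) (hc _),
    integral_map (by fun_prop) (hc _), integral_map (by fun_prop) (hc _)]

/-- The trace inequality for smooth functions. -/
theorem exists_norm_trace_le (hL : 0 < L) (hab : a < b) :
    ∃ C, ∀ φ, ‖smoothLp (arcLength L a b) φ‖ ≤ C * ‖jet (rect L a b) planeDirs φ‖ := by
  -- The sum of the coefficients that the two horizontal and the two vertical sides produce; it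
  -- dominates each of them.
  set D : ℝ := 4 / (b - a) + 4 * (b - a) + 4 / L + 4 * L with hD
  have hba : 0 < b - a := sub_pos.2 hab
  have hD0 : 0 ≤ D := by positivity
  refine ⟨√D, fun φ => ?_⟩
  refine le_of_sq_le_sq ?_ (by positivity)
  rw [mul_pow, Real.sq_sqrt hD0, norm_sq_smoothLp_arcLength, norm_sq_jet_rect]
  have h1 := integral_horizontal_le (L := L) φ le_rfl hab le_rfl (left_mem_Icc.2 hab.le)
  have h2 := integral_horizontal_le (L := L) φ le_rfl hab le_rfl (right_mem_Icc.2 hab.le)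
  have h3 := integral_vertical_le (a := a) (b := b) φ hL (left_mem_Icc.2 hL.le)
  have h4 := integral_vertical_le (a := a) (b := b) φ hL (right_mem_Icc.2 hL.le)
  have p0 : 0 ≤ ∫ z in rect L a b, φ.1 z ^ 2 := integral_nonneg fun _ => sq_nonneg _
  have p1 : 0 ≤ ∫ z in rect L a b, (Smooth.deriv (1, 0) φ).1 z ^ 2 :=
    integral_nonneg fun _ => sq_nonneg _
  have p2 : 0 ≤ ∫ z in rect L a b, (Smooth.deriv (0, 1) φ).1 z ^ 2 :=
    integral_nonneg fun _ => sq_nonneg _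
  set A := ∫ z in rect L a b, φ.1 z ^ 2
  set B := ∫ z in rect L a b, (Smooth.deriv (1, 0) φ).1 z ^ 2
  set G := ∫ z in rect L a b, (Smooth.deriv (0, 1) φ).1 z ^ 2
  rw [← le_div_iff₀' hba] at h1 h2
  rw [← le_div_iff₀' hL] at h3 h4
  have e1 : (2 * A + 2 * (b - a) * (b - a) * G) / (b - a) = 2 / (b - a) * A + 2 * (b - a) * G := by
    field_simp
  have e2 : (2 * A + 2 * L * L * B) / L = 2 / L * A + 2 * L * B := by
    field_simp
  rw [e1] at h1 h2
  rw [e2] at h3 h4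
  have q1 : 0 ≤ 4 / (b - a) := by positivity
  have q2 : 0 ≤ 4 / L := by positivity
  have e3 : D * (A + (B + G)) = (4 / (b - a) * A + 4 / L * A + 4 * L * B + 4 * (b - a) * G) +
      ((4 * (b - a) + 4 * L) * A + (4 / (b - a) + 4 * (b - a) + 4 / L) * B +
        (4 / (b - a) + 4 / L + 4 * L) * G) := by rw [hD]; ring
  have e4 : 0 ≤ (4 * (b - a) + 4 * L) * A + (4 / (b - a) + 4 * (b - a) + 4 / L) * B +
        (4 / (b - a) + 4 / L + 4 * L) * G := by positivity
  have e5 : 4 / (b - a) = 2 / (b - a) + 2 / (b - a) := by ring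
  have e6 : 4 / L = 2 / L + 2 / L := by ring
  rw [e3]
  refine le_trans ?_ (le_add_of_nonneg_right e4)
  rw [e5, e6]
  linarith

end Rectangle

/-! ### Uniqueness of traces and completeness of the trace-constrained spaces -/

section Trace

variable {L a b : ℝ}

theorem isTrace_iff {w : Jet L a b} {g : Lp ℝ 2 (arcLength L a b)} :
    IsTrace L a b w g ↔ ∃ φ : ℕ → Smooth (ℝ × ℝ),
      Tendsto (fun n => jet (rect L a b) planeDirs (φ n)) atTop (𝓝 w) ∧
        Tendsto (fun n => smoothLp (arcLength L a b) (φ n)) atTop (𝓝 g) := by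
  constructor
  · rintro ⟨φ, hφ, h1, h2⟩
    exact ⟨fun n => ⟨φ n, hφ n⟩, (tendstoH1_iff _ _ (fun n => ⟨φ n, hφ n⟩) w).1 h1,
      (tendstoL2_iff _ (fun n => ⟨φ n, hφ n⟩) g).1 h2⟩
  · rintro ⟨φ, h1, h2⟩
    exact ⟨fun n => (φ n).1, fun n => (φ n).2, (tendstoH1_iff _ _ φ w).2 h1,
      (tendstoL2_iff _ φ g).2 h2⟩

theorem exists_norm_le_of_isTrace (hL : 0 < L) (hab : a < b) :
    ∃ C, ∀ w g, IsTrace L a b w g → ‖g‖ ≤ C * ‖w‖ := by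
  obtain ⟨C, hC⟩ := exists_norm_trace_le hL hab
  refine ⟨C, fun w g h => ?_⟩
  obtain ⟨φ, h1, h2⟩ := isTrace_iff.1 h
  exact le_of_tendsto_of_tendsto' h2.norm (h1.norm.const_mul C) fun n => hC _

theorem IsTrace.sub {w z : Jet L a b} {g k : Lp ℝ 2 (arcLength L a b)}
    (hw : IsTrace L a b w g) (hz : IsTrace L a b z k) : IsTrace L a b (w - z) (g - k) := by
  have h := hw.add (hz.smul (-1))
  simpa only [neg_smul, one_smul, ← sub_eq_add_neg] using h

theorem IsTrace.unique (hL : 0 < L) (hab : a < b) {w : Jet L a b}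
    {g k : Lp ℝ 2 (arcLength L a b)} (h : IsTrace L a b w g) (h' : IsTrace L a b w k) :
    g = k := by
  obtain ⟨C, hC⟩ := exists_norm_le_of_isTrace hL hab
  have := hC _ _ (h.sub h')
  rw [sub_self, norm_zero, mul_zero] at this
  exact sub_eq_zero.1 (norm_le_zero_iff.1 this)

theorem IsTrace.mem_H1 {w : Jet L a b} {g : Lp ℝ 2 (arcLength L a b)} (h : IsTrace L a b w g) :
    w ∈ H1 (rect L a b) planeDirs := by
  obtain ⟨φ, h1, -⟩ := isTrace_iff.1 h
  exact mem_H1_of_tendsto _ _ h1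

/-- By definition the trace relation is the closure of the graph of restriction on smooth functions.
-/
theorem isClosed_isTrace :
    IsClosed {p : Jet L a b × Lp ℝ 2 (arcLength L a b) | IsTrace L a b p.1 p.2} := by
  have h : {p : Jet L a b × Lp ℝ 2 (arcLength L a b) | IsTrace L a b p.1 p.2} =
      closure (range fun φ => (jet (rect L a b) planeDirs φ, smoothLp (arcLength L a b) φ)) := by
    ext p
    rw [mem_closure_iff_seq_limit, mem_ofPred_eq, isTrace_iff]
    constructor
    · rintro ⟨φ, h1, h2⟩
      exact ⟨_, fun n => ⟨φ n, rfl⟩, h1.prodMk_nhds h2⟩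
    · rintro ⟨x, hx, hp⟩
      choose φ hφ using hx
      obtain rfl : (fun n => (jet (rect L a b) planeDirs (φ n),
        smoothLp (arcLength L a b) (φ n))) = x := funext hφ
      exact ⟨φ, (continuous_fst.tendsto _).comp hp, (continuous_snd.tendsto _).comp hp⟩
  rw [h]
  exact isClosed_closure

/-- An `L²` convergent sequence has an a.e. convergent subsequence, and pointwise limits of zeros
are zero. -/
theorem isClosed_ae_eq_zero {α : Type*} [MeasurableSpace α] (m : Measure α) (Γ : Set α) :
    IsClosed {g : Lp ℝ 2 m | ∀ᵐ z ∂m, z ∈ Γ → g z = 0} := by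
  refine isClosed_of_closure_subset fun g hg => ?_
  obtain ⟨u, hu, hug⟩ := mem_closure_iff_seq_limit.1 hg
  obtain ⟨ns, -, hns⟩ := (tendstoInMeasure_of_tendsto_Lp hug).exists_seq_tendsto_ae
  filter_upwards [ae_all_iff.2 hu, hns] with z h1 h2 hz
  refine tendsto_nhds_unique h2 ?_
  simp only [fun i => h1 (ns i) hz]
  exact tendsto_const_nhds

/-- The `H¹` condition is redundant: a function with a trace is a limit of smooth jets, and `H¹` is
closed. -/
theorem mem_H1zero {Γ : Set (ℝ × ℝ)} {w : Jet L a b} : w ∈ H1zero L a b Γ ↔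
    ∃ g, IsTrace L a b w g ∧ ∀ᵐ z ∂(arcLength L a b), z ∈ Γ → g z = 0 :=
  ⟨fun h => h.2, fun h => ⟨h.choose_spec.1.mem_H1, h⟩⟩

/-- The trace bound makes the traces of a convergent sequence Cauchy; the limit trace then still
vanishes on `Γ`. This supplies the completeness needed for Lax-Milgram. -/
theorem isClosed_H1zero (hL : 0 < L) (hab : a < b) (Γ : Set (ℝ × ℝ)) :
    IsClosed (H1zero L a b Γ : Set (Jet L a b)) := by
  obtain ⟨C, hC⟩ := exists_norm_le_of_isTrace hL hab
  refine isClosed_of_closure_subset fun w hw => ?_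
  obtain ⟨u, hu, huw⟩ := mem_closure_iff_seq_limit.1 hw
  have hu' := fun n => mem_H1zero.1 (hu n)
  choose g hg g0 using hu'
  have hc : CauchySeq g := by
    rw [cauchySeq_iff_tendsto_dist_atTop_0]
    have h := (cauchySeq_iff_tendsto_dist_atTop_0.1 huw.cauchySeq).const_mul C
    rw [mul_zero] at h
    refine squeeze_zero (fun _ => dist_nonneg) (fun p => ?_) h
    rw [dist_eq_norm, dist_eq_norm]
    exact hC _ _ ((hg _).sub (hg _))
  obtain ⟨k, hk⟩ := cauchySeq_tendsto_of_complete hc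
  have h1 := isClosed_isTrace.mem_of_tendsto (f := fun n => (u n, g n)) (huw.prodMk_nhds hk)
    (Eventually.of_forall fun n => hg n)
  have h2 := (isClosed_ae_eq_zero (arcLength L a b) Γ).mem_of_tendsto (f := g) hk
    (Eventually.of_forall fun n => g0 n)
  exact mem_H1zero.2 ⟨k, h1, h2⟩

end Trace

section Interval

theorem mem_VGam {L : ℝ} {w : PiLp 2 (fun _ : Option (Fin 1) => L2 (Ioo (0 : ℝ) L))} :
    w ∈ VGam L ↔ ∃ φ : ℕ → Smooth ℝ,
      (∀ n, HasCompactSupport (φ n).1 ∧ tsupport (φ n).1 ⊆ Ioo 0 L) ∧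
      Tendsto (fun n => jet (Ioo 0 L) (fun _ : Fin 1 => (1 : ℝ)) (φ n)) atTop (𝓝 w) := by
  constructor
  · rintro ⟨-, φ, hφ, h⟩
    exact ⟨fun n => ⟨φ n, (hφ n).1⟩, fun n => (hφ n).2,
      (tendstoH1_iff _ _ (fun n => ⟨φ n, (hφ n).1⟩) w).1 h⟩
  · rintro ⟨φ, hφ, h⟩
    exact ⟨mem_H1_of_tendsto _ _ h, fun n => (φ n).1, fun n => ⟨(φ n).2, hφ n⟩,
      (tendstoH1_iff _ _ φ w).2 h⟩

/-- The space is the closure of the jets of test functions; their limits are automatically in `H¹`.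
-/
theorem isClosed_VGam (L : ℝ) :
    IsClosed (VGam L : Set (PiLp 2 (fun _ : Option (Fin 1) => L2 (Ioo (0 : ℝ) L)))) := by
  have h : (VGam L : Set (PiLp 2 (fun _ : Option (Fin 1) => L2 (Ioo (0 : ℝ) L)))) =
      closure (jet (Ioo 0 L) (fun _ : Fin 1 => (1 : ℝ)) ''
        {φ | HasCompactSupport φ.1 ∧ tsupport φ.1 ⊆ Ioo 0 L}) := by
    ext w
    rw [SetLike.mem_coe, mem_VGam, mem_closure_iff_seq_limit]
    constructor
    · rintro ⟨φ, hφ, h⟩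
      exact ⟨_, fun n => ⟨φ n, hφ n, rfl⟩, h⟩
    · rintro ⟨x, hx, h⟩
      choose φ hφ e using hx
      obtain rfl : (fun n => jet (Ioo 0 L) (fun _ : Fin 1 => (1 : ℝ)) (φ n)) = x := funext e
      exact ⟨φ, hφ, h⟩
  rw [h]
  exact isClosed_closure

end Interval

/-! ### Operations on smooth functions and on traces -/

section Interface

variable {L a b : ℝ}

theorem map_le_arcLength (hab : a = 0 ∨ b = 0) :
    (volume.restrict (Ioo 0 L)).map (fun x : ℝ => (x, (0 : ℝ))) ≤ arcLength L a b := by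
  unfold arcLength
  rcases hab with rfl | rfl
  · rw [add_assoc, add_assoc]
    exact Measure.le_add_right le_rfl
  · rw [add_assoc]
    exact Measure.le_add_right (Measure.le_add_left le_rfl)

/-- The measure on `γ` is one of the four summands of arc length, so restricting to it preserves
square integrability. -/
theorem IsTrace.exists_isTraceOnInterface (h0 : a = 0 ∨ b = 0) {w : Jet L a b}
    {g : Lp ℝ 2 (arcLength L a b)} (h : IsTrace L a b w g) :
    ∃ σ, IsTraceOnInterface L a b w σ := by
  have h1 : MemLp g 2 ((volume.restrict (Ioo 0 L)).map (fun x : ℝ => (x, (0 : ℝ)))) :=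
    (Lp.memLp g).mono_measure (map_le_arcLength h0)
  have h2 : MemLp (fun x : ℝ => g (x, 0)) 2 (volume.restrict (Ioo 0 L)) :=
    (memLp_map_measure_iff h1.aestronglyMeasurable (by fun_prop)).1 h1
  exact ⟨h2.toLp _, g, h, h2.coeFn_toLp.symm⟩

theorem IsTraceOnInterface.unique (hL : 0 < L) (hab : a < b) {w : Jet L a b}
    {σ τ : L2 (Ioo 0 L)} (h : IsTraceOnInterface L a b w σ) (h' : IsTraceOnInterface L a b w τ) :
    σ = τ := by
  obtain ⟨g, hg, h1⟩ := h
  obtain ⟨k, hk, h2⟩ := h'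
  obtain rfl := hg.unique hL hab hk
  exact Lp.ext (h1.symm.trans h2)

theorem traceOnInterface_eq (hL : 0 < L) (hab : a < b) {w : Jet L a b}
    {σ : L2 (Ioo 0 L)} (h : IsTraceOnInterface L a b w σ) : traceOnInterface L a b w = σ := by
  have h' : ∃ σ, IsTraceOnInterface L a b w σ := ⟨σ, h⟩
  unfold traceOnInterface
  rw [dif_pos h']
  exact h'.choose_spec.unique hL hab h

theorem ae_mem_sides (L a b : ℝ) :
    ∀ᵐ z ∂(arcLength L a b), z.1 = 0 ∨ z.1 = L ∨ z.2 = a ∨ z.2 = b := by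
  rw [ae_arcLength_iff]
  · simp
  · exact (measurableSet_eq_fun measurable_fst measurable_const).union
      ((measurableSet_eq_fun measurable_fst measurable_const).union
      ((measurableSet_eq_fun measurable_snd measurable_const).union
      (measurableSet_eq_fun measurable_snd measurable_const)))

/-- A subsequence of a subsequence serves both limits, so a pointwise relation between `φₙ` and `ψₙ`
is inherited by `g` and `k`. -/
theorem exists_subseq_ae_tendsto {E F : Type*} [NormedAddCommGroup E] [NormedSpace ℝ E]
    [MeasurableSpace E] [BorelSpace E] [SecondCountableTopology E] [NormedAddCommGroup F]
    [NormedSpace ℝ F] [MeasurableSpace F] [BorelSpace F] [SecondCountableTopology F]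
    {m : Measure E} [CompactlyCarried m] {m' : Measure F} [CompactlyCarried m']
    {φ : ℕ → Smooth E} {ψ : ℕ → Smooth F} {g : Lp ℝ 2 m} {k : Lp ℝ 2 m'}
    (hφ : Tendsto (fun n => smoothLp m (φ n)) atTop (𝓝 g))
    (hψ : Tendsto (fun n => smoothLp m' (ψ n)) atTop (𝓝 k)) :
    ∃ ns : ℕ → ℕ, (∀ᵐ x ∂m, Tendsto (fun i => (φ (ns i)).1 x) atTop (𝓝 (g x))) ∧
      ∀ᵐ x ∂m', Tendsto (fun i => (ψ (ns i)).1 x) atTop (𝓝 (k x)) := by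
  obtain ⟨ns, hns, h1⟩ := (tendstoInMeasure_of_tendsto_Lp hφ).exists_seq_tendsto_ae
  obtain ⟨ms, hms, h2⟩ := (tendstoInMeasure_of_tendsto_Lp
    (hψ.comp hns.tendsto_atTop)).exists_seq_tendsto_ae
  refine ⟨ns ∘ ms, ?_, ?_⟩
  · filter_upwards [h1, ae_all_iff.2 fun n => coeFn_smoothLp m (φ n)] with x hx hc
    refine (hx.comp hms.tendsto_atTop).congr fun i => ?_
    exact hc _
  · filter_upwards [h2, ae_all_iff.2 fun n => coeFn_smoothLp m' (ψ n)] with x hx hc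
    refine hx.congr fun i => ?_
    exact hc _

/-- The common device for cutoff, reflection and extension: an `H¹` bound for smooth inputs carries
the operation to the limit, and the trace inequality makes the traces converge as well. -/
theorem exists_isTrace_of_norm_le {S X : Type*} [AddCommGroup S] [Module ℝ S]
    [NormedAddCommGroup X] [NormedSpace ℝ X] (hL : 0 < L) (hab : a < b) (J : S →ₗ[ℝ] X)
    (T : S →ₗ[ℝ] Smooth (ℝ × ℝ)) {C : ℝ}
    (h : ∀ s, ‖jet (rect L a b) planeDirs (T s)‖ ≤ C * ‖J s‖) {s : ℕ → S} {w : X}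
    (hs : Tendsto (fun n => J (s n)) atTop (𝓝 w)) :
    ∃ w' g', IsTrace L a b w' g' ∧ ‖w'‖ ≤ C * ‖w‖ ∧
      Tendsto (fun n => smoothLp (arcLength L a b) (T (s n))) atTop (𝓝 g') := by
  obtain ⟨w', h1, h2⟩ :=
    exists_tendsto_of_norm_le J ((jet (rect L a b) planeDirs).comp T) h hs
  obtain ⟨D, hD⟩ := exists_norm_trace_le hL hab
  obtain ⟨g', h3, -⟩ := exists_tendsto_of_norm_le (jet (rect L a b) planeDirs)
    (smoothLp (arcLength L a b)) hD (s := fun n => T (s n)) h1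
  exact ⟨w', g', isTrace_iff.2 ⟨fun n => T (s n), h1, h3⟩, h2, h3⟩

end Interface

section Operations

variable {E F : Type*} [NormedAddCommGroup E] [NormedSpace ℝ E] [NormedAddCommGroup F]
  [NormedSpace ℝ F]

/-- Multiplication by a smooth function. -/
def Smooth.mul (χ : Smooth E) : Smooth E →ₗ[ℝ] Smooth E where
  toFun φ := ⟨fun x => χ.1 x * φ.1 x, (Smooth.contDiff χ).mul (Smooth.contDiff φ)⟩
  map_add' φ ψ := by ext x; exact mul_add _ _ _
  map_smul' c φ := by ext x; exact mul_left_comm _ _ _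

/-- Composition with a continuous linear map. -/
def Smooth.comp (A : E →L[ℝ] F) : Smooth F →ₗ[ℝ] Smooth E where
  toFun φ := ⟨fun x => φ.1 (A x), (Smooth.contDiff φ).comp A.contDiff⟩
  map_add' _ _ := rfl
  map_smul' _ _ := rfl

theorem Smooth.mul_apply (χ φ : Smooth E) (x : E) : (Smooth.mul χ φ).1 x = χ.1 x * φ.1 x := rfl

theorem Smooth.comp_apply (A : E →L[ℝ] F) (φ : Smooth F) (x : E) :
    (Smooth.comp A φ).1 x = φ.1 (A x) := rfl

theorem Smooth.deriv_apply (v : E) (φ : Smooth E) (x : E) :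
    (Smooth.deriv v φ).1 x = fderiv ℝ φ.1 x v := rfl

theorem Smooth.deriv_mul (χ φ : Smooth E) (v x : E) :
    (Smooth.deriv v (Smooth.mul χ φ)).1 x =
      χ.1 x * (Smooth.deriv v φ).1 x + φ.1 x * (Smooth.deriv v χ).1 x := by
  change fderiv ℝ (fun x => χ.1 x * φ.1 x) x v = _
  rw [fderiv_fun_mul (χ.differentiable x) (φ.differentiable x)]
  rfl

theorem Smooth.deriv_comp (A : E →L[ℝ] F) (φ : Smooth F) (v x : E) :
    (Smooth.deriv v (Smooth.comp A φ)).1 x = (Smooth.deriv (A v) φ).1 (A x) := by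
  change fderiv ℝ (φ.1 ∘ A) x v = _
  rw [fderiv_comp x (φ.differentiable (A x)) A.differentiableAt, A.fderiv]
  rfl

/-- The integrand `φ² + (∂ₓφ)² + (∂ᵧφ)²` of the squared `H¹` norm. -/
def sqDensity (φ : Smooth (ℝ × ℝ)) (z : ℝ × ℝ) : ℝ :=
  φ.1 z ^ 2 + ((Smooth.deriv (1, 0) φ).1 z ^ 2 + (Smooth.deriv (0, 1) φ).1 z ^ 2)

theorem continuous_sqDensity (φ : Smooth (ℝ × ℝ)) : Continuous (sqDensity φ) :=
  φ.continuous_sq.add ((Smooth.continuous_sq _).add (Smooth.continuous_sq _))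

theorem norm_sq_jet_eq (L a b : ℝ) (φ : Smooth (ℝ × ℝ)) :
    ‖jet (rect L a b) planeDirs φ‖ ^ 2 = ∫ z in rect L a b, sqDensity φ z := by
  have i (ψ : Smooth (ℝ × ℝ)) : Integrable (fun z => ψ.1 z ^ 2) (volume.restrict (rect L a b)) :=
    integrable_of_continuous _ ψ.continuous_sq
  have j : Integrable (fun z => (Smooth.deriv (1, 0) φ).1 z ^ 2 + (Smooth.deriv (0, 1) φ).1 z ^ 2)
    (volume.restrict (rect L a b)) := (i _).add (i _)
  rw [norm_sq_jet_rect, ← integral_add (i _) (i _), ← integral_add (i _) j]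
  rfl

theorem norm_jet_le {L a b : ℝ} {φ : Smooth (ℝ × ℝ)} {C r : ℝ} (hC : 0 ≤ C) (hr : 0 ≤ r)
    (h : ∫ z in rect L a b, sqDensity φ z ≤ C ^ 2 * r ^ 2) :
    ‖jet (rect L a b) planeDirs φ‖ ≤ C * r := by
  refine le_of_sq_le_sq ?_ (by positivity)
  rw [norm_sq_jet_eq, mul_pow]
  exact h

end Operations

/-! ### Multiplication by a smooth function -/

section Cutoff

variable {L a b : ℝ}

theorem exists_norm_jet_mul_le (L a b : ℝ) (χ : Smooth (ℝ × ℝ)) :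
    ∃ C, 0 ≤ C ∧ ∀ φ, ‖jet (rect L a b) planeDirs (Smooth.mul χ φ)‖ ≤
      C * ‖jet (rect L a b) planeDirs φ‖ := by
  have hK : IsCompact (Icc 0 L ×ˢ Icc a b) := isCompact_Icc.prod isCompact_Icc
  obtain ⟨B, hB⟩ := hK.exists_bound_of_continuousOn (continuous_sqDensity χ).continuousOn
  have hB' : ∀ z ∈ rect L a b, sqDensity χ z ≤ max B 0 := fun z hz =>
    ((le_abs_self _).trans (hB z ⟨Ioo_subset_Icc_self hz.1, Ioo_subset_Icc_self hz.2⟩)).trans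
      (le_max_left _ _)
  have hM : 0 ≤ max B 0 := le_max_right _ _
  set M := max B 0
  -- `M` bounds `χ² + |∇χ|²`. After the product rule, `φ²` is counted once from `χφ` and twice from
  -- each derivative, hence `5`; the derivatives of `φ` are counted only twice.
  refine ⟨√(5 * M), Real.sqrt_nonneg _, fun φ => norm_jet_le (Real.sqrt_nonneg _)
    (norm_nonneg _) ?_⟩
  rw [Real.sq_sqrt (by positivity), norm_sq_jet_eq, ← integral_const_mul]
  refine setIntegral_mono_on (integrable_of_continuous _ (continuous_sqDensity _))
    (integrable_of_continuous _ ((continuous_sqDensity _).const_mul _)) (measurableSet_rect L a b)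
    fun z hz => ?_
  have h := hB' z hz
  unfold sqDensity at h ⊢
  rw [Smooth.deriv_mul, Smooth.deriv_mul, Smooth.mul_apply]
  generalize χ.1 z = c at *
  generalize (Smooth.deriv (1, 0) χ).1 z = c1 at *
  generalize (Smooth.deriv (0, 1) χ).1 z = c2 at *
  generalize φ.1 z = f at *
  generalize (Smooth.deriv (1, 0) φ).1 z = f1 at *
  generalize (Smooth.deriv (0, 1) φ).1 z = f2 at *
  have e1 : (c * f1 + f * c1) ^ 2 ≤ 2 * (c ^ 2 * f1 ^ 2) + 2 * (f ^ 2 * c1 ^ 2) := by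
    nlinarith [sq_nonneg (c * f1 - f * c1)]
  have e2 : (c * f2 + f * c2) ^ 2 ≤ 2 * (c ^ 2 * f2 ^ 2) + 2 * (f ^ 2 * c2 ^ 2) := by
    nlinarith [sq_nonneg (c * f2 - f * c2)]
  have k (s t : ℝ) (hs : s ^ 2 ≤ M) : s ^ 2 * t ^ 2 ≤ M * t ^ 2 :=
    mul_le_mul_of_nonneg_right hs (sq_nonneg t)
  have hc : c ^ 2 ≤ M := by nlinarith [sq_nonneg c1, sq_nonneg c2]
  have hc1 : c1 ^ 2 ≤ M := by nlinarith [sq_nonneg c, sq_nonneg c2]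
  have hc2 : c2 ^ 2 ≤ M := by nlinarith [sq_nonneg c1, sq_nonneg c]
  have k0 := k c f hc
  have k1 := k c f1 hc
  have k2 := k c f2 hc
  have k3 := k c1 f hc1
  have k4 := k c2 f hc2
  have p1 := mul_nonneg hM (sq_nonneg f1)
  have p2 := mul_nonneg hM (sq_nonneg f2)
  rw [mul_pow]
  linarith [mul_comm (f ^ 2) (c1 ^ 2), mul_comm (f ^ 2) (c2 ^ 2)]

theorem exists_isTrace_mul (hL : 0 < L) (hab : a < b) (χ : Smooth (ℝ × ℝ)) :
    ∃ C, 0 ≤ C ∧ ∀ w g, IsTrace L a b w g → ∃ w' g', IsTrace L a b w' g' ∧ ‖w'‖ ≤ C * ‖w‖ ∧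
      ∀ᵐ z ∂(arcLength L a b), g' z = χ.1 z * g z := by
  obtain ⟨C, hC0, hC⟩ := exists_norm_jet_mul_le L a b χ
  refine ⟨C, hC0, fun w g h => ?_⟩
  obtain ⟨φ, h1, h2⟩ := isTrace_iff.1 h
  obtain ⟨w', g', h3, h4, h5⟩ := exists_isTrace_of_norm_le hL hab _ (Smooth.mul χ) hC h1
  obtain ⟨ns, k1, k2⟩ := exists_subseq_ae_tendsto h2 h5
  refine ⟨w', g', h3, h4, ?_⟩
  filter_upwards [k1, k2] with z hz hz'
  exact tendsto_nhds_unique hz' (hz.const_mul _)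

end Cutoff

/-! ### Reflection across the interface -/

section Reflection

/-- The reflection `(x, y) ↦ (x, -y)`. -/
def reflection : ℝ × ℝ →L[ℝ] ℝ × ℝ :=
  (ContinuousLinearMap.fst ℝ ℝ ℝ).prod (-ContinuousLinearMap.snd ℝ ℝ ℝ)

theorem reflection_apply (z : ℝ × ℝ) : reflection z = (z.1, -z.2) := rfl

variable {L a b : ℝ}

theorem measurePreserving_neg_Ioo (a b : ℝ) :
    MeasurePreserving (fun y : ℝ => -y) (volume.restrict (Ioo (-b) (-a)))
      (volume.restrict (Ioo a b)) := by
  have h := (Measure.measurePreserving_neg (volume : Measure ℝ)).restrict_preimage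
    (measurableSet_Ioo (a := a) (b := b))
  simpa using h

theorem measurePreserving_reflection_rect (L a b : ℝ) :
    MeasurePreserving reflection (volume.restrict (rect L (-b) (-a)))
      (volume.restrict (rect L a b)) := by
  rw [volume_restrict_rect, volume_restrict_rect]
  exact (MeasurePreserving.id _).prod (measurePreserving_neg_Ioo a b)

/-- The vertical sides are reversed and the two horizontal sides exchange places. -/
theorem measurePreserving_reflection_arcLength (L a b : ℝ) :
    MeasurePreserving reflection (arcLength L (-b) (-a)) (arcLength L a b) := by
  have hm : Measurable reflection := reflection.continuous.measurable
  refine ⟨hm, ?_⟩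
  have hv (c : ℝ) : ((volume.restrict (Ioo (-b) (-a))).map (fun y : ℝ => (c, y))).map reflection =
      (volume.restrict (Ioo a b)).map (fun y : ℝ => (c, y)) := by
    rw [← (measurePreserving_neg_Ioo a b).map_eq, Measure.map_map hm (by fun_prop),
      Measure.map_map (by fun_prop) (by fun_prop)]
    rfl
  have hh (c : ℝ) : ((volume.restrict (Ioo 0 L)).map (fun x : ℝ => (x, -c))).map reflection =
      (volume.restrict (Ioo 0 L)).map (fun x : ℝ => (x, c)) := by
    rw [Measure.map_map hm (by fun_prop)]
    congr 1
    funext x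
    simp [reflection_apply]
  unfold arcLength
  rw [Measure.map_add _ _ hm, Measure.map_add _ _ hm, Measure.map_add _ _ hm, hv, hv, hh, hh,
    add_comm (Measure.map (fun x : ℝ => (x, b)) _)]

theorem sqDensity_comp_reflection (φ : Smooth (ℝ × ℝ)) (z : ℝ × ℝ) :
    sqDensity (Smooth.comp reflection φ) z = sqDensity φ (reflection z) := by
  have h : (Smooth.deriv (reflection (0, 1)) φ).1 (reflection z) =
      -(Smooth.deriv (0, 1) φ).1 (reflection z) := by
    have e : reflection (0, 1) = -(0, 1) := by simp [reflection_apply]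
    rw [e, Smooth.deriv_apply, map_neg]
    rfl
  have e' : reflection (1, 0) = (1, 0) := by simp [reflection_apply]
  unfold sqDensity
  rw [Smooth.deriv_comp, Smooth.deriv_comp, Smooth.comp_apply, h, e', neg_sq]

/-- The chain rule only changes the sign of `∂ᵧ`. The factor `1` is the constant expected by
`exists_isTrace_of_norm_le`. -/
theorem norm_jet_comp_reflection (φ : Smooth (ℝ × ℝ)) :
    ‖jet (rect L (-b) (-a)) planeDirs (Smooth.comp reflection φ)‖ ≤
      1 * ‖jet (rect L a b) planeDirs φ‖ := by
  refine norm_jet_le zero_le_one (norm_nonneg _) (le_of_eq ?_)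
  rw [one_pow, one_mul, norm_sq_jet_eq, ← (measurePreserving_reflection_rect L a b).map_eq,
    integral_map reflection.continuous.aemeasurable
      (continuous_sqDensity φ).aestronglyMeasurable]
  simp only [sqDensity_comp_reflection]

theorem IsTrace.exists_reflection (hL : 0 < L) (hab : a < b) {w : Jet L a b}
    {g : Lp ℝ 2 (arcLength L a b)} (h : IsTrace L a b w g) {a' b' : ℝ} (ha : a' = -b)
    (hb : b' = -a) :
    ∃ w' g', IsTrace L a' b' w' g' ∧ ‖w'‖ ≤ ‖w‖ ∧
      ∀ᵐ z ∂(arcLength L a' b'), g' z = g (reflection z) := by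
  subst ha hb
  obtain ⟨φ, h1, h2⟩ := isTrace_iff.1 h
  obtain ⟨w', g', h3, h4, h5⟩ := exists_isTrace_of_norm_le (a := -b) (b := -a) hL
    (by linarith) _ (Smooth.comp reflection) norm_jet_comp_reflection h1
  obtain ⟨ns, k1, k2⟩ := exists_subseq_ae_tendsto h2 h5
  rw [one_mul] at h4
  refine ⟨w', g', h3, h4, ?_⟩
  filter_upwards [(measurePreserving_reflection_arcLength L a b).quasiMeasurePreserving.ae k1, k2]
    with z hz hz'
  exact tendsto_nhds_unique hz' hz

end Reflection

/-! ### Extension of functions on `γ` into a rectangle -/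

section Extension

/-- The function `y ↦ 1 - c y` on the plane. -/
def slope (c : ℝ) : Smooth (ℝ × ℝ) :=
  ⟨fun z => 1 - c * z.2, show ContDiff ℝ ∞ fun z : ℝ × ℝ => 1 - c * z.2 from
    contDiff_const.sub (contDiff_const.mul contDiff_snd)⟩

theorem deriv_slope (c : ℝ) (v z : ℝ × ℝ) : (Smooth.deriv v (slope c)).1 z = -(c * v.2) := by
  have h : HasFDerivAt (fun z : ℝ × ℝ => 1 - c * z.2)
      (-(c • ContinuousLinearMap.snd ℝ ℝ ℝ)) z :=
    ((ContinuousLinearMap.snd ℝ ℝ ℝ).hasFDerivAt.const_mul c).const_sub 1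
  change fderiv ℝ (fun z : ℝ × ℝ => 1 - c * z.2) z v = _
  rw [h.fderiv]
  simp

/-- The extension `(x, y) ↦ (1 - c y) φ(x)` of a function `φ` of one variable. -/
def slopeExtension (c : ℝ) : Smooth ℝ →ₗ[ℝ] Smooth (ℝ × ℝ) :=
  (Smooth.mul (slope c)).comp (Smooth.comp (ContinuousLinearMap.fst ℝ ℝ ℝ))

theorem slopeExtension_apply (c : ℝ) (φ : Smooth ℝ) (z : ℝ × ℝ) :
    (slopeExtension c φ).1 z = (1 - c * z.2) * φ.1 z.1 := rfl

theorem sqDensity_slopeExtension (c : ℝ) (φ : Smooth ℝ) (z : ℝ × ℝ) :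
    sqDensity (slopeExtension c φ) z = ((1 - c * z.2) * φ.1 z.1) ^ 2 +
      (((1 - c * z.2) * fderiv ℝ φ.1 z.1 1) ^ 2 + (c * φ.1 z.1) ^ 2) := by
  have h0 : (Smooth.deriv ((ContinuousLinearMap.fst ℝ ℝ ℝ) (0, 1)) φ).1 z.1 = 0 := by
    simp [Smooth.deriv_apply]
  have e (v : ℝ × ℝ) : (Smooth.deriv v (slopeExtension c φ)).1 z =
      (1 - c * z.2) * fderiv ℝ φ.1 z.1 v.1 + φ.1 z.1 * -(c * v.2) := by
    rw [← deriv_slope c v z]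
    refine (Smooth.deriv_mul _ _ _ _).trans ?_
    rw [Smooth.deriv_comp]
    rfl
  unfold sqDensity
  rw [e, e, slopeExtension_apply]
  simp only [map_zero]
  ring

/-- With slope `h⁻¹` the extension vanishes on the side `y = h`. On the rectangle the factor `1 -
y/h` lies in `[0, 1]` and its derivative is `-h⁻¹`; integrating over `y` adds the factor `h`. -/
theorem exists_norm_jet_slopeExtension_le (L : ℝ) {h : ℝ} (hh : 0 < h) :
    ∃ C, 0 ≤ C ∧ ∀ φ, ‖jet (rect L 0 h) planeDirs (slopeExtension h⁻¹ φ)‖ ≤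
      C * ‖jet (Ioo 0 L) (fun _ : Fin 1 => (1 : ℝ)) φ‖ := by
  refine ⟨√((1 + h⁻¹ ^ 2) * h), Real.sqrt_nonneg _, fun φ => norm_jet_le (Real.sqrt_nonneg _)
    (norm_nonneg _) ?_⟩
  have c1 : Continuous fun x => φ.1 x ^ 2 := φ.continuous.pow 2
  have c2 : Continuous fun x => fderiv ℝ φ.1 x 1 ^ 2 := (Smooth.deriv 1 φ).continuous.pow 2
  have e : ‖jet (Ioo 0 L) (fun _ : Fin 1 => (1 : ℝ)) φ‖ ^ 2 =
      ∫ x in Ioo 0 L, (φ.1 x ^ 2 + fderiv ℝ φ.1 x 1 ^ 2) := by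
    rw [norm_sq_jet, integral_add (integrable_of_continuous _ c1) (integrable_of_continuous _ c2)]
    simp
  have e2 : (1 + h⁻¹ ^ 2) * h * ∫ x in Ioo 0 L, (φ.1 x ^ 2 + fderiv ℝ φ.1 x 1 ^ 2) =
      ∫ z in rect L 0 h, (1 + h⁻¹ ^ 2) * (φ.1 z.1 ^ 2 + fderiv ℝ φ.1 z.1 1 ^ 2) := by
    have c3 : Continuous fun z : ℝ × ℝ =>
        (1 + h⁻¹ ^ 2) * (φ.1 z.1 ^ 2 + fderiv ℝ φ.1 z.1 1 ^ 2) :=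
      ((c1.add c2).comp continuous_fst).const_mul _
    rw [setIntegral_rect c3, ← integral_const_mul]
    simp only [setIntegral_const, Real.volume_real_Ioo_of_le hh.le, smul_eq_mul, sub_zero]
    congr 1
    funext x
    ring
  rw [Real.sq_sqrt (by positivity), e, e2]
  refine setIntegral_mono_on (integrable_of_continuous _ (continuous_sqDensity _))
    (integrable_of_continuous _ ?_) (measurableSet_rect L 0 h) fun z hz => ?_
  · exact ((c1.add c2).comp continuous_fst).const_mul _
  rw [sqDensity_slopeExtension]
  have h1 : h⁻¹ * z.2 ≤ 1 := by
    rw [inv_mul_le_iff₀ hh, mul_one]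
    exact hz.2.2.le
  have h2 : 0 ≤ h⁻¹ * z.2 := mul_nonneg (by positivity) hz.2.1.le
  have h3 : (1 - h⁻¹ * z.2) ^ 2 ≤ 1 := by
    rw [sq_le_one_iff_abs_le_one, abs_le]
    constructor <;> linarith
  have k1 := mul_le_mul_of_nonneg_right h3 (sq_nonneg (φ.1 z.1))
  have k2 := mul_le_mul_of_nonneg_right h3 (sq_nonneg (fderiv ℝ φ.1 z.1 1))
  have k3 : 0 ≤ h⁻¹ ^ 2 * fderiv ℝ φ.1 z.1 1 ^ 2 := by positivity
  rw [mul_pow, mul_pow, mul_pow]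
  linarith

end Extension

/-! ### The subdomains and their function spaces -/

section Geometry

variable {L l : ℝ}

theorem lo_lt_hi (hl : 0 < l) (i : Fin 2) : lo l i < hi l i := by
  fin_cases i
  · simpa [lo, hi] using hl
  · simpa [lo, hi] using hl

theorem lo_eq_or_hi_eq (l : ℝ) (i : Fin 2) : lo l i = 0 ∨ hi l i = 0 := by
  fin_cases i
  · exact Or.inl rfl
  · exact Or.inr rfl

theorem lo_nonpos (hl : 0 < l) (i : Fin 2) : lo l i ≤ 0 := by
  fin_cases i
  · exact le_rfl
  · simpa [lo] using (half_pos hl).le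

theorem hi_nonneg (hl : 0 < l) (i : Fin 2) : 0 ≤ hi l i := by
  fin_cases i
  · simpa [hi] using (half_pos hl).le
  · exact le_rfl

theorem neg_half_le_lo (hl : 0 < l) (i : Fin 2) : -(l / 2) ≤ lo l i := by
  fin_cases i
  · simpa [lo] using (half_pos hl).le
  · exact le_rfl

theorem hi_le_half (hl : 0 < l) (i : Fin 2) : hi l i ≤ l / 2 := by
  fin_cases i
  · exact le_rfl
  · simpa [hi] using (half_pos hl).le

theorem lo_eq_neg_hi {i j : Fin 2} (hij : i ≠ j) : lo l j = -hi l i := by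
  fin_cases i <;> fin_cases j <;> simp_all [lo, hi]

theorem mem_rect {a b : ℝ} {z : ℝ × ℝ} :
    z ∈ rect L a b ↔ (0 < z.1 ∧ z.1 < L) ∧ a < z.2 ∧ z.2 < b := Iff.rfl

theorem mem_interface {z : ℝ × ℝ} : z ∈ interface L ↔ (0 < z.1 ∧ z.1 < L) ∧ z.2 = 0 := Iff.rfl

theorem mem_frontier_rect (hL : 0 < L) {a b : ℝ} (hab : a < b) {z : ℝ × ℝ} :
    z ∈ frontier (rect L a b) ↔
      ((0 ≤ z.1 ∧ z.1 ≤ L) ∧ a ≤ z.2 ∧ z.2 ≤ b) ∧ z ∉ rect L a b := by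
  have ho : IsOpen (rect L a b) := isOpen_Ioo.prod isOpen_Ioo
  rw [ho.frontier_eq, Set.mem_sdiff, rect, closure_prod_eq, closure_Ioo hL.ne, closure_Ioo hab.ne]
  rfl

/-- A boundary point of `Ωᵢ` inside `Ω` must have height `0`, since otherwise it would be interior
to `Ωᵢ`. -/
theorem frontier_oxide_diff_subset (hL : 0 < L) (hl : 0 < l) (i : Fin 2) :
    frontier (oxide L l i) \ interface L ⊆ frontier (device L l) := by
  rintro z ⟨h1, h2⟩
  rw [oxide, mem_frontier_rect hL (lo_lt_hi hl i), mem_rect] at h1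
  rw [device, mem_frontier_rect hL (by linarith), mem_rect]
  rw [mem_interface] at h2
  obtain ⟨⟨h3, h4, h5⟩, h6⟩ := h1
  refine ⟨⟨h3, (neg_half_le_lo hl i).trans h4, h5.trans (hi_le_half hl i)⟩, ?_⟩
  rintro ⟨k1, k2, k3⟩
  have h7 : z.2 ≠ 0 := fun h => h2 ⟨k1, h⟩
  refine h6 ⟨k1, ?_⟩
  fin_cases i
  · exact ⟨lt_of_le_of_ne h4 (Ne.symm h7), k3⟩
  · exact ⟨k2, lt_of_le_of_ne h5 h7⟩

theorem notMem_frontier_device_of_mem_interface (hL : 0 < L) (hl : 0 < l) {z : ℝ × ℝ}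
    (hz : z ∈ interface L) : z ∉ frontier (device L l) := by
  rw [device, mem_frontier_rect hL (by linarith), mem_rect]
  rw [mem_interface] at hz
  refine fun h => h.2 ⟨hz.1, ?_, ?_⟩ <;> rw [hz.2] <;> linarith

/-- The part of the left side that is close to the interface belongs to `Γ_D`. -/
theorem exists_strip (hL : 0 < L) (hl : 0 < l) {ΓD : Set (ℝ × ℝ)}
    (hΓN : Disjoint (closure (frontier (device L l) \ ΓD)) (closure (interface L))) (i : Fin 2) :
    ∃ a' b', lo l i ≤ a' ∧ a' < b' ∧ b' ≤ hi l i ∧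
      ∀ y ∈ Ioo a' b', ((0 : ℝ), y) ∈ frontier (oxide L l i) ∩ ΓD := by
  -- The corner belongs to the closure of `γ`, so a ball around it avoids `Γ_N`; the left side
  -- inside that ball is then in `Γ_D`.
  have h0 : ((0 : ℝ), (0 : ℝ)) ∈ closure (interface L) := by
    rw [interface, closure_prod_eq, closure_Ioo hL.ne, closure_singleton]
    exact ⟨left_mem_Icc.2 hL.le, rfl⟩
  have h1 : ((0 : ℝ), (0 : ℝ)) ∉ closure (frontier (device L l) \ ΓD) :=
    fun h => hΓN.notMem_of_mem_left h h0
  obtain ⟨r, hr, hr'⟩ := Metric.isOpen_iff.1 isClosed_closure.isOpen_compl _ h1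
  have k0 := lo_lt_hi hl i
  have k1 := lo_nonpos hl i
  have k2 := hi_nonneg hl i
  refine ⟨max (lo l i) (-r), min (hi l i) r, le_max_left _ _, ?_, min_le_left _ _, ?_⟩
  · refine max_lt (lt_min k0 ?_) (lt_min ?_ ?_) <;> linarith
  · rintro y ⟨hy1, hy2⟩
    rw [max_lt_iff] at hy1
    rw [lt_min_iff] at hy2
    refine ⟨?_, ?_⟩
    · rw [oxide, mem_frontier_rect hL k0, mem_rect]
      exact ⟨⟨⟨le_rfl, hL.le⟩, hy1.1.le, hy2.1.le⟩, fun h => lt_irrefl _ h.1.1⟩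
    · by_contra hy
      have hd : ((0 : ℝ), y) ∈ frontier (device L l) := by
        rw [device, mem_frontier_rect hL (by linarith), mem_rect]
        exact ⟨⟨⟨le_rfl, hL.le⟩, ((neg_half_le_lo hl i).trans hy1.1.le),
          hy2.1.le.trans (hi_le_half hl i)⟩, fun h => lt_irrefl _ h.1.1⟩
      refine hr' (?_ : ((0 : ℝ), y) ∈ _) (subset_closure ⟨hd, hy⟩)
      rw [Metric.mem_ball, Prod.dist_eq]
      simp [abs_lt, hy1.2, hy2.2]

/-- A smooth Urysohn function for the disjoint closures of `Γ_N` and `γ`. -/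
theorem exists_cutoff {ΓD : Set (ℝ × ℝ)}
    (hΓN : Disjoint (closure (frontier (device L l) \ ΓD)) (closure (interface L))) :
    ∃ χ : Smooth (ℝ × ℝ), (∀ z ∈ frontier (device L l) \ ΓD, χ.1 z = 0) ∧
      ∀ z ∈ interface L, χ.1 z = 1 := by
  obtain ⟨χ, h0, h1, -⟩ := exists_contMDiffMap_zero_one_of_isClosed (n := ⊤)
    (modelWithCornersSelf ℝ (ℝ × ℝ)) isClosed_closure isClosed_closure hΓN
  exact ⟨⟨χ, χ.contMDiff.contDiff⟩, fun z hz => h0 (subset_closure hz),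
    fun z hz => h1 (subset_closure hz)⟩

end Geometry

/-! ### Moving functions between `Vⁱ`, `H¹_{0,∂Ωᵢ∖γ}(Ωᵢ)` and `V^γ` -/

section TraceSpaces

variable {L l : ℝ} {ΓD : Set (ℝ × ℝ)}

theorem H1zero_anti {a b : ℝ} {Γ Γ' : Set (ℝ × ℝ)} (h : Γ ⊆ Γ') :
    H1zero L a b Γ' ≤ H1zero L a b Γ := by
  intro w hw
  obtain ⟨g, hg, g0⟩ := mem_H1zero.1 hw
  exact mem_H1zero.2 ⟨g, hg, g0.mono fun z hz hz' => hz (h hz')⟩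

/-- `Γ_D` lies on `∂Ω` and therefore misses `γ`, which is interior to `Ω`. -/
theorem VInt_le_VOx (hL : 0 < L) (hl : 0 < l) (hΓD : ΓD ⊆ frontier (device L l)) (i : Fin 2) :
    VInt L l i ≤ VOx L l ΓD i :=
  H1zero_anti fun _ hz =>
    ⟨hz.1, fun h => notMem_frontier_device_of_mem_interface hL hl h (hΓD hz.2)⟩

theorem exists_isTraceOnInterface_of_mem_H1zero (i : Fin 2) {Γ : Set (ℝ × ℝ)}
    {w : Jet L (lo l i) (hi l i)} (hw : w ∈ H1zero L (lo l i) (hi l i) Γ) :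
    ∃ σ, IsTraceOnInterface L (lo l i) (hi l i) w σ := by
  obtain ⟨g, hg, -⟩ := mem_H1zero.1 hw
  exact hg.exists_isTraceOnInterface (lo_eq_or_hi_eq l i)

/-- Multiplication by the cutoff removes the values on `Γ_N` and leaves those on `γ` unchanged. -/
theorem exists_VInt_of_VOx (hL : 0 < L) (hl : 0 < l)
    (hΓN : Disjoint (closure (frontier (device L l) \ ΓD)) (closure (interface L))) (i : Fin 2) :
    ∃ C, 0 ≤ C ∧ ∀ v ∈ VOx L l ΓD i, ∀ σ, IsTraceOnInterface L (lo l i) (hi l i) v σ →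
      ∃ w ∈ VInt L l i, ‖w‖ ≤ C * ‖v‖ ∧ IsTraceOnInterface L (lo l i) (hi l i) w σ := by
  have hlh := lo_lt_hi hl i
  obtain ⟨χ, χ0, χ1⟩ := exists_cutoff hΓN
  obtain ⟨C, hC0, hC⟩ := exists_isTrace_mul hL hlh χ
  refine ⟨C, hC0, fun v hv σ hσ => ?_⟩
  obtain ⟨g, hg, gσ⟩ := hσ
  obtain ⟨k, hk, g0⟩ := mem_H1zero.1 hv
  obtain rfl := hg.unique hL hlh hk
  obtain ⟨w, g', hw, hn, hg'⟩ := hC v g hg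
  refine ⟨w, mem_H1zero.2 ⟨g', hw, ?_⟩, hn, g', hw, ?_⟩
  · filter_upwards [g0, hg'] with z h1 h2 h3
    rw [h2]
    -- On `Γ_D` the trace of `v` vanishes; on `Γ_N` the cutoff does.
    by_cases hz : z ∈ ΓD
    · rw [h1 ⟨h3.1, hz⟩, mul_zero]
    · rw [χ0 z ⟨frontier_oxide_diff_subset hL hl i h3, hz⟩, zero_mul]
  · filter_upwards [ae_interface (lo_eq_or_hi_eq l i) hg', gσ,
      ae_restrict_mem measurableSet_Ioo] with x h1 h2 h3
    rw [h1, ← h2, χ1 (x, 0) ⟨h3, rfl⟩, one_mul]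

/-- This makes the trace space and its norm, defined through `Ω₁`, available from either subdomain.
-/
theorem exists_VInt_reflection (hL : 0 < L) (hl : 0 < l) (i j : Fin 2)
    {w : Jet L (lo l i) (hi l i)} (hw : w ∈ VInt L l i) {σ : L2 (Ioo 0 L)}
    (hσ : IsTraceOnInterface L (lo l i) (hi l i) w σ) :
    ∃ w' ∈ VInt L l j, ‖w'‖ ≤ ‖w‖ ∧ IsTraceOnInterface L (lo l j) (hi l j) w' σ := by
  rcases eq_or_ne i j with rfl | hij
  · exact ⟨w, hw, le_rfl, hσ⟩
  have hlh := lo_lt_hi hl i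
  have e1 : lo l j = -hi l i := lo_eq_neg_hi hij
  have e2 : hi l j = -lo l i := by rw [lo_eq_neg_hi hij.symm, neg_neg]
  obtain ⟨g, hg, gσ⟩ := hσ
  obtain ⟨k, hk, g0⟩ := mem_H1zero.1 hw
  obtain rfl := hg.unique hL hlh hk
  obtain ⟨w', g', hw', hn, hg'⟩ := hg.exists_reflection hL hlh e1 e2
  have hm : MeasurePreserving reflection (arcLength L (lo l j) (hi l j))
      (arcLength L (lo l i) (hi l i)) := by
    rw [e1, e2]
    exact measurePreserving_reflection_arcLength _ _ _
  refine ⟨w', mem_H1zero.2 ⟨g', hw', ?_⟩, hn, g', hw', ?_⟩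
  · filter_upwards [hg', hm.quasiMeasurePreserving.ae g0] with z h1 h2 h3
    rw [h1]
    refine h2 ⟨?_, ?_⟩
    · have h4 := h3.1
      rw [oxide, mem_frontier_rect hL (lo_lt_hi hl j), mem_rect, e1, e2] at h4
      rw [oxide, mem_frontier_rect hL hlh, mem_rect, reflection_apply]
      obtain ⟨⟨k1, k2, k3⟩, k4⟩ := h4
      refine ⟨⟨k1, by linarith, by linarith⟩, fun h => k4 ⟨h.1, ?_, ?_⟩⟩
      · have := h.2.2
        linarith
      · have := h.2.1
        linarith
    · intro h
      rw [mem_interface, reflection_apply, neg_eq_zero] at h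
      exact h3.2 h
  · filter_upwards [ae_interface (lo_eq_or_hi_eq l j) hg', gσ] with x h1 h2
    rw [h1, ← h2, reflection_apply, neg_zero]

/-- The slope extensions of approximating test functions already vanish on `∂Ω₁∖γ`, and their values
on `γ` are the test functions themselves. -/
theorem exists_VInt_of_VGam (hL : 0 < L) (hl : 0 < l) :
    ∃ C, 0 ≤ C ∧ ∀ w ∈ VGam L, ∃ v ∈ VInt L l 0, ‖v‖ ≤ C * ‖w‖ ∧
      IsTraceOnInterface L (lo l 0) (hi l 0) v (w none) := by
  have hh : 0 < l / 2 := half_pos hl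
  obtain ⟨C, hC0, hC⟩ := exists_norm_jet_slopeExtension_le L hh
  refine ⟨C, hC0, fun w hw => ?_⟩
  obtain ⟨φ, hφ, h1⟩ := mem_VGam.1 hw
  obtain ⟨v, g, h2, h3, h4⟩ := exists_isTrace_of_norm_le hL hh _ _ hC h1
  have h5 := (tendsto_piLp_iff _ _).1 h1 none
  simp only [jet_none] at h5
  obtain ⟨ns, k1, k2⟩ := exists_subseq_ae_tendsto h5 h4
  refine ⟨v, mem_H1zero.2 ⟨g, h2, ?_⟩, h3, g, h2, ?_⟩
  · filter_upwards [ae_mem_sides L 0 (l / 2), k2] with z hz hz' hΓ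
    refine tendsto_nhds_unique hz' (tendsto_const_nhds.congr fun i => ?_)
    rw [slopeExtension_apply]
    have hs : z.1 ∉ Ioo 0 L → (φ (ns i)).1 z.1 = 0 := fun h =>
      image_eq_zero_of_notMem_tsupport fun h' => h ((hφ _).2 h')
    -- Left and right sides lie over the ends of the interval, where `φ` vanishes; a point of the
    -- bottom side off `γ` does too; on the top the slope factor is zero.
    rcases hz with hz | hz | hz | hz
    · rw [hs (fun h => h.1.ne' hz), mul_zero]
    · rw [hs (fun h => h.2.ne hz), mul_zero]
    · rw [hs (fun h => hΓ.2 ⟨h, hz⟩), mul_zero]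
    · rw [hz, inv_mul_cancel₀ hh.ne', sub_self, zero_mul]
  · filter_upwards [ae_interface (Or.inl rfl) k2, k1] with x hx hx'
    refine tendsto_nhds_unique hx (hx'.congr fun i => ?_)
    rw [slopeExtension_apply, mul_zero, sub_zero, one_mul]

end TraceSpaces

/-! ### Poincaré inequalities -/

section Poincare

variable {L l : ℝ} {ΓD : Set (ℝ × ℝ)}

theorem compactlyCarried_map {E F : Type*} [TopologicalSpace E] [MeasurableSpace E] [BorelSpace E]
    [TopologicalSpace F] [T2Space F] [MeasurableSpace F] [BorelSpace F] {m : Measure E}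
    [CompactlyCarried m] {f : E → F} (hf : Continuous f) : CompactlyCarried (m.map f) where
  toIsFiniteMeasure := inferInstance
  exists_isCompact := by
    obtain ⟨K, hK, h⟩ := CompactlyCarried.exists_isCompact (m := m)
    refine ⟨f '' K, hK.image hf, ?_⟩
    refine (ae_map_iff hf.measurable.aemeasurable (hK.image hf).measurableSet
      (p := fun x => x ∈ f '' K)).2 ?_
    exact h.mono fun x hx => mem_image_of_mem f hx

theorem map_left_le_arcLength {a b a' b' : ℝ} (ha : a ≤ a') (hb : b' ≤ b) :
    (volume.restrict (Ioo a' b')).map (fun y : ℝ => ((0 : ℝ), y)) ≤ arcLength L a b := by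
  unfold arcLength
  refine Measure.le_add_right (Measure.le_add_left ?_)
  exact Measure.map_mono (Measure.restrict_mono (Ioo_subset_Ioo ha hb) le_rfl) (by fun_prop)

/-- Approximants need not vanish on `Γ_D`, but their traces converge in `L²`, in particular for the
smaller measure on this segment, where the limit is zero. -/
theorem tendsto_integral_left_zero {a b a' b' : ℝ} (ha : a ≤ a') (hb : b' ≤ b)
    {φ : ℕ → Smooth (ℝ × ℝ)} {g : Lp ℝ 2 (arcLength L a b)}
    (h : Tendsto (fun n => smoothLp (arcLength L a b) (φ n)) atTop (𝓝 g)) {Γ : Set (ℝ × ℝ)}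
    (hΓ : ∀ y ∈ Ioo a' b', ((0 : ℝ), y) ∈ Γ) (g0 : ∀ᵐ z ∂(arcLength L a b), z ∈ Γ → g z = 0) :
    Tendsto (fun n => ∫ y in Ioo a' b', (φ n).1 (0, y) ^ 2) atTop (𝓝 0) := by
  have hc : Continuous fun y : ℝ => ((0 : ℝ), y) := by fun_prop
  set m := (volume.restrict (Ioo a' b')).map (fun y : ℝ => ((0 : ℝ), y)) with hm
  have hle : m ≤ arcLength L a b := map_left_le_arcLength ha hb
  have : CompactlyCarried m := compactlyCarried_map hc
  have hz : ∀ᵐ z ∂m, g z = 0 := by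
    have hS : MeasurableSet ({0} ×ˢ Ioo a' b' : Set (ℝ × ℝ)) :=
      (measurableSet_singleton _).prod measurableSet_Ioo
    have h1 : ∀ᵐ z ∂m, z ∈ ({0} ×ˢ Ioo a' b' : Set (ℝ × ℝ)) := by
      refine (ae_map_iff hc.measurable.aemeasurable
        (p := fun z => z ∈ ({0} ×ˢ Ioo a' b' : Set (ℝ × ℝ))) hS).2 ?_
      exact (ae_restrict_mem measurableSet_Ioo).mono fun y hy => ⟨rfl, hy⟩
    filter_upwards [h1, Measure.absolutelyContinuous_of_le hle g0] with z hz1 hz2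
    obtain ⟨x, y⟩ := z
    obtain ⟨rfl, hy⟩ := hz1
    exact hz2 (hΓ y hy)
  have h2 : TendstoL2 m (fun n => (φ n).1) 0 := by
    have h3 := (tendstoL2_iff _ φ g).2 h
    refine tendsto_of_tendsto_of_tendsto_of_le_of_le tendsto_const_nhds h3
      (fun _ => zero_le) (fun n => ?_)
    refine le_trans (le_of_eq ?_) (eLpNorm_mono_measure _ hle)
    refine eLpNorm_congr_ae ?_
    filter_upwards [hz, Lp.coeFn_zero ℝ 2 m] with z h4 h5
    rw [h4, h5]
    rfl
  have h4 := ((tendstoL2_iff m φ 0).1 h2).norm.pow 2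
  rw [norm_zero, zero_pow two_ne_zero] at h4
  refine h4.congr fun n => ?_
  rw [norm_sq_smoothLp, hm, integral_map hc.measurable.aemeasurable
    (φ n).continuous_sq.aestronglyMeasurable]

/-- The Poincaré inequality on `Vⁱ`. -/
theorem exists_poincare_VOx (hL : 0 < L) (hl : 0 < l)
    (hΓN : Disjoint (closure (frontier (device L l) \ ΓD)) (closure (interface L))) (i : Fin 2) :
    ∃ C, 0 ≤ C ∧ ∀ v ∈ VOx L l ΓD i, ‖v none‖ ^ 2 ≤ C * ∑ j, ‖v (some j)‖ ^ 2 := by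
  have hlh := lo_lt_hi hl i
  obtain ⟨a', b', ha, hab, hb, hs⟩ := exists_strip hL hl hΓN i
  set a := lo l i
  set b := hi l i
  have hba : 0 < b - a := sub_pos.2 hlh
  have hba' : 0 < b' - a' := sub_pos.2 hab
  -- `D` is the cost of passing from the strip to the rectangle; `C` collects the coefficients of
  -- `‖∂ₓv‖²` (horizontal step in the strip) and `‖∂ᵧv‖²` (vertical step).
  set D := (b - a) / (b' - a') * 2 with hD
  have hD0 : 0 ≤ D := by positivity
  set C := D * (2 * L * L) + 2 * (b - a) ^ 2 with hC
  refine ⟨C, by positivity, fun v hv => ?_⟩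
  obtain ⟨g, hg, g0⟩ := mem_H1zero.1 hv
  obtain ⟨φ, h1, h2⟩ := isTrace_iff.1 hg
  have h3 := tendsto_integral_left_zero ha hb h2 hs g0
  have h4 := (tendsto_piLp_iff _ _).1 h1
  -- Valid for every smooth function because the boundary term is kept; it tends to zero along the
  -- approximating sequence.
  have key (ψ : Smooth (ℝ × ℝ)) : ‖jet (rect L a b) planeDirs ψ none‖ ^ 2 ≤
      D * (2 * L) * (∫ y in Ioo a' b', ψ.1 (0, y) ^ 2) +
        C * ∑ j, ‖jet (rect L a b) planeDirs ψ (some j)‖ ^ 2 := by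
    have e : ∑ j, ‖jet (rect L a b) planeDirs ψ (some j)‖ ^ 2 =
        (∫ z in rect L a b, (Smooth.deriv (1, 0) ψ).1 z ^ 2) +
          ∫ z in rect L a b, (Smooth.deriv (0, 1) ψ).1 z ^ 2 := by
      rw [Fin.sum_univ_two, jet_some, jet_some, norm_sq_smoothLp, norm_sq_smoothLp]
      rfl
    rw [e, jet_none, norm_sq_smoothLp]
    have k1 := integral_rect_le_of_strip (L := L) ψ ha hab hb
    have k2 := integral_rect_le_of_left (a := a') (b := b') ψ hL
    have k3 : ∫ z in rect L a' b', (Smooth.deriv (1, 0) ψ).1 z ^ 2 ≤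
        ∫ z in rect L a b, (Smooth.deriv (1, 0) ψ).1 z ^ 2 :=
      setIntegral_mono_set (integrable_of_continuous _ (Smooth.continuous_sq _))
        (ae_of_all _ fun _ => sq_nonneg _)
        (LE.le.eventuallyLE (prod_mono subset_rfl (Ioo_subset_Ioo ha hb)))
    have p2 : 0 ≤ ∫ z in rect L a b, (Smooth.deriv (0, 1) ψ).1 z ^ 2 :=
      integral_nonneg fun _ => sq_nonneg _
    have p1 : 0 ≤ ∫ z in rect L a b, (Smooth.deriv (1, 0) ψ).1 z ^ 2 :=
      integral_nonneg fun _ => sq_nonneg _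
    set X := ∫ z in rect L a b, ψ.1 z ^ 2
    set Y := ∫ z in rect L a' b', ψ.1 z ^ 2
    set B := ∫ z in rect L a b, (Smooth.deriv (1, 0) ψ).1 z ^ 2
    set B' := ∫ z in rect L a' b', (Smooth.deriv (1, 0) ψ).1 z ^ 2
    set G := ∫ z in rect L a b, (Smooth.deriv (0, 1) ψ).1 z ^ 2
    set T := ∫ y in Ioo a' b', ψ.1 (0, y) ^ 2
    rw [← le_div_iff₀' hba'] at k1
    have e1 : (b - a) * (2 * Y + 2 * (b - a) * (b' - a') * G) / (b' - a') =
        D * Y + 2 * (b - a) ^ 2 * G := by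
      rw [hD]
      field_simp
    rw [e1] at k1
    have k4 : D * Y ≤ D * (2 * L * T + 2 * L * L * B) := by
      refine mul_le_mul_of_nonneg_left (k2.trans ?_) hD0
      gcongr
    have k5 : 0 ≤ D * (2 * L * L) * G := by positivity
    have k6 : 0 ≤ 2 * (b - a) ^ 2 * B := by positivity
    rw [hC]
    linarith
  have h5 : Tendsto (fun n => D * (2 * L) * (∫ y in Ioo a' b', (φ n).1 (0, y) ^ 2) +
      C * ∑ j, ‖jet (rect L a b) planeDirs (φ n) (some j)‖ ^ 2) atTop
      (𝓝 (D * (2 * L) * 0 + C * ∑ j, ‖v (some j)‖ ^ 2)) :=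
    (h3.const_mul _).add ((tendsto_finsetSum _ fun j _ => (h4 (some j)).norm.pow 2).const_mul _)
  rw [mul_zero, zero_add] at h5
  exact le_of_tendsto_of_tendsto' ((h4 none).norm.pow 2) h5 fun n => key _

/-- The Poincaré inequality on `V^γ`. -/
theorem poincare_VGam (hL : 0 < L) {w : PiLp 2 (fun _ : Option (Fin 1) => L2 (Ioo (0 : ℝ) L))}
    (hw : w ∈ VGam L) : ‖w none‖ ^ 2 ≤ 2 * L ^ 2 * ‖w (some 0)‖ ^ 2 := by
  obtain ⟨φ, hφ, h1⟩ := mem_VGam.1 hw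
  have h4 := (tendsto_piLp_iff _ _).1 h1
  refine le_of_tendsto_of_tendsto' ((h4 none).norm.pow 2)
    (((h4 (some 0)).norm.pow 2).const_mul _) fun n => ?_
  rw [jet_none, jet_some, norm_sq_smoothLp, norm_sq_smoothLp]
  -- The support avoids the end point, so the reference value in `sq_le_of_hasDerivAt` is zero.
  have h0 : (φ n).1 0 = 0 :=
    image_eq_zero_of_notMem_tsupport fun h => lt_irrefl _ ((hφ n).2 h).1
  have hc : Continuous fun x => (φ n).1 x ^ 2 := (φ n).continuous.pow 2
  have h := setIntegral_mono_on (μ := volume) (s := Ioo 0 L) (integrable_of_continuous _ hc)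
    (integrable_of_continuous _ continuous_const) measurableSet_Ioo fun x hx =>
      sq_le_of_hasDerivAt (f' := (Smooth.deriv 1 (φ n)).1)
        (fun x => ((φ n).differentiable x).hasFDerivAt.hasDerivAt)
        (Smooth.deriv 1 (φ n)).continuous hL
        (Ioo_subset_Icc_self hx) (left_mem_Icc.2 hL.le)
  simp only [setIntegral_const, Real.volume_real_Ioo_of_le hL.le, smul_eq_mul, sub_zero, h0] at h
  refine h.trans (le_of_eq ?_)
  ring

end Poincare

/-! ### The trace space and its dual -/

section Half

variable {L l : ℝ}

theorem exists_VInt_of_Hhalf (hL : 0 < L) (hl : 0 < l) (i : Fin 2) (σ : Hhalf L l) :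
    ∃ w ∈ VInt L l i, IsTraceOnInterface L (lo l i) (hi l i) w σ.1 := by
  obtain ⟨w, hw, hσ⟩ := σ.2
  obtain ⟨w', hw', -, hσ'⟩ := exists_VInt_reflection hL hl 0 i hw hσ
  exact ⟨w', hw', hσ'⟩

theorem mem_Hhalf_of_VInt (hL : 0 < L) (hl : 0 < l) {i : Fin 2} {w : Jet L (lo l i) (hi l i)}
    (hw : w ∈ VInt L l i) {σ : L2 (Ioo 0 L)}
    (hσ : IsTraceOnInterface L (lo l i) (hi l i) w σ) : σ ∈ Hhalf L l := by
  obtain ⟨w', hw', -, hσ'⟩ := exists_VInt_reflection hL hl i 0 hw hσ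
  exact ⟨w', hw', hσ'⟩

theorem halfNorm_le (hL : 0 < L) (hl : 0 < l) {i : Fin 2} {w : Jet L (lo l i) (hi l i)}
    (hw : w ∈ VInt L l i) {σ : Hhalf L l}
    (hσ : IsTraceOnInterface L (lo l i) (hi l i) w σ.1) : halfNorm L l σ ≤ ‖w‖ := by
  obtain ⟨w', hw', hn, hσ'⟩ := exists_VInt_reflection hL hl i 0 hw hσ
  refine le_trans (csInf_le ⟨0, ?_⟩ ⟨w', hw', hσ', rfl⟩) hn
  rintro r ⟨z, -, -, rfl⟩
  exact norm_nonneg z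

theorem halfNorm_nonneg (σ : Hhalf L l) : 0 ≤ halfNorm L l σ := by
  refine Real.sInf_nonneg ?_
  rintro r ⟨z, -, -, rfl⟩
  exact norm_nonneg z

/-- Passage to the infimum, which runs over `Ω₁`; a competitor there is reflected into `Ωᵢ` without
increasing its norm. -/
theorem le_mul_halfNorm (hL : 0 < L) (hl : 0 < l) (i : Fin 2) {σ : Hhalf L l} {c C : ℝ}
    (hC : 0 ≤ C) (h : ∀ w ∈ VInt L l i, IsTraceOnInterface L (lo l i) (hi l i) w σ.1 →
      c ≤ C * ‖w‖) : c ≤ C * halfNorm L l σ := by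
  -- For `C = 0` division is impossible, but a single extension of `σ` already gives `c ≤ 0`.
  rcases hC.eq_or_lt with rfl | hC
  · obtain ⟨w, hw, hσ⟩ := exists_VInt_of_Hhalf hL hl i σ
    simpa using h w hw hσ
  · rw [← div_le_iff₀' hC]
    refine le_csInf ?_ ?_
    · obtain ⟨w, hw, hσ⟩ := exists_VInt_of_Hhalf hL hl 0 σ
      exact ⟨_, w, hw, hσ, rfl⟩
    · rintro r ⟨w, hw, hσ, rfl⟩
      obtain ⟨w', hw', hn, hσ'⟩ := exists_VInt_reflection hL hl 0 i hw hσ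
      rw [div_le_iff₀' hC]
      exact (h w' hw' hσ').trans (mul_le_mul_of_nonneg_left hn hC.le)

theorem pairing_coe (μ : HhalfDual L l) (σ : Hhalf L l) : pairing L l μ σ.1 = μ.1 σ := by
  unfold pairing
  rw [dif_pos σ.2]

theorem pairing_traceOnInterface (hL : 0 < L) (hl : 0 < l) (μ : HhalfDual L l) {i : Fin 2}
    {w : Jet L (lo l i) (hi l i)} {σ : Hhalf L l}
    (hσ : IsTraceOnInterface L (lo l i) (hi l i) w σ.1) :
    pairing L l μ (traceOnInterface L (lo l i) (hi l i) w) = μ.1 σ := by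
  rw [traceOnInterface_eq hL (lo_lt_hi hl i) hσ, pairing_coe]

theorem exists_Hhalf_of_VInt (hL : 0 < L) (hl : 0 < l) {i : Fin 2}
    {w : Jet L (lo l i) (hi l i)} (hw : w ∈ VInt L l i) :
    ∃ σ : Hhalf L l, IsTraceOnInterface L (lo l i) (hi l i) w σ.1 := by
  obtain ⟨σ, hσ⟩ := exists_isTraceOnInterface_of_mem_H1zero i hw
  exact ⟨⟨σ, mem_Hhalf_of_VInt hL hl hw hσ⟩, hσ⟩

theorem bddAbove_dualQuotient (hL : 0 < L) (hl : 0 < l) (i : Fin 2) (μ : HhalfDual L l) :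
    BddAbove (range (dualQuotient L l i μ)) := by
  obtain ⟨C, hC⟩ := μ.2
  -- The continuity constant of a functional is not assumed nonnegative.
  refine ⟨max C 0, ?_⟩
  rintro _ ⟨v, rfl⟩
  obtain ⟨σ, hσ⟩ := exists_Hhalf_of_VInt hL hl v.2
  unfold dualQuotient
  rw [pairing_traceOnInterface hL hl μ hσ]
  refine div_le_of_le_mul₀ (norm_nonneg _) (le_max_right _ _) ?_
  calc μ.1 σ ≤ C * halfNorm L l σ := (le_abs_self _).trans (hC σ)
    _ ≤ max C 0 * halfNorm L l σ :=
      mul_le_mul_of_nonneg_right (le_max_left _ _) (halfNorm_nonneg σ)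
    _ ≤ max C 0 * ‖v‖ :=
      mul_le_mul_of_nonneg_left (halfNorm_le hL hl v.2 hσ) (le_max_right _ _)

theorem dualNorm_nonneg (hL : 0 < L) (hl : 0 < l) (i : Fin 2) (μ : HhalfDual L l) :
    0 ≤ dualNorm L l i μ := by
  -- The quotient at `v = 0` is `0 / 0 = 0`, so the supremum is nonnegative.
  have h := le_ciSup (bddAbove_dualQuotient hL hl i μ) 0
  unfold dualQuotient at h
  rwa [norm_zero, div_zero] at h

theorem apply_le_dualNorm_mul_norm (hL : 0 < L) (hl : 0 < l) {i : Fin 2} (μ : HhalfDual L l)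
    {w : Jet L (lo l i) (hi l i)} (hw : w ∈ VInt L l i) {σ : Hhalf L l}
    (hσ : IsTraceOnInterface L (lo l i) (hi l i) w σ.1) : μ.1 σ ≤ dualNorm L l i μ * ‖w‖ := by
  rcases eq_or_ne w 0 with rfl | hne
  · have h0 : σ = 0 := Subtype.ext (hσ.unique hL (lo_lt_hi hl i)
      (IsTraceOnInterface.zero (lo_eq_or_hi_eq l i)))
    rw [h0, map_zero, norm_zero, mul_zero]
  · rw [← div_le_iff₀ (norm_pos_iff.2 hne)]
    have h := le_ciSup (bddAbove_dualQuotient hL hl i μ) ⟨w, hw⟩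
    unfold dualQuotient at h
    rwa [pairing_traceOnInterface hL hl μ hσ] at h

/-- The one-sided supremum controls the absolute value because `-w` extends `-σ`; the infimum over
extensions then gives `halfNorm`. -/
theorem abs_apply_le (hL : 0 < L) (hl : 0 < l) (i : Fin 2) (μ : HhalfDual L l) (σ : Hhalf L l) :
    |μ.1 σ| ≤ dualNorm L l i μ * halfNorm L l σ := by
  refine le_mul_halfNorm hL hl i (dualNorm_nonneg hL hl i μ) fun w hw hσ => abs_le'.2 ⟨?_, ?_⟩
  · exact apply_le_dualNorm_mul_norm hL hl μ hw hσ
  · have h := hσ.smul (lo_eq_or_hi_eq l i) (-1)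
    have h2 := apply_le_dualNorm_mul_norm hL hl μ (σ := (-1 : ℝ) • σ)
      ((VInt L l i).smul_mem (-1) hw) h
    simpa using h2

theorem eq_zero_of_dualNorm_eq_zero (hL : 0 < L) (hl : 0 < l) {i : Fin 2} {μ : HhalfDual L l}
    (h : dualNorm L l i μ = 0) : μ = 0 := by
  refine Subtype.ext (LinearMap.ext fun σ => ?_)
  have h1 := abs_apply_le hL hl i μ σ
  rw [h, zero_mul] at h1
  simpa using h1

theorem normLam_sq (lam : Lam L l) : normLam L l lam ^ 2 = ∑ i, dualNorm L l i (lam i) ^ 2 :=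
  Real.sq_sqrt (Finset.sum_nonneg fun _ _ => sq_nonneg _)

theorem normLam_nonneg (lam : Lam L l) : 0 ≤ normLam L l lam := Real.sqrt_nonneg _

theorem dualNorm_le_normLam (lam : Lam L l) (i : Fin 2) :
    dualNorm L l i (lam i) ≤ normLam L l lam := by
  refine Real.le_sqrt_of_sq_le ?_
  exact Finset.single_le_sum (f := fun i => dualNorm L l i (lam i) ^ 2)
    (fun _ _ => sq_nonneg _) (Finset.mem_univ i)

theorem normLam_pos (hL : 0 < L) (hl : 0 < l) {lam : Lam L l} (h : lam ≠ 0) :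
    0 < normLam L l lam := by
  refine (normLam_nonneg lam).lt_of_ne fun h0 => h (funext fun i => ?_)
  refine eq_zero_of_dualNorm_eq_zero hL hl (i := i) (le_antisymm ?_ (dualNorm_nonneg hL hl i _))
  exact (dualNorm_le_normLam lam i).trans h0.symm.le

end Half

/-! ### The forms -/

/-- The assumptions on the geometry. -/
structure Admissible (L l : ℝ) (ΓD : Set (ℝ × ℝ)) : Prop where
  hL : 0 < L
  hl : 0 < l
  subset : ΓD ⊆ frontier (device L l)
  disjoint : Disjoint (closure (frontier (device L l) \ ΓD)) (closure (interface L))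

section Jump

variable {L l : ℝ} {ΓD : Set (ℝ × ℝ)}

theorem Admissible.isTraceOnInterface (A : Admissible L l ΓD) {i : Fin 2}
    {v : Jet L (lo l i) (hi l i)} (hv : v ∈ VOx L l ΓD i) :
    IsTraceOnInterface L (lo l i) (hi l i) v (traceOnInterface L (lo l i) (hi l i) v) := by
  obtain ⟨σ, hσ⟩ := exists_isTraceOnInterface_of_mem_H1zero i hv
  rwa [traceOnInterface_eq A.hL (lo_lt_hi A.hl i) hσ]

theorem Admissible.existsUnique_trace (A : Admissible L l ΓD) {i : Fin 2}
    {v : Jet L (lo l i) (hi l i)} (hv : v ∈ VOx L l ΓD i) :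
    ∃! σ, IsTraceOnInterface L (lo l i) (hi l i) v σ :=
  ⟨_, A.isTraceOnInterface hv, fun _ h => h.unique A.hL (lo_lt_hi A.hl i)
    (A.isTraceOnInterface hv)⟩

theorem Admissible.traceOnInterface_mem (A : Admissible L l ΓD) {i : Fin 2}
    {v : Jet L (lo l i) (hi l i)} (hv : v ∈ VOx L l ΓD i) :
    traceOnInterface L (lo l i) (hi l i) v ∈ Hhalf L l := by
  obtain ⟨C, -, hC⟩ := exists_VInt_of_VOx A.hL A.hl A.disjoint i
  obtain ⟨w, hw, -, hσ⟩ := hC v hv _ (A.isTraceOnInterface hv)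
  exact mem_Hhalf_of_VInt A.hL A.hl hw hσ

theorem VGam_mem_Hhalf (hL : 0 < L) (hl : 0 < l)
    {w : PiLp 2 (fun _ : Option (Fin 1) => L2 (Ioo (0 : ℝ) L))} (hw : w ∈ VGam L) :
    w none ∈ Hhalf L l := by
  obtain ⟨C, -, hC⟩ := exists_VInt_of_VGam hL hl
  obtain ⟨v, hv, -, hσ⟩ := hC w hw
  exact ⟨v, hv, hσ⟩

/-- The trace as a linear map `Vⁱ → H^{1/2}₀₀(γ)`. -/
def Admissible.traceOx (A : Admissible L l ΓD) (i : Fin 2) : VOx L l ΓD i →ₗ[ℝ] Hhalf L l where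
  toFun v := ⟨traceOnInterface L (lo l i) (hi l i) v.1, A.traceOnInterface_mem v.2⟩
  map_add' v w := Subtype.ext (traceOnInterface_eq A.hL (lo_lt_hi A.hl i)
    ((A.isTraceOnInterface v.2).add (lo_eq_or_hi_eq l i) (A.isTraceOnInterface w.2)))
  map_smul' c v := Subtype.ext (traceOnInterface_eq A.hL (lo_lt_hi A.hl i)
    ((A.isTraceOnInterface v.2).smul (lo_eq_or_hi_eq l i) c))

/-- The inclusion `V^γ ⊂ H^{1/2}₀₀(γ)`. -/
def Admissible.inclGam (A : Admissible L l ΓD) : VGam L →ₗ[ℝ] Hhalf L l where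
  toFun w := ⟨w.1 none, VGam_mem_Hhalf A.hL A.hl w.2⟩
  map_add' _ _ := rfl
  map_smul' _ _ := rfl

/-- The jump `uᵢ|_γ - u_γ`. -/
def Admissible.jump (A : Admissible L l ΓD) (i : Fin 2) : V L l ΓD →ₗ[ℝ] Hhalf L l :=
  A.traceOx i ∘ₗ LinearMap.proj i ∘ₗ LinearMap.fst ℝ _ _ - A.inclGam ∘ₗ LinearMap.snd ℝ _ _

theorem Admissible.jump_apply (A : Admissible L l ΓD) (i : Fin 2) (u : V L l ΓD) :
    A.jump i u = A.traceOx i (u.1 i) - A.inclGam u.2 := rfl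

/-- Jumps lie in `H^{1/2}₀₀(γ)`, so the default value of `pairing` never occurs and `𝐛` is visibly
bilinear. -/
theorem Admissible.formB_eq (A : Admissible L l ΓD) (mu : Lam L l) (u : V L l ΓD) :
    formB L l ΓD mu u = ∑ i, (mu i).1 (A.jump i u) :=
  Finset.sum_congr rfl fun i _ => pairing_coe (mu i) (A.jump i u)

/-- The element of `𝐕` whose only nonzero component is `v ∈ Vⁱ`. -/
def slot (i : Fin 2) : VOx L l ΓD i →ₗ[ℝ] V L l ΓD :=
  LinearMap.inl ℝ _ _ ∘ₗ LinearMap.single ℝ (fun i : Fin 2 => VOx L l ΓD i) i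

theorem Admissible.jump_slot_self (A : Admissible L l ΓD) (i : Fin 2) (v : VOx L l ΓD i) :
    A.jump i (slot i v) = A.traceOx i v := by
  simp [Admissible.jump_apply, slot]

theorem Admissible.jump_slot_of_ne (A : Admissible L l ΓD) {i j : Fin 2} (h : j ≠ i)
    (v : VOx L l ΓD i) : A.jump j (slot i v) = 0 := by
  simp [Admissible.jump_apply, slot, Pi.single_eq_of_ne h]

theorem Admissible.formB_slot (A : Admissible L l ΓD) (mu : Lam L l) (i : Fin 2)
    (v : VOx L l ΓD i) : formB L l ΓD mu (slot i v) = (mu i).1 (A.traceOx i v) := by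
  rw [A.formB_eq, Finset.sum_eq_single i, A.jump_slot_self]
  · intro j _ hj
    rw [A.jump_slot_of_ne hj, map_zero]
  · exact fun h => absurd (Finset.mem_univ i) h

theorem Admissible.exists_traceOx_le (A : Admissible L l ΓD) (i : Fin 2) :
    ∃ C, 0 ≤ C ∧ ∀ v, halfNorm L l (A.traceOx i v) ≤ C * ‖v‖ := by
  obtain ⟨C, hC0, hC⟩ := exists_VInt_of_VOx A.hL A.hl A.disjoint i
  refine ⟨C, hC0, fun v => ?_⟩
  obtain ⟨w, hw, hn, hσ⟩ := hC v.1 v.2 _ (A.isTraceOnInterface v.2)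
  exact (halfNorm_le A.hL A.hl hw (σ := A.traceOx i v) hσ).trans hn

theorem Admissible.exists_inclGam_le (A : Admissible L l ΓD) :
    ∃ C, 0 ≤ C ∧ ∀ w, halfNorm L l (A.inclGam w) ≤ C * ‖w‖ := by
  obtain ⟨C, hC0, hC⟩ := exists_VInt_of_VGam A.hL A.hl
  refine ⟨C, hC0, fun w => ?_⟩
  obtain ⟨v, hv, hn, hσ⟩ := hC w.1 w.2
  exact (halfNorm_le A.hL A.hl hv (σ := A.inclGam w) hσ).trans hn

end Jump

/-! ### Continuity and inf-sup condition of `𝐛` -/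

section Norms

variable {L l : ℝ} {ΓD : Set (ℝ × ℝ)}

theorem normV_nonneg (u : V L l ΓD) : 0 ≤ normV L l ΓD u := Real.sqrt_nonneg _

theorem normV_sq (u : V L l ΓD) : normV L l ΓD u ^ 2 = (∑ i, ‖u.1 i‖ ^ 2) + ‖u.2‖ ^ 2 :=
  Real.sq_sqrt (by positivity)

theorem norm_fst_le_normV (u : V L l ΓD) (i : Fin 2) : ‖u.1 i‖ ≤ normV L l ΓD u := by
  refine Real.le_sqrt_of_sq_le ?_
  refine le_trans ?_ (le_add_of_nonneg_right (sq_nonneg _))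
  exact Finset.single_le_sum (f := fun i => ‖u.1 i‖ ^ 2)
    (fun _ _ => sq_nonneg _) (Finset.mem_univ i)

theorem norm_snd_le_normV (u : V L l ΓD) : ‖u.2‖ ≤ normV L l ΓD u :=
  Real.le_sqrt_of_sq_le (le_add_of_nonneg_left (Finset.sum_nonneg fun _ _ => sq_nonneg _))

theorem eq_zero_of_normV_eq_zero {u : V L l ΓD} (h : normV L l ΓD u = 0) : u = 0 := by
  refine Prod.ext (funext fun i => ?_) ?_
  · exact norm_le_zero_iff.1 ((norm_fst_le_normV u i).trans h.le)
  · exact norm_le_zero_iff.1 ((norm_snd_le_normV u).trans h.le)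

theorem normV_slot (i : Fin 2) (v : VOx L l ΓD i) : normV L l ΓD (slot i v) = ‖v‖ := by
  have h : normV L l ΓD (slot i v) ^ 2 = ‖v‖ ^ 2 := by
    rw [normV_sq, Finset.sum_eq_single i]
    · simp [slot]
    · intro j _ hj
      simp [slot, Pi.single_eq_of_ne hj]
    · exact fun h => absurd (Finset.mem_univ i) h
  exact (sq_eq_sq₀ (normV_nonneg _) (norm_nonneg _)).1 h

theorem Admissible.exists_abs_formB_le (A : Admissible L l ΓD) :
    ∃ M, 0 < M ∧ ∀ (mu : Lam L l) (v : V L l ΓD),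
      |formB L l ΓD mu v| ≤ M * normLam L l mu * normV L l ΓD v := by
  choose C hC0 hC using A.exists_traceOx_le
  obtain ⟨D, hD0, hD⟩ := A.exists_inclGam_le
  -- The summand `1` only ensures strict positivity.
  refine ⟨∑ i, (C i + D) + 1, ?_, fun mu v => ?_⟩
  · have : 0 ≤ ∑ i, (C i + D) := Finset.sum_nonneg fun i _ => add_nonneg (hC0 i) hD0
    linarith
  have h (i : Fin 2) : |(mu i).1 (A.jump i v)| ≤
      (C i + D) * (normLam L l mu * normV L l ΓD v) := by
    have h1 := abs_apply_le A.hL A.hl i (mu i) (A.traceOx i (v.1 i))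
    have h2 := abs_apply_le A.hL A.hl i (mu i) (A.inclGam v.2)
    have h3 : halfNorm L l (A.traceOx i (v.1 i)) ≤ C i * normV L l ΓD v :=
      (hC i _).trans (mul_le_mul_of_nonneg_left (norm_fst_le_normV v i) (hC0 i))
    have h4 : halfNorm L l (A.inclGam v.2) ≤ D * normV L l ΓD v :=
      (hD _).trans (mul_le_mul_of_nonneg_left (norm_snd_le_normV v) hD0)
    have h5 := mul_le_mul (dualNorm_le_normLam mu i) h3 (halfNorm_nonneg _) (normLam_nonneg mu)
    have h6 := mul_le_mul (dualNorm_le_normLam mu i) h4 (halfNorm_nonneg _) (normLam_nonneg mu)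
    rw [A.jump_apply, map_sub]
    refine (abs_sub _ _).trans ?_
    calc _ ≤ normLam L l mu * (C i * normV L l ΓD v) + normLam L l mu * (D * normV L l ΓD v) :=
          add_le_add (h1.trans h5) (h2.trans h6)
      _ = _ := by ring
  rw [A.formB_eq]
  refine (Finset.abs_sum_le_sum_abs _ _).trans ((Finset.sum_le_sum fun i _ => h i).trans ?_)
  rw [← Finset.sum_mul, mul_assoc]
  refine mul_le_mul_of_nonneg_right (by linarith) ?_
  exact mul_nonneg (normLam_nonneg mu) (normV_nonneg v)

/-- Test functions supported in one component reduce `𝐛(𝛌, ·)` to a single pairing and preserve the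
norm, so the supremum `S` satisfies `‖λᵢ‖ ≤ S ‖𝛌‖` for both `i`. Squaring and adding gives `1 ≤ 2
S²`. -/
theorem Admissible.infSupConst (A : Admissible L l ΓD) : InfSupConst L l ΓD (1 / 2) := by
  refine ⟨by norm_num, fun lam hlam => ?_⟩
  obtain ⟨M, hM, hMb⟩ := A.exists_abs_formB_le
  have hN := normLam_pos A.hL A.hl hlam
  have hbdd : BddAbove (range fun v : V L l ΓD =>
      formB L l ΓD lam v / (normLam L l lam * normV L l ΓD v)) := by
    refine ⟨M, ?_⟩
    rintro _ ⟨v, rfl⟩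
    refine div_le_of_le_mul₀ (mul_nonneg hN.le (normV_nonneg v)) hM.le ?_
    rw [← mul_assoc]
    exact (le_abs_self _).trans (hMb lam v)
  set S := ⨆ v : V L l ΓD, formB L l ΓD lam v / (normLam L l lam * normV L l ΓD v)
  set N := normLam L l lam with hNdef
  have key (i : Fin 2) : dualNorm L l i (lam i) ≤ S * N := by
    refine ciSup_le fun w => ?_
    have h := le_ciSup hbdd (slot i ⟨w.1, VInt_le_VOx A.hL A.hl A.subset i w.2⟩)
    simp only [A.formB_slot, normV_slot] at h
    unfold dualQuotient
    rw [← div_le_iff₀ hN, div_div, mul_comm ‖w‖]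
    refine le_trans (le_of_eq ?_) h
    congr 1
    exact pairing_coe (lam i) (A.traceOx i ⟨w.1, VInt_le_VOx A.hL A.hl A.subset i w.2⟩)
  have hS : 0 ≤ S := by
    have := (dualNorm_nonneg A.hL A.hl 0 (lam 0)).trans (key 0)
    exact nonneg_of_mul_nonneg_left this hN
  have h2 : N ^ 2 ≤ 2 * S ^ 2 * N ^ 2 := by
    have hsq := normLam_sq lam
    rw [Fin.sum_univ_two, ← hNdef] at hsq
    have k0 := pow_le_pow_left₀ (dualNorm_nonneg A.hL A.hl 0 (lam 0)) (key 0) 2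
    have k1 := pow_le_pow_left₀ (dualNorm_nonneg A.hL A.hl 1 (lam 1)) (key 1) 2
    rw [mul_pow] at k0 k1
    linarith
  have h3 : 1 ≤ 2 * S ^ 2 := by
    have hp : 0 < N ^ 2 := by positivity
    exact le_of_mul_le_mul_right (by linarith) hp
  nlinarith

end Norms

/-! ### Continuity and coercivity of `𝐚` -/

section FormA

variable {L l : ℝ} {ΓD : Set (ℝ × ℝ)} {d εox εch : ℝ}

theorem integral_mul_eq_inner {α : Type*} [MeasurableSpace α] {m : Measure α} (f g : Lp ℝ 2 m) :
    ∫ x, f x * g x ∂m = inner ℝ f g := by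
  rw [L2.inner_def]
  simp only [RCLike.inner_apply, conj_trivial, mul_comm]

theorem formA_eq (u v : V L l ΓD) :
    formA L l ΓD d εox εch u v =
      (∑ i, εox * ∑ j : Fin 2, inner ℝ ((u.1 i).1 (some j)) ((v.1 i).1 (some j))) +
        d * (εch * inner ℝ (u.2.1 (some 0)) (v.2.1 (some 0))) := by
  unfold formA
  congr 1
  · refine Finset.sum_congr rfl fun i _ => ?_
    rw [integral_const_mul, integral_finsetSum]
    · simp only [← integral_mul_eq_inner]
      rfl
    · exact fun j _ => MemLp.integrable_mul (p := 2) (q := 2) (Lp.memLp ((u.1 i).1 (some j)))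
        (Lp.memLp ((v.1 i).1 (some j)))
  · rw [integral_const_mul, integral_mul_eq_inner]

/-- The form `𝐚` as a bilinear map. -/
def bilinA (L l : ℝ) (ΓD : Set (ℝ × ℝ)) (d εox εch : ℝ) :
    V L l ΓD →ₗ[ℝ] V L l ΓD →ₗ[ℝ] ℝ :=
  LinearMap.mk₂ ℝ (formA L l ΓD d εox εch)
    (fun u u' v => by
      simp only [formA_eq, Prod.fst_add, Prod.snd_add, Pi.add_apply, Submodule.coe_add,
        PiLp.add_apply, inner_add_left, Fin.sum_univ_two]
      ring)
    (fun c u v => by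
      simp only [formA_eq, Prod.smul_fst, Prod.smul_snd, Pi.smul_apply, Submodule.coe_smul,
        PiLp.smul_apply, real_inner_smul_left, Fin.sum_univ_two, smul_eq_mul]
      ring)
    (fun u v v' => by
      simp only [formA_eq, Prod.fst_add, Prod.snd_add, Pi.add_apply, Submodule.coe_add,
        PiLp.add_apply, inner_add_right, Fin.sum_univ_two]
      ring)
    (fun c u v => by
      simp only [formA_eq, Prod.smul_fst, Prod.smul_snd, Pi.smul_apply, Submodule.coe_smul,
        PiLp.smul_apply, real_inner_smul_right, Fin.sum_univ_two, smul_eq_mul]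
      ring)

theorem bilinA_apply (u v : V L l ΓD) :
    bilinA L l ΓD d εox εch u v = formA L l ΓD d εox εch u v := rfl

theorem norm_fst_apply_le_normV (u : V L l ΓD) (i : Fin 2) (o : Option (Fin 2)) :
    ‖(u.1 i).1 o‖ ≤ normV L l ΓD u :=
  (PiLp.norm_apply_le (u.1 i).1 o).trans (norm_fst_le_normV u i)

theorem norm_snd_apply_le_normV (u : V L l ΓD) (o : Option (Fin 1)) :
    ‖u.2.1 o‖ ≤ normV L l ΓD u :=
  (PiLp.norm_apply_le u.2.1 o).trans (norm_snd_le_normV u)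

theorem exists_abs_formA_le (hd : 0 < d) (hox : 0 < εox) (hch : 0 < εch) :
    ∃ α, 0 < α ∧ ∀ u v : V L l ΓD,
      |formA L l ΓD d εox εch u v| ≤ α * normV L l ΓD u * normV L l ΓD v := by
  -- Every inner product in `𝐚` is at most `‖𝐮‖ ‖𝐯‖`, so the coefficients are simply added.
  refine ⟨∑ _i : Fin 2, εox * ∑ _j : Fin 2, 1 + d * (εch * 1), by positivity, fun u v => ?_⟩
  have h (i j : Fin 2) : |inner ℝ ((u.1 i).1 (some j)) ((v.1 i).1 (some j))| ≤
      1 * (normV L l ΓD u * normV L l ΓD v) := by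
    rw [one_mul]
    exact (abs_real_inner_le_norm _ _).trans (mul_le_mul (norm_fst_apply_le_normV u i _)
      (norm_fst_apply_le_normV v i _) (norm_nonneg _) (normV_nonneg u))
  have h' : |inner ℝ (u.2.1 (some 0)) (v.2.1 (some 0))| ≤
      1 * (normV L l ΓD u * normV L l ΓD v) := by
    rw [one_mul]
    exact (abs_real_inner_le_norm _ _).trans (mul_le_mul (norm_snd_apply_le_normV u _)
      (norm_snd_apply_le_normV v _) (norm_nonneg _) (normV_nonneg u))
  rw [formA_eq, mul_assoc, add_mul, Finset.sum_mul]
  refine (abs_add_le _ _).trans (add_le_add ?_ ?_)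
  · refine (Finset.abs_sum_le_sum_abs _ _).trans (Finset.sum_le_sum fun i _ => ?_)
    rw [abs_mul, abs_of_pos hox, mul_assoc, Finset.sum_mul]
    refine mul_le_mul_of_nonneg_left ?_ hox.le
    exact (Finset.abs_sum_le_sum_abs _ _).trans (Finset.sum_le_sum fun j _ => h i j)
  · rw [abs_mul, abs_mul, abs_of_pos hd, abs_of_pos hch, mul_assoc, mul_assoc]
    gcongr

theorem Admissible.exists_coercivityConst (A : Admissible L l ΓD) (hd : 0 < d) (hox : 0 < εox)
    (hch : 0 < εch) : ∃ α, CoercivityConst L l ΓD d εox εch α := by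
  choose C hC0 hC using exists_poincare_VOx A.hL A.hl A.disjoint
  -- `D` exceeds each of the three Poincaré constants by at least one, so every full norm is bounded
  -- by `D` times the gradient part.
  set D := 1 + (∑ i, C i) + 2 * L ^ 2 with hD
  have hCs : 0 ≤ ∑ i, C i := Finset.sum_nonneg fun i _ => hC0 i
  have hL2 : 0 ≤ 2 * L ^ 2 := by positivity
  have hD0 : 0 < D := by linarith
  have hm : 0 < min εox (d * εch) := lt_min hox (mul_pos hd hch)
  refine ⟨min εox (d * εch) / D, div_pos hm hD0, fun u => ?_⟩
  have h1 (i : Fin 2) : ‖u.1 i‖ ^ 2 ≤ D * ∑ j, ‖(u.1 i).1 (some j)‖ ^ 2 := by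
    have e : ‖u.1 i‖ ^ 2 = ‖(u.1 i).1 none‖ ^ 2 + ∑ j, ‖(u.1 i).1 (some j)‖ ^ 2 := by
      rw [Submodule.coe_norm, PiLp.norm_sq_eq_of_L2, Fintype.sum_option]
    have p : 0 ≤ ∑ j, ‖(u.1 i).1 (some j)‖ ^ 2 := Finset.sum_nonneg fun _ _ => sq_nonneg _
    have k := hC i _ (u.1 i).2
    have k2 : C i ≤ ∑ i, C i :=
      Finset.single_le_sum (f := C) (fun i _ => hC0 i) (Finset.mem_univ i)
    have k3 : (C i + 1) * ∑ j, ‖(u.1 i).1 (some j)‖ ^ 2 ≤ D * ∑ j, ‖(u.1 i).1 (some j)‖ ^ 2 :=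
      mul_le_mul_of_nonneg_right (by linarith) p
    rw [e]
    linarith
  have h2 : ‖u.2‖ ^ 2 ≤ D * ‖u.2.1 (some 0)‖ ^ 2 := by
    have e : ‖u.2‖ ^ 2 = ‖u.2.1 none‖ ^ 2 + ‖u.2.1 (some 0)‖ ^ 2 := by
      rw [Submodule.coe_norm, PiLp.norm_sq_eq_of_L2, Fintype.sum_option, Fin.sum_univ_one]
    have k := poincare_VGam A.hL u.2.2
    have k3 : (2 * L ^ 2 + 1) * ‖u.2.1 (some 0)‖ ^ 2 ≤ D * ‖u.2.1 (some 0)‖ ^ 2 :=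
      mul_le_mul_of_nonneg_right (by linarith) (sq_nonneg _)
    rw [e]
    linarith
  have h3 : normV L l ΓD u ^ 2 ≤ D * ((∑ i, ∑ j, ‖(u.1 i).1 (some j)‖ ^ 2) +
      ‖u.2.1 (some 0)‖ ^ 2) := by
    rw [normV_sq, mul_add, Finset.mul_sum]
    exact add_le_add (Finset.sum_le_sum fun i _ => h1 i) h2
  rw [div_mul_eq_mul_div, div_le_iff₀ hD0, formA_eq]
  simp only [real_inner_self_eq_norm_sq]
  rw [← Finset.mul_sum, ← mul_assoc d]
  set X := ∑ i, ∑ j, ‖(u.1 i).1 (some j)‖ ^ 2 with hX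
  have pX : 0 ≤ X := Finset.sum_nonneg fun _ _ => Finset.sum_nonneg fun _ _ => sq_nonneg _
  set Y := ‖u.2.1 (some 0)‖ ^ 2
  have pY : 0 ≤ Y := sq_nonneg _
  have k1 := mul_le_mul_of_nonneg_right (min_le_left εox (d * εch)) pX
  have k2 := mul_le_mul_of_nonneg_right (min_le_right εox (d * εch)) pY
  calc _ ≤ min εox (d * εch) * (D * (X + Y)) := mul_le_mul_of_nonneg_left h3 hm.le
    _ = D * (min εox (d * εch) * X + min εox (d * εch) * Y) := by ring
    _ ≤ D * (εox * X + d * εch * Y) := mul_le_mul_of_nonneg_left (add_le_add k1 k2) hD0.le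
    _ = _ := mul_comm _ _

end FormA

/-! ### Well-posedness -/

section Abstract

variable {H : Type*} [NormedAddCommGroup H] [InnerProductSpace ℝ H] [CompleteSpace H]

/-- The Lax-Milgram theorem on a closed subspace. -/
theorem exists_mem_forall_eq (a : H →ₗ[ℝ] H →ₗ[ℝ] ℝ) {α c : ℝ}
    (ha : ∀ u v, |a u v| ≤ α * ‖u‖ * ‖v‖) (hc : 0 < c) (hcoer : ∀ u, c * ‖u‖ ^ 2 ≤ a u u)
    (K : Submodule ℝ H) (hK : IsClosed (K : Set H)) (f : H →ₗ[ℝ] ℝ) {D : ℝ}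
    (hf : ∀ v, |f v| ≤ D * ‖v‖) : ∃ u ∈ K, ∀ v ∈ K, a u v = f v := by
  have : CompleteSpace K := hK.completeSpace_coe
  let B : K →L[ℝ] K →L[ℝ] ℝ := LinearMap.mkContinuous₂ (a.domRestrict₁₂ K K) α
    fun u v => ha u v
  have hB : IsCoercive B := ⟨c, hc, fun u => by
    rw [mul_assoc, ← pow_two]
    exact hcoer u⟩
  let F : K →L[ℝ] ℝ := LinearMap.mkContinuous (f.domRestrict K) D fun v => hf v
  let u := hB.continuousLinearEquivOfBilin.symm ((InnerProductSpace.toDual ℝ K).symm F)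
  refine ⟨u, u.2, fun v hv => ?_⟩
  have h := hB.continuousLinearEquivOfBilin_apply u ⟨v, hv⟩
  rw [ContinuousLinearEquiv.apply_symm_apply, InnerProductSpace.toDual_symm_apply] at h
  exact h.symm

/-- The variational problem on the common kernel of bounded functionals, on a space `W` with a
Hilbert norm `N`. -/
theorem exists_forall_eq_on_kernel {W ι : Type*} [AddCommGroup W] [Module ℝ W] (e : H ≃ₗ[ℝ] W)
    {N : W → ℝ} (hN : ∀ u, N (e u) = ‖u‖) (a : W →ₗ[ℝ] W →ₗ[ℝ] ℝ) {α c : ℝ}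
    (ha : ∀ u v, |a u v| ≤ α * N u * N v) (hc : 0 < c) (hcoer : ∀ u, c * N u ^ 2 ≤ a u u)
    (b : ι → W →ₗ[ℝ] ℝ) {M : ι → ℝ} (hb : ∀ i v, |b i v| ≤ M i * N v)
    (f : W →ₗ[ℝ] ℝ) {D : ℝ} (hf : ∀ v, |f v| ≤ D * N v) :
    ∃ u, (∀ i, b i u = 0) ∧ ∀ v, (∀ i, b i v = 0) → a u v = f v := by
  let B (i : ι) : H →L[ℝ] ℝ := (b i ∘ₗ e.toLinearMap).mkContinuous (M i) fun v => by
    rw [← hN]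
    exact hb i _
  let K : Submodule ℝ H := ⨅ i, (B i).ker
  have hmem (v : H) : v ∈ K ↔ ∀ i, b i (e v) = 0 := by
    simp only [K, Submodule.mem_iInf]
    rfl
  have hK : IsClosed (K : Set H) := by
    simp only [K, Submodule.coe_iInf]
    exact isClosed_iInter fun i => (B i).isClosed_ker
  obtain ⟨u, huK, hu⟩ := exists_mem_forall_eq (a.compl₁₂ e.toLinearMap e.toLinearMap) (α := α)
    (c := c) (fun u v => by rw [← hN, ← hN]; exact ha _ _) hc
    (fun u => by rw [← hN]; exact hcoer _) K hK (f ∘ₗ e.toLinearMap) (D := D)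
    (fun v => by rw [← hN]; exact hf _)
  refine ⟨e u, (hmem u).1 huK, fun v hv => ?_⟩
  have h := hu (e.symm v) ((hmem _).2 fun i => by rw [e.apply_symm_apply]; exact hv i)
  simpa only [LinearMap.compl₁₂_apply, LinearMap.comp_apply, LinearEquiv.coe_coe,
    e.apply_symm_apply] using h

end Abstract

/-! ### Existence, uniqueness and stability -/

section WellPosed

variable {L l : ℝ} {ΓD : Set (ℝ × ℝ)} {d εox εch : ℝ}

/-- The Hilbert space structure on `𝐕`. -/
abbrev HilbertV (L l : ℝ) (ΓD : Set (ℝ × ℝ)) : Type :=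
  WithLp 2 (PiLp 2 (fun i : Fin 2 => VOx L l ΓD i) × VGam L)

instance : InnerProductSpace ℝ (HilbertV L l ΓD) :=
  WithLp.instProdInnerProductSpace

/-- The identification of the Hilbert space with `𝐕`. -/
def toV (L l : ℝ) (ΓD : Set (ℝ × ℝ)) : HilbertV L l ΓD ≃ₗ[ℝ] V L l ΓD :=
  (WithLp.linearEquiv 2 ℝ _).trans
    ((WithLp.linearEquiv 2 ℝ _).prodCongr (LinearEquiv.refl ℝ _))

/-- `𝐕` as a plain product carries the maximum norm; Lax-Milgram needs the Euclidean one, which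
comes from an inner product. -/
theorem normV_toV (u : HilbertV L l ΓD) : normV L l ΓD (toV L l ΓD u) = ‖u‖ := by
  refine (sq_eq_sq₀ (normV_nonneg _) (norm_nonneg _)).1 ?_
  rw [normV_sq, WithLp.prod_norm_sq_eq_of_L2, PiLp.norm_sq_eq_of_L2]
  rfl

theorem completeSpace_HilbertV (hL : 0 < L) (hl : 0 < l) : CompleteSpace (HilbertV L l ΓD) := by
  have h1 (i : Fin 2) : CompleteSpace (VOx L l ΓD i) :=
    (isClosed_H1zero hL (lo_lt_hi hl i) _).completeSpace_coe
  have h2 : CompleteSpace (VGam L) := (isClosed_VGam L).completeSpace_coe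
  infer_instance

/-- The form `𝐛(𝛍, ·)` as a linear map. -/
def Admissible.linB (A : Admissible L l ΓD) (mu : Lam L l) : V L l ΓD →ₗ[ℝ] ℝ :=
  ∑ i, (mu i).1 ∘ₗ A.jump i

theorem Admissible.linB_apply (A : Admissible L l ΓD) (mu : Lam L l) (v : V L l ΓD) :
    A.linB mu v = formB L l ΓD mu v := by
  rw [A.formB_eq, Admissible.linB, LinearMap.sum_apply]
  rfl

theorem Admissible.formB_sub (A : Admissible L l ΓD) (mu nu : Lam L l) (v : V L l ΓD) :
    formB L l ΓD (mu - nu) v = formB L l ΓD mu v - formB L l ΓD nu v := by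
  simp only [A.formB_eq, ← Finset.sum_sub_distrib]
  rfl

/-- The linear functional `𝐯 ↦ ∫_γ ρ v_γ`. -/
def load (ΓD : Set (ℝ × ℝ)) (l : ℝ) (ρ : L2 (Ioo 0 L)) : V L l ΓD →ₗ[ℝ] ℝ where
  toFun v := inner ℝ ρ (v.2.1 none)
  map_add' _ _ := inner_add_right _ _ _
  map_smul' _ _ := real_inner_smul_right _ _ _

theorem load_apply (ρ : L2 (Ioo 0 L)) (v : V L l ΓD) :
    load ΓD l ρ v = ∫ x in Ioo 0 L, ρ x * v.2.1 none x :=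
  (integral_mul_eq_inner _ _).symm

theorem abs_load_le (ρ : L2 (Ioo 0 L)) (v : V L l ΓD) :
    |load ΓD l ρ v| ≤ ‖ρ‖ * normV L l ΓD v :=
  (abs_real_inner_le_norm _ _).trans
    (mul_le_mul_of_nonneg_left (norm_snd_apply_le_normV v none) (norm_nonneg ρ))

/-- A bounded functional on `𝐕` that vanishes on functions without jumps is `𝐛(𝛌, ·)` for
some `𝛌`. -/
theorem Admissible.exists_lam (A : Admissible L l ΓD) (F : V L l ΓD →ₗ[ℝ] ℝ) {D : ℝ}
    (hD : 0 ≤ D) (hF : ∀ v, |F v| ≤ D * normV L l ΓD v)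
    (h0 : ∀ v, (∀ i, A.jump i v = 0) → F v = 0) :
    ∃ lam : Lam L l, ∀ v, formB L l ΓD lam v = F v := by
  have hsurj (i : Fin 2) : Function.Surjective (A.traceOx i) := fun σ => by
    obtain ⟨w, hw, hσ⟩ := exists_VInt_of_Hhalf A.hL A.hl i σ
    exact ⟨⟨w, VInt_le_VOx A.hL A.hl A.subset i hw⟩,
      Subtype.ext (traceOnInterface_eq A.hL (lo_lt_hi A.hl i) hσ)⟩
  -- These right inverses are only linear. Boundedness of `λᵢ` follows afterwards, since the value
  -- does not depend on the chosen extension.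
  choose s hs using fun i => (A.traceOx i).exists_rightInverse_of_surjective
    (LinearMap.range_eq_top.2 (hsurj i))
  have hs' (i : Fin 2) (σ : Hhalf L l) : A.traceOx i (s i σ) = σ := LinearMap.congr_fun (hs i) σ
  -- Two extensions with the same trace differ by a function without jumps, on which `F` vanishes.
  have hval (i : Fin 2) (w : VOx L l ΓD i) :
      F (slot i (s i (A.traceOx i w))) = F (slot i w) := by
    rw [← sub_eq_zero, ← map_sub, ← map_sub]
    refine h0 _ fun j => ?_
    by_cases hj : j = i
    · subst hj
      rw [A.jump_slot_self, map_sub, hs', sub_self]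
    · exact A.jump_slot_of_ne hj _
  refine ⟨fun i => ⟨F ∘ₗ slot i ∘ₗ s i, D, fun σ => ?_⟩, fun v => ?_⟩
  · refine le_mul_halfNorm A.hL A.hl i hD fun w hw hσ => ?_
    have e : A.traceOx i ⟨w, VInt_le_VOx A.hL A.hl A.subset i hw⟩ = σ :=
      Subtype.ext (traceOnInterface_eq A.hL (lo_lt_hi A.hl i) hσ)
    change |F (slot i (s i σ))| ≤ _
    rw [← e, hval]
    refine (hF _).trans (le_of_eq ?_)
    rw [normV_slot]
    rfl
  · rw [A.formB_eq]
    change ∑ i, F (slot i (s i (A.jump i v))) = F v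
    -- Subtracting from `𝐯` the extensions of its own jumps leaves a function without jumps.
    rw [← map_sum, ← sub_eq_zero, ← map_sub]
    refine h0 _ fun j => ?_
    rw [map_sub, map_sum, Finset.sum_eq_single j, A.jump_slot_self, hs', sub_self]
    · exact fun i _ hi => A.jump_slot_of_ne hi.symm _
    · exact fun h => absurd (Finset.mem_univ j) h

theorem Admissible.exists_isSolution (A : Admissible L l ΓD) (hd : 0 < d) (hox : 0 < εox)
    (hch : 0 < εch) (ρ : L2 (Ioo 0 L)) : ∃ p, IsSolution L l ΓD d εox εch ρ p := by
  obtain ⟨α, hα, ha⟩ := exists_abs_formA_le (L := L) (l := l) (ΓD := ΓD) hd hox hch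
  obtain ⟨c, hc, hcoer⟩ := A.exists_coercivityConst hd hox hch
  obtain ⟨M, hM, hMb⟩ := A.exists_abs_formB_le
  have := completeSpace_HilbertV (ΓD := ΓD) A.hL A.hl
  obtain ⟨u, huK, hu⟩ := exists_forall_eq_on_kernel (toV L l ΓD) normV_toV
    (bilinA L l ΓD d εox εch) ha hc hcoer A.linB (M := fun mu => M * normLam L l mu)
    (fun mu v => by rw [A.linB_apply]; exact hMb mu v) (load ΓD l ρ) (abs_load_le ρ)
  -- A function without jumps lies in the kernel of every `𝐛(𝛍, ·)`, so the residual vanishes on it;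
  -- the converse inclusion plays no role.
  obtain ⟨lam, hlam⟩ := A.exists_lam (bilinA L l ΓD d εox εch u - load ΓD l ρ)
    (D := α * normV L l ΓD u + ‖ρ‖)
    (add_nonneg (mul_nonneg hα.le (normV_nonneg _)) (norm_nonneg _))
    (fun v => by
      rw [add_mul]
      exact (abs_sub _ _).trans (add_le_add (ha _ _) (abs_load_le ρ v)))
    (fun v hv => sub_eq_zero.2 (hu v fun mu => by
      rw [A.linB_apply, A.formB_eq]
      exact Finset.sum_eq_zero fun i _ => by rw [hv i, map_zero]))
  refine ⟨(u, lam), fun v => ?_, fun mu => (A.linB_apply mu u).symm.trans (huK mu)⟩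
  rw [hlam, ← load_apply]
  exact sub_sub_cancel _ _

theorem Admissible.isSolution_unique (A : Admissible L l ΓD) (hd : 0 < d) (hox : 0 < εox)
    (hch : 0 < εch) {ρ : L2 (Ioo 0 L)} {p q : V L l ΓD × Lam L l}
    (hp : IsSolution L l ΓD d εox εch ρ p) (hq : IsSolution L l ΓD d εox εch ρ q) : p = q := by
  obtain ⟨c, hc, hcoer⟩ := A.exists_coercivityConst hd hox hch
  obtain ⟨u, lam⟩ := p
  obtain ⟨u', lam'⟩ := q
  obtain ⟨hp1, hp2⟩ := hp
  obtain ⟨hq1, hq2⟩ := hq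
  simp only at hp1 hp2 hq1 hq2
  have h1 (v : V L l ΓD) : bilinA L l ΓD d εox εch (u - u') v =
      formB L l ΓD (lam - lam') v := by
    have k1 := hp1 v
    have k2 := hq1 v
    rw [← bilinA_apply] at k1 k2
    rw [A.formB_sub, LinearMap.map_sub, LinearMap.sub_apply]
    linarith
  have h2 (mu : Lam L l) : formB L l ΓD mu (u - u') = 0 := by
    rw [← A.linB_apply, LinearMap.map_sub, A.linB_apply, A.linB_apply, hp2, hq2, sub_zero]
  have h3 : u - u' = 0 := by
    have k := hcoer (u - u')
    rw [← bilinA_apply, h1, h2] at k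
    refine eq_zero_of_normV_eq_zero ?_
    have k2 : normV L l ΓD (u - u') ^ 2 ≤ 0 := by
      by_contra hne
      exact absurd k (not_le.2 (mul_pos hc (not_le.1 hne)))
    exact (pow_eq_zero_iff two_ne_zero).1 (le_antisymm k2 (sq_nonneg _))
  -- Once the `𝐮` parts agree, `𝐛(𝛌 - 𝛌', ·)` is zero, and the inf-sup condition would read `1/2 ≤
  -- 0`.
  have h4 : lam - lam' = 0 := by
    by_contra hne
    have k := A.infSupConst.2 _ hne
    have k2 (v : V L l ΓD) : formB L l ΓD (lam - lam') v = 0 := by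
      rw [← h1, h3, LinearMap.map_zero, LinearMap.zero_apply]
    simp only [k2, zero_div, ciSup_const] at k
    norm_num at k
  have h5 : u = u' := sub_eq_zero.1 h3
  have h6 : lam = lam' := sub_eq_zero.1 h4
  rw [h5, h6]

theorem normV_le_of_isSolution {ρ : L2 (Ioo 0 L)} {p : V L l ΓD × Lam L l}
    (hp : IsSolution L l ΓD d εox εch ρ p) {α₂ : ℝ}
    (h₂ : CoercivityConst L l ΓD d εox εch α₂) : normV L l ΓD p.1 ≤ 1 / α₂ * ‖ρ‖ := by
  have h := hp.1 p.1
  rw [hp.2, sub_zero, ← load_apply] at h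
  have h1 := (h₂.2 p.1).trans (h.le.trans ((le_abs_self _).trans (abs_load_le ρ p.1)))
  rw [one_div, ← div_eq_inv_mul, le_div_iff₀ h₂.1]
  -- One factor `‖𝐮‖` is cancelled, which requires it to be nonzero.
  rcases (normV_nonneg p.1).eq_or_lt with h0 | h0
  · rw [← h0, zero_mul]
    exact norm_nonneg ρ
  · refine le_of_mul_le_mul_right ?_ h0
    linarith [pow_two (normV L l ΓD p.1)]

theorem Admissible.normLam_le_of_isSolution (A : Admissible L l ΓD) {ρ : L2 (Ioo 0 L)}
    {p : V L l ΓD × Lam L l} (hp : IsSolution L l ΓD d εox εch ρ p) {α₁ α₂ β : ℝ}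
    (h₁ : ContinuityConst L l ΓD d εox εch α₁) (h₂ : CoercivityConst L l ΓD d εox εch α₂)
    (hβ : InfSupConst L l ΓD β) :
    normLam L l p.2 ≤ 1 / β * (1 + α₁ / α₂) * ‖ρ‖ := by
  have hu := normV_le_of_isSolution hp h₂
  have hα₁ := h₁.1
  have hα₂ := h₂.1
  have hβ0 := hβ.1
  set R := (1 + α₁ / α₂) * ‖ρ‖ with hR
  have hR0 : 0 ≤ R := by positivity
  rw [mul_assoc, one_div, ← div_eq_inv_mul, le_div_iff₀ hβ0]
  -- The inf-sup condition says nothing about `𝛌 = 0`, where the norm is computed directly.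
  rcases eq_or_ne p.2 0 with h0 | hne
  · have hz (i : Fin 2) : dualNorm L l i (0 : HhalfDual L l) = 0 := by
      have k (v : VInt L l i) : dualQuotient L l i 0 v = 0 := by
        unfold dualQuotient pairing
        split_ifs <;> simp
      unfold dualNorm
      simp only [k, ciSup_const]
    have hn : normLam L l (0 : Lam L l) = 0 := by
      unfold normLam
      simp [hz]
    rw [h0, hn, zero_mul]
    exact hR0
  · have hN := normLam_pos A.hL A.hl hne
    -- The first equation gives `𝐛(𝛌, 𝐯) = 𝐚(𝐮, 𝐯) - ∫ ρ v_γ`, and `‖𝐮‖` is already bounded by `‖ρ‖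
    -- / α₂`.
    have hb (v : V L l ΓD) : formB L l ΓD p.2 v ≤ R * normV L l ΓD v := by
      have k1 := hp.1 v
      rw [← load_apply] at k1
      have k2 := h₁.2 p.1 v
      have k3 := neg_le_of_abs_le (abs_load_le ρ v)
      have k4 : α₁ * normV L l ΓD p.1 * normV L l ΓD v ≤
          α₁ * (1 / α₂ * ‖ρ‖) * normV L l ΓD v :=
        mul_le_mul_of_nonneg_right (mul_le_mul_of_nonneg_left hu hα₁.le) (normV_nonneg v)
      have e : R * normV L l ΓD v =
          α₁ * (1 / α₂ * ‖ρ‖) * normV L l ΓD v + ‖ρ‖ * normV L l ΓD v := by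
        rw [hR]
        ring
      rw [e]
      linarith
    have h := (hβ.2 _ hne).trans (ciSup_le (c := R / normLam L l p.2) fun v => ?_)
    · rw [le_div_iff₀ hN] at h
      linarith
    · refine div_le_of_le_mul₀ (mul_nonneg hN.le (normV_nonneg v)) (by positivity) ?_
      rw [← mul_assoc, div_mul_cancel₀ _ hN.ne']
      exact hb v

end WellPosed

end InterfaceProblem

end

theorem mainTheorem1 (L l d εox εch : ℝ) (hL : 0 < L) (hl : 0 < l) (hd : 0 < d)
    (hεox : 0 < εox) (hεch : 0 < εch) (ΓD : Set (ℝ × ℝ))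
    (hΓD : ΓD ⊆ frontier (InterfaceProblem.device L l))
    (hΓN : Disjoint (closure (frontier (InterfaceProblem.device L l) \ ΓD))
      (closure (InterfaceProblem.interface L))) :
    -- the trace of a function in `Vⁱ` is well defined on `γ` and belongs to `H^{1/2}₀₀(γ)`
    (∀ i, ∀ v ∈ InterfaceProblem.VOx L l ΓD i,
      (∃! σ, InterfaceProblem.IsTraceOnInterface L (InterfaceProblem.lo l i)
        (InterfaceProblem.hi l i) v σ) ∧
      InterfaceProblem.traceOnInterface L (InterfaceProblem.lo l i) (InterfaceProblem.hi l i) v ∈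
        InterfaceProblem.Hhalf L l) ∧
    -- functions in `V^γ` belong to `H^{1/2}₀₀(γ)`
    (∀ w ∈ InterfaceProblem.VGam L, w none ∈ InterfaceProblem.Hhalf L l) ∧
    -- the norms of `Λ¹` and `Λ²` are finite
    (∀ i mu, BddAbove (Set.range (InterfaceProblem.dualQuotient L l i mu))) ∧
    -- the constants exist
    (∃ α₁, InterfaceProblem.ContinuityConst L l ΓD d εox εch α₁) ∧
    (∃ α₂, InterfaceProblem.CoercivityConst L l ΓD d εox εch α₂) ∧
    (∃ M, InterfaceProblem.ContinuityConstB L l ΓD M) ∧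
    (∃ β, InterfaceProblem.InfSupConst L l ΓD β) ∧
    -- existence, uniqueness and bounds
    ∀ ρ : InterfaceProblem.L2 (Set.Ioo 0 L),
      (∃! p : InterfaceProblem.V L l ΓD × InterfaceProblem.Lam L l,
        InterfaceProblem.IsSolution L l ΓD d εox εch ρ p) ∧
      ∀ p : InterfaceProblem.V L l ΓD × InterfaceProblem.Lam L l,
        InterfaceProblem.IsSolution L l ΓD d εox εch ρ p →
        ∀ α₁ α₂ β : ℝ, InterfaceProblem.ContinuityConst L l ΓD d εox εch α₁ →
          InterfaceProblem.CoercivityConst L l ΓD d εox εch α₂ →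
          InterfaceProblem.InfSupConst L l ΓD β →
          InterfaceProblem.normV L l ΓD p.1 ≤ 1 / α₂ * ‖ρ‖ ∧
          InterfaceProblem.normLam L l p.2 ≤ 1 / β * (1 + α₁ / α₂) * ‖ρ‖ := by
  have A : InterfaceProblem.Admissible L l ΓD := ⟨hL, hl, hΓD, hΓN⟩
  refine ⟨fun i v hv => ⟨A.existsUnique_trace hv, A.traceOnInterface_mem hv⟩,
    fun w hw => InterfaceProblem.VGam_mem_Hhalf hL hl hw,
    InterfaceProblem.bddAbove_dualQuotient hL hl, ?_, A.exists_coercivityConst hd hεox hεch, ?_,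
    ⟨1 / 2, A.infSupConst⟩, fun ρ => ⟨?_, fun p hp α₁ α₂ β h₁ h₂ hβ =>
      ⟨InterfaceProblem.normV_le_of_isSolution hp h₂,
        A.normLam_le_of_isSolution hp h₁ h₂ hβ⟩⟩⟩
  · obtain ⟨α, hα, h⟩ := InterfaceProblem.exists_abs_formA_le (L := L) (l := l) (ΓD := ΓD)
      hd hεox hεch
    exact ⟨α, hα, fun u v => (le_abs_self _).trans (h u v)⟩
  · obtain ⟨M, hM, h⟩ := A.exists_abs_formB_le
    exact ⟨M, hM, fun mu v => (le_abs_self _).trans (h mu v)⟩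
  · obtain ⟨p, hp⟩ := A.exists_isSolution hd hεox hεch ρ
    exact ⟨p, hp, fun q hq => A.isSolution_unique hd hεox hεch hq hp⟩
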